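/- A Wheeler graph is a finite directed multigraph $G$ with edge labels from a totally ordered alphabet whose vertices admit a Wheeler order $\pi$: a total order in which the vertices of in-degree $0$ precede those of positive in-degree and in which, for all edges $(u,v)$ and $(u',v')$ labelled $a$ and $a'$, $a\prec a'$ implies $v<v'$, and $a=a'$ together with $u<u'$ implies $v\le v'$. Let $G$ be a Wheeler graph with $n$ vertices and Wheeler order $\pi$. Suppose that the number of edges and the alphabet size are polynomial in $n$, i.e. at most $c\,n^c$ for some constant $c$. Let $B$ be the Burrows–Wheeler transform of $G$ according to $\pi$, that is, the list of all edge labels sorted by the rank in $\pi$ of the edge's source, with the out-edges of a single vertex sorted by the rank of their targets. Let $r$ be the number of runs (maximal non-empty unary substrings) of $B$. Let $D$ be a decomposition of $G$ into $\upsilon$ edge-disjoint directed paths (every edge lies on exactly one of them; a path may be closed) whose internal vertices each have in- and out-degree exactly $1$. Let the vertices have distinct identifiers in $\{0,\dots,n-1\}$ such that for every edge $(u,v)$ for which neither $u$ nor $v$ is an endpoint of a path in $D$, the identifier of $v$ is that of $u$ plus $1$. Then, on a word RAM with words of $\Theta(\log n)$ bits, $G$ can be stored in $O(r+\upsilon)$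 words so that, given any pattern $P$ over the alphabet, the vertices of $G$ reachable by directed paths labelled $P$ can be counted in $O(|P|\log\log n)$ time, after which the identifiers of those vertices can be reported, each exactly once, in $O(\log\log n)$ time per vertex. The constants, including those of the word length, and the query programs depend only on $c$. (Here $|P|$, $r+\upsilon$ and $\log\log n$ are to be read as at least $1$.) -/

import Mathlib

namespace WheelerIndex

/-! ### Edge-labelled directed multigraphs -/

/-- A directed multigraph with vertices `V`, edges `E` (parallel edges and loops are allowed) and
edge labels in `A`. -/
structure LabelledDigraph (V E A : Type) where
  src : E → V
  tgt : E → V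
  label : E → A

namespace LabelledDigraph

variable {V E A : Type} (G : LabelledDigraph V E A)

/-- In-degree, counted with multiplicity. -/
noncomputable def inDeg (v : V) : ℕ := Set.ncard {e : E | G.tgt e = v}

/-- Out-degree, counted with multiplicity. -/
noncomputable def outDeg (v : V) : ℕ := Set.ncard {e : E | G.src e = v}

/-- `G.PathLabelled u P v`: there is a directed path from `u` to `v` whose edge labels, in the order
in which the edges are traversed, spell `P`. -/
inductive PathLabelled : V → List A → V → Prop
  | nil (u : V) : PathLabelled u [] u
  | cons (e : E) {P : List A} {v : V} (h : PathLabelled (G.tgt e) P v) :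
      PathLabelled (G.src e) (G.label e :: P) v

/-- The set of vertices that are reachable (from anywhere) by a directed path labelled `P`. -/
def reached (P : List A) : Set V := {v | ∃ u, G.PathLabelled u P v}

/-- `π`, which gives each vertex its rank, is a Wheeler order of `G`. -/
structure IsWheelerOrder [LinearOrder A] {n : ℕ} (π : V ≃ Fin n) : Prop where
  sources_first : ∀ u v, G.inDeg u = 0 → 0 < G.inDeg v → π u < π v
  lt_of_label_lt : ∀ e e', G.label e < G.label e' → π (G.tgt e) < π (G.tgt e')
  le_of_label_eq : ∀ e e', G.label e = G.label e' → π (G.src e) < π (G.src e') →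
    π (G.tgt e) ≤ π (G.tgt e')

/-- `B` is the Burrows-Wheeler transform of `G` according to `π`: all edge labels, listed in the
order of the ranks of the edges' sources, where the out-edges of one vertex are listed in the order
of the ranks of their targets. -/
def IsBWT {n : ℕ} (π : V ≃ Fin n) (B : List A) : Prop :=
  ∃ es : List E, es.Nodup ∧ (∀ e, e ∈ es) ∧
    es.Pairwise (fun e e' => π (G.src e) < π (G.src e') ∨
      (G.src e = G.src e' ∧ π (G.tgt e) ≤ π (G.tgt e'))) ∧
    B = es.map G.label

/-- `D` decomposes `G` into edge-disjoint directed paths, each given by the nonempty list of its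
edges: every edge lies on exactly one path of `D`, once, and every internal vertex of a path of `D`
has in-degree and out-degree exactly 1. (A path may be closed.) -/
structure IsPathDecomposition (D : List (List E)) : Prop where
  ne_nil : ∀ p ∈ D, p ≠ []
  consecutive : ∀ p ∈ D, p.IsChain (fun e e' => G.tgt e = G.src e')
  internal : ∀ p ∈ D, p.IsChain (fun e _ => G.inDeg (G.tgt e) = 1 ∧ G.outDeg (G.tgt e) = 1)
  nodup : D.flatten.Nodup
  cover : ∀ e, e ∈ D.flatten

/-- `v` is the first or the last vertex of a path in `D`. -/
def IsEndpoint (D : List (List E)) (v : V) : Prop :=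
  ∃ p ∈ D, ∃ h : p ≠ [], v = G.src (p.head h) ∨ v = G.tgt (p.getLast h)

/-- The numeric identifiers of the vertices increase by 1 along every edge neither of whose ends is
an endpoint of a path in `D`. -/
def IsIdentifierAssignment {n : ℕ} (D : List (List E)) (ident : V ≃ Fin n) : Prop :=
  ∀ e, ¬ G.IsEndpoint D (G.src e) → ¬ G.IsEndpoint D (G.tgt e) →
    (ident (G.tgt e) : ℕ) = (ident (G.src e) : ℕ) + 1

end LabelledDigraph

/-- The number of runs (maximal nonempty unary substrings) of a string. -/
def runs {A : Type} [DecidableEq A] (B : List A) : ℕ :=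
  (B.splitBy (fun a b => decide (a = b))).length

/-! ### The word RAM

Words have `w` bits. A query is answered by a fixed program with finitely many registers, each
holding one word. The program has random access to the read-only memory `mem`, which holds the data
structure, and reads its input (the pattern) letter by letter. Every instruction and every
evaluation of a branch or loop condition takes one step. -/

/-- Binary operations on words. -/
inductive BinOp
  | add | sub | mul | div | mod | and | or | xor | shl | shr | lt | eq

/-- The value of a binary operation before reduction modulo `2 ^ w`. Subtraction is modulo `2 ^ w`;
a quotient by 0 is 0. -/
def BinOp.eval (w : ℕ) : BinOp → ℕ → ℕ → ℕ
  | add, a, b => a + b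
  | sub, a, b => a + (2 ^ w - b)
  | mul, a, b => a * b
  | div, a, b => a / b
  | mod, a, b => a % b
  | and, a, b => a &&& b
  | or, a, b => a ||| b
  | xor, a, b => a ^^^ b
  | shl, a, b => a <<< b
  | shr, a, b => a >>> b
  | lt, a, b => if a < b then 1 else 0
  | eq, a, b => if a = b then 1 else 0

/-- Programs. Registers are named by natural numbers. -/
inductive Prog
  /-- do nothing -/
  | skip
  /-- `reg d := k` -/
  | const (d k : ℕ)
  /-- `reg d := o (reg a) (reg b)` -/
  | op (o : BinOp) (d a b : ℕ)
  /-- `reg d := mem[reg a]` -/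
  | load (d a : ℕ)
  /-- if a letter of the input is left, then take it off the input, put it into `reg d`, and set
  `reg f := 1`; otherwise set `reg f := 0` -/
  | read (d f : ℕ)
  /-- first `p`, then `q` -/
  | seq (p q : Prog)
  /-- if `reg a ≠ 0` then `p` else `q` -/
  | cond (a : ℕ) (p q : Prog)
  /-- while `reg a ≠ 0` do `p` -/
  | loop (a : ℕ) (p : Prog)

/-- The registers and the part of the input that has not been read. -/
structure State where
  reg : ℕ → ℕ
  input : List ℕ

/-- The initial state: all registers are 0. -/
def State.init (input : List ℕ) : State := ⟨fun _ => 0, input⟩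

/-- Assign a value to a register, modulo `2 ^ w`. -/
def State.set (w : ℕ) (s : State) (d x : ℕ) : State :=
  ⟨Function.update s.reg d (x % 2 ^ w), s.input⟩

/-- `Exec w mem p s t s'`: on a machine with `w`-bit words and memory `mem`, the program `p` started
in the state `s` stops after exactly `t` steps, in the state `s'`. -/
inductive Exec (w : ℕ) (mem : List ℕ) : Prog → State → ℕ → State → Prop
  | skip (s) : Exec w mem .skip s 1 s
  | const (d k s) : Exec w mem (.const d k) s 1 (s.set w d k)
  | op (o d a b s) : Exec w mem (.op o d a b) s 1 (s.set w d (o.eval w (s.reg a) (s.reg b)))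
  | load (d a s) : Exec w mem (.load d a) s 1 (s.set w d (mem.getD (s.reg a) 0))
  | read_cons (d f r x xs) :
      Exec w mem (.read d f) ⟨r, x :: xs⟩ 1 (((⟨r, xs⟩ : State).set w d x).set w f 1)
  | read_nil (d f r) :
      Exec w mem (.read d f) ⟨r, []⟩ 1 ((⟨r, []⟩ : State).set w f 0)
  | seq {p q s t s' t' s''} : Exec w mem p s t s' → Exec w mem q s' t' s'' →
      Exec w mem (.seq p q) s (t + t') s''
  | cond_pos {a p q s t s'} : s.reg a ≠ 0 → Exec w mem p s t s' →
      Exec w mem (.cond a p q) s (t + 1) s'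
  | cond_zero {a p q s t s'} : s.reg a = 0 → Exec w mem q s t s' →
      Exec w mem (.cond a p q) s (t + 1) s'
  | loop_pos {a p s t s' t' s''} : s.reg a ≠ 0 → Exec w mem p s t s' →
      Exec w mem (.loop a p) s' t' s'' → Exec w mem (.loop a p) s (t + t' + 1) s''
  | loop_zero {a p s} : s.reg a = 0 → Exec w mem (.loop a p) s 1 s

/-- Starting in the state `s`, running `next` again and again delivers the elements of the list one
after the other in register 0, each within at most `T` further steps. -/
def Reports (w : ℕ) (mem : List ℕ) (next : Prog) (T : ℕ) : State → List ℕ → Prop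
  | _, [] => True
  | s, x :: xs => ∃ t s', Exec w mem next s t s' ∧ t ≤ T ∧ s'.reg 0 = x ∧
      Reports w mem next T s' xs

/-- The length in bits of the words of a machine for graphs with `n` vertices: `Θ(log n)`, where the
summand 1 only matters for tiny `n`. -/
def wordSize (K n : ℕ) : ℕ := K * (Nat.log 2 n + 1)

/-- `log log n`, where the summand 1 only matters for tiny `n`. -/
def loglog (n : ℕ) : ℕ := Nat.log 2 (Nat.log 2 n) + 1

end WheelerIndex

/-! In a Wheeler graph the vertices reached by a pattern form an interval `[i, j)` of ranks. Reading
a further letter `a` replaces it by `[lowTgt a i, highTgt a j)` if an edge labelled `a` leaves the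
interval, that is, if `nextSrc a i < j`, and by the empty interval otherwise (`image_interval`). So
counting needs three functions of a pair of letter and rank. Reporting needs the identifier of the
first vertex of the interval, kept up to date letter by letter, and the function that takes the
identifier of a vertex to that of its successor in the Wheeler order.

All these functions are piecewise linear with slope 0 or 1 and have O(r + υ) pieces. Call an edge
inner if it is neither the first nor the last edge of its path. Both ends of an inner edge have in-
and out-degree 1 and are endpoints of no path (`IsPathDecomposition.inner`), so identifiers grow by
1 along it. If inner edges with the same label leave consecutive ranks, then their targets have
consecutive ranks (`tgt_inner_succ`): the functions run along a piece of slope 1. Where no edge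
labelled `a` leaves, they are constant. Such a pattern can break only at a first or last edge of a
path, at the end of a run of the transform, at the single rank where in-degrees become positive, or
at the extreme ranks (`innerAt_succ`, `innerAt_pred`, `breakKeys_subset`, `card_breakKeys_le`).

All arguments are coded as keys in one universe of polynomial size. The index stores one record per
break; a query finds the last break before its key and adds slope times distance. That predecessor
search takes O(log log n) steps in linear space: every `2 ^ T`-th break is sampled, the ancestors of
the samples in a binary tree of height `l = 2 ^ T - 1` are stored in a two-level perfect hash table,
a binary search over the depth finds the block of the query, and a second one finds the break within
the block (`exists_searchTables`, `runs_lookup`). As `l` is O(log n), `T` is O(log log n).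

The time bounds refer to concrete programs, whose effect is derived from Hoare-style rules for
straight-line blocks and counted loops. -/

namespace WheelerIndex

/-! ### Expressions and blocks of assignments on the word RAM

Registers below 20 are variables; the registers from 20 on hold intermediate results. -/

/-- Expressions over the variables, numerals and the memory. -/
inductive Expr
  | var (r : Fin 20)
  | lit (k : ℕ)
  | bin (o : BinOp) (a b : Expr)
  | ld (a : Expr)

namespace Expr

/-- The value of an expression on a machine with `w`-bit words. -/
def eval (w : ℕ) (mem : List ℕ) (f : Fin 20 → ℕ) : Expr → ℕ
  | var r => f r
  | lit k => k % 2 ^ w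
  | bin o a b => o.eval w (eval w mem f a) (eval w mem f b) % 2 ^ w
  | ld a => mem.getD (eval w mem f a) 0 % 2 ^ w

/-- A program that evaluates an expression into register `d` and does not change lower registers. -/
def code : Expr → ℕ → Prog
  -- There is no move instruction; `or` with a zeroed register copies a word.
  | var r, d => .seq (.const d 0) (.op .or d r d)
  | lit k, d => .const d k
  | bin o a b, d => .seq (code a d) (.seq (code b (d + 1)) (.op o d d (d + 1)))
  | ld a, d => .seq (code a d) (.load d d)

/-- The running time of `code`. -/
def cost : Expr → ℕ
  | var _ => 2
  | lit _ => 1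
  | bin _ a b => cost a + (cost b + 1)
  | ld a => cost a + 1

end Expr

/-- The values of the variables in the state `s` are given by `f`. -/
def Agree (w : ℕ) (s : State) (f : Fin 20 → ℕ) : Prop :=
  ∀ r : Fin 20, s.reg r = f r ∧ f r < 2 ^ w

theorem State.set_reg_self (w : ℕ) (s : State) (d x : ℕ) : (s.set w d x).reg d = x % 2 ^ w := by
  simp [State.set]

theorem State.set_reg_of_ne (w : ℕ) (s : State) {d r : ℕ} (x : ℕ) (h : r ≠ d) :
    (s.set w d x).reg r = s.reg r := by
  simp [State.set, Function.update_of_ne h]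

/-- The registers from `d` on act as an evaluation stack: the left operand stays in `d` while the
right one is computed in `d + 1` and above. The time does not depend on the state. -/
theorem Expr.exec_code {w : ℕ} {mem : List ℕ} {f : Fin 20 → ℕ} (e : Expr) :
    ∀ (d : ℕ) (s : State), 20 ≤ d → Agree w s f →
    ∃ s', Exec w mem (e.code d) s e.cost s' ∧ s'.reg d = e.eval w mem f ∧
      (∀ r < d, s'.reg r = s.reg r) ∧ s'.input = s.input := by
  induction e with
  | var r =>
    intro d s hd hs
    refine ⟨_, .seq (.const d 0 s) (.op _ _ _ _ _), ?_, ?_, rfl⟩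
    · have h1 : (r : ℕ) ≠ d := by omega
      simp only [State.set_reg_self, State.set_reg_of_ne w s 0 h1, Expr.eval, (hs r).1]
      simp [BinOp.eval, Nat.mod_eq_of_lt (hs r).2]
    · intro r' hr'
      rw [State.set_reg_of_ne _ _ _ hr'.ne, State.set_reg_of_ne _ _ _ hr'.ne]
  | lit k =>
    intro d s hd hs
    exact ⟨_, .const d k s, State.set_reg_self .., fun r hr => State.set_reg_of_ne _ _ _ hr.ne, rfl⟩
  | bin o a b iha ihb =>
    intro d s hd hs
    obtain ⟨s1, h1, v1, k1, i1⟩ := iha d s hd hs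
    have hs1 : Agree w s1 f := fun r => ⟨by rw [k1 r (by omega), (hs r).1], (hs r).2⟩
    obtain ⟨s2, h2, v2, k2, i2⟩ := ihb (d + 1) s1 (by omega) hs1
    refine ⟨_, .seq h1 (.seq h2 (.op _ _ _ _ _)), ?_, ?_, ?_⟩
    · rw [State.set_reg_self, v2, k2 d (by omega), v1, Expr.eval]
    · intro r hr
      rw [State.set_reg_of_ne _ _ _ hr.ne, k2 r (by omega), k1 r hr]
    · simp [State.set, i2, i1]
  | ld a iha =>
    intro d s hd hs
    obtain ⟨s1, h1, v1, k1, i1⟩ := iha d s hd hs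
    refine ⟨_, .seq h1 (.load _ _ _), ?_, ?_, ?_⟩
    · rw [State.set_reg_self, v1, Expr.eval]
    · intro r hr
      rw [State.set_reg_of_ne _ _ _ hr.ne, k1 r hr]
    · simp [State.set, i1]

theorem Expr.eval_lt {w : ℕ} {mem : List ℕ} {f : Fin 20 → ℕ} (hf : ∀ r, f r < 2 ^ w) (e : Expr) :
    e.eval w mem f < 2 ^ w := by
  cases e with
  | var r => exact hf r
  | _ => exact Nat.mod_lt _ (by positivity)

/-- The program for a sequence of assignments. -/
def block : List (Fin 20 × Expr) → Prog
  | [] => .skip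
  | (d, e) :: l => .seq (.seq (e.code 20) (.seq (.const 21 0) (.op .or d 20 21))) (block l)

/-- The running time of `block`. -/
def blockCost : List (Fin 20 × Expr) → ℕ
  | [] => 1
  | (_, e) :: l => (e.cost + 2) + blockCost l

/-- Started with the variables `f` and the input `inp`, the program `p` stops after at most `T`
steps, and `Q` holds of the variables and the input that is left. -/
def Runs (w : ℕ) (mem : List ℕ) (p : Prog) (T : ℕ) (f : Fin 20 → ℕ) (inp : List ℕ)
    (Q : (Fin 20 → ℕ) → List ℕ → Prop) : Prop :=
  ∀ s, Agree w s f → s.input = inp →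
    ∃ t s' f', Exec w mem p s t s' ∧ t ≤ T ∧ Agree w s' f' ∧ Q f' s'.input

/-! ### Hoare-style rules for `Runs` -/

section
variable {w : ℕ} {mem : List ℕ} {p q : Prog} {T T' : ℕ} {f : Fin 20 → ℕ} {inp : List ℕ}
  {Q Q' : (Fin 20 → ℕ) → List ℕ → Prop}

theorem Runs.mono (h : Runs w mem p T f inp Q) (hT : T ≤ T')
    (hQ : ∀ f' i', (∀ r, f' r < 2 ^ w) → Q f' i' → Q' f' i') : Runs w mem p T' f inp Q' := by
  intro s hs hi
  obtain ⟨t, s', f', he, ht, ha, hq⟩ := h s hs hi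
  exact ⟨t, s', f', he, ht.trans hT, ha, hQ _ _ (fun r => (ha r).2) hq⟩

theorem Runs.seq (h : Runs w mem p T f inp Q)
    (h' : ∀ f' i', (∀ r, f' r < 2 ^ w) → Q f' i' → Runs w mem q T' f' i' Q') :
    Runs w mem (.seq p q) (T + T') f inp Q' := by
  intro s hs hi
  obtain ⟨t, s', f', he, ht, ha, hq⟩ := h s hs hi
  obtain ⟨t', s'', f'', he', ht', ha', hq'⟩ := h' f' _ (fun r => (ha r).2) hq s' ha rfl
  exact ⟨_, s'', f'', .seq he he', by omega, ha', hq'⟩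

theorem runs_block_nil (h : Q f inp) : Runs w mem (block []) (blockCost []) f inp Q :=
  fun s hs hi => ⟨1, s, f, .skip s, le_rfl, hs, hi ▸ h⟩

/-- Repeated use executes a block symbolically. The value `v` is supplied in the form that later
steps need, so overflow is dealt with once, in the proof of `he`. -/
theorem runs_block_cons {d : Fin 20} {e : Expr} {l : List (Fin 20 × Expr)} {v : ℕ}
    (he : e.eval w mem f = v)
    (h : v < 2 ^ w → Runs w mem (block l) (blockCost l) (Function.update f d v) inp Q) :
    Runs w mem (block ((d, e) :: l)) (blockCost ((d, e) :: l)) f inp Q := by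
  intro s hs hi
  obtain ⟨s1, h1, v1, k1, i1⟩ := e.exec_code (mem := mem) 20 s le_rfl hs
  have hlt : v < 2 ^ w := he ▸ e.eval_lt (mem := mem) (fun r => (hs r).2)
  rw [he] at v1
  obtain ⟨t, s', f', he', ht, ha, hq⟩ := h hlt
    (((s1.set w 21 0).set w d (BinOp.or.eval w ((s1.set w 21 0).reg 20) ((s1.set w 21 0).reg 21))))
    (fun r => by
      by_cases hr : r = d
      · subst hr
        rw [State.set_reg_self, State.set_reg_self, State.set_reg_of_ne _ _ _ (by omega), v1]
        simp [BinOp.eval, Nat.mod_eq_of_lt hlt, hlt]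
      · rw [State.set_reg_of_ne _ _ _ (by omega), State.set_reg_of_ne _ _ _ (by omega),
          k1 r (by omega), Function.update_of_ne hr]
        exact hs r) (by simpa [State.set, i1] using hi)
  exact ⟨_, s', f', .seq (.seq h1 (.seq (.const 21 0 s1) (.op .or d 20 21 _))) he',
    by rw [blockCost]; omega, ha, hq⟩

theorem runs_read_cons {d g : Fin 20} (x : ℕ) (hx : x < 2 ^ w)
    (h1 : 1 < 2 ^ w) :
    Runs w mem (.read d g) 1 f (x :: inp)
      (fun f' i' => f' = Function.update (Function.update f d x) g 1 ∧ i' = inp) := by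
  rintro ⟨r, i⟩ hs hi
  obtain rfl : i = x :: inp := hi
  refine ⟨_, _, _, .read_cons _ _ _ _ _, le_rfl, ?_, rfl, rfl⟩
  intro k
  by_cases hk : k = g
  · subst hk
    rw [State.set_reg_self, Nat.mod_eq_of_lt h1]
    simp [h1]
  · rw [State.set_reg_of_ne _ _ _ (by omega), Function.update_of_ne hk]
    by_cases hk : k = d
    · subst hk
      rw [State.set_reg_self, Nat.mod_eq_of_lt hx]
      simp [hx]
    · rw [State.set_reg_of_ne _ _ _ (by omega), Function.update_of_ne hk]
      exact hs k

theorem runs_read_nil {d g : Fin 20} :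
    Runs w mem (.read d g) 1 f []
      (fun f' i' => f' = Function.update f g 0 ∧ i' = []) := by
  rintro ⟨r, i⟩ hs hi
  obtain rfl : i = [] := hi
  refine ⟨_, _, _, .read_nil _ _ _, le_rfl, ?_, rfl, rfl⟩
  intro k
  by_cases hk : k = g
  · subst hk
    rw [State.set_reg_self]
    simp
  · rw [State.set_reg_of_ne _ _ _ (by omega), Function.update_of_ne hk]
    exact hs k

theorem Runs.cond_pos {a : Fin 20} (ha : f a ≠ 0) (h : Runs w mem p T f inp Q) :
    Runs w mem (.cond a p q) (T + 1) f inp Q := by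
  intro s hs hi
  obtain ⟨t, s', f', he, ht, ha', hq⟩ := h s hs hi
  exact ⟨_, s', f', .cond_pos (by rwa [(hs a).1]) he, by omega, ha', hq⟩

theorem Runs.cond_zero {a : Fin 20} (ha : f a = 0) (h : Runs w mem q T f inp Q) :
    Runs w mem (.cond a p q) (T + 1) f inp Q := by
  intro s hs hi
  obtain ⟨t, s', f', he, ht, ha', hq⟩ := h s hs hi
  exact ⟨_, s', f', .cond_zero (by rwa [(hs a).1]) he, by omega, ha', hq⟩

/-- A loop whose body runs exactly `k` times. -/
theorem runs_loop {a : Fin 20} (I : ℕ → (Fin 20 → ℕ) → List ℕ → Prop)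
    (h0 : ∀ f i, I 0 f i → f a = 0) (hpos : ∀ k f i, I (k + 1) f i → f a ≠ 0)
    (hbody : ∀ k f i, (∀ r, f r < 2 ^ w) → I (k + 1) f i → Runs w mem p T f i (I k)) :
    ∀ k f inp, I k f inp → Runs w mem (.loop a p) (k * (T + 1) + 1) f inp (I 0) := by
  intro k
  induction k with
  | zero =>
    intro f inp hI s hs hi
    exact ⟨1, s, f, .loop_zero (by rw [(hs a).1]; exact h0 _ _ hI), by omega, hs, hi ▸ hI⟩
  | succ k ih =>
    intro f inp hI s hs hi
    obtain ⟨t, s', f', he, ht, ha, hq⟩ := hbody k f inp (fun r => (hs r).2) hI s hs hi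
    obtain ⟨t', s'', f'', he', ht', ha', hq'⟩ := ih f' _ hq s' ha rfl
    refine ⟨_, s'', f'', .loop_pos (by rw [(hs a).1]; exact hpos _ _ _ hI) he he', ?_, ha', hq'⟩
    have : (k + 1) * (T + 1) = k * (T + 1) + T + 1 := by ring
    omega

end

/-! ### Perfect hashing -/

/-- With `z = a * (y - x) % p`, the residues of `a * x` and `a * y` differ by `z` or by `p - z`,
according to whether the addition wraps around. A collision therefore makes `m` divide one of these,
and `a ↦ z` is injective. At most `(p - 1) / m` numbers in `(0, p - 1]` are multiples of `m`. -/
theorem card_filter_mod_eq_mul_le {p x y : ℕ} (hp : p.Prime) (hxy : x < y) (hy : y < p)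
    (m : ℕ) :
    ((Finset.Ico 1 p).filter (fun a => (a * x % p) % m = (a * y % p) % m)).card * m
      ≤ 2 * (p - 1) := by
  classical
  set M := (Finset.Ioc 0 (p - 1)).filter (m ∣ ·) with hM
  have hMc : M.card * m ≤ p - 1 := by
    rw [hM, Nat.Ioc_filter_dvd_card_eq_div]
    exact Nat.div_mul_le_self _ _
  have hd : y - x < p := by omega
  have hd0 : 0 < y - x := by omega
  have key : ((Finset.Ico 1 p).filter (fun a => (a * x % p) % m = (a * y % p) % m)).card
      ≤ (M ∪ M.image (fun z => p - z)).card := by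
    apply Finset.card_le_card_of_injOn (fun a => a * (y - x) % p)
    · intro a ha
      simp only [Finset.coe_filter, Finset.mem_Ico, Set.mem_ofPred_eq] at ha
      obtain ⟨⟨ha1, ha2⟩, hc⟩ := ha
      have hpp := hp.pos
      have hα : a * x % p < p := Nat.mod_lt _ hpp
      have hβ : a * y % p < p := Nat.mod_lt _ hpp
      have hz : a * (y - x) % p < p := Nat.mod_lt _ hpp
      have hz0 : a * (y - x) % p ≠ 0 := by
        intro h0
        rcases (Nat.Prime.dvd_mul hp).1 (Nat.dvd_of_mod_eq_zero h0) with h | h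
        · exact absurd (Nat.le_of_dvd (by omega) h) (by omega)
        · exact absurd (Nat.le_of_dvd hd0 h) (by omega)
      have hsum : (a * x % p + a * (y - x) % p) % p = a * y % p := by
        rw [← Nat.add_mod, ← mul_add, Nat.add_sub_cancel' hxy.le]
      simp only [Finset.coe_union, Finset.coe_image, Set.mem_union, Finset.mem_coe, Set.mem_image,
        hM, Finset.mem_filter, Finset.mem_Ioc]
      generalize a * x % p = α at *
      generalize a * y % p = β at *
      generalize a * (y - x) % p = z at *
      by_cases h : α + z < p
      · rw [Nat.mod_eq_of_lt h] at hsum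
        left
        refine ⟨by omega, ?_⟩
        have := (Nat.modEq_iff_dvd' (by omega : α ≤ β)).1 hc
        rwa [show β - α = z by omega] at this
      · rw [Nat.mod_eq_sub_mod (by omega), Nat.mod_eq_of_lt (by omega)] at hsum
        right
        refine ⟨p - z, ⟨by omega, ?_⟩, by omega⟩
        have := (Nat.modEq_iff_dvd' (by omega : β ≤ α)).1 hc.symm
        rwa [show α - β = p - z by omega] at this
    · intro a ha b hb hab
      simp only [Finset.coe_filter, Finset.mem_Ico, Set.mem_ofPred_eq] at ha hb
      have hcop : Nat.gcd p (y - x) = 1 :=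
        (Nat.Prime.coprime_iff_not_dvd hp).2 (Nat.not_dvd_of_pos_of_lt hd0 hd)
      have : a ≡ b [MOD p] := Nat.ModEq.cancel_right_of_coprime hcop hab
      exact Nat.ModEq.eq_of_lt_of_lt this ha.1.2 hb.1.2
  calc _ ≤ (M ∪ M.image (fun z => p - z)).card * m := Nat.mul_le_mul_right _ key
    _ ≤ (M.card + M.card) * m := by
        apply Nat.mul_le_mul_right
        exact (Finset.card_union_le _ _).trans (Nat.add_le_add_left Finset.card_image_le _)
    _ = M.card * m + M.card * m := by ring
    _ ≤ _ := by omega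

/-- Averaging over the `p - 1` nonzero multipliers: each pair in `Q` collides for at most a fraction
`2 / m` of them. -/
theorem exists_multiplier {p : ℕ} (hp : p.Prime) (Q : Finset (ℕ × ℕ))
    (hQ : ∀ q ∈ Q, q.1 < q.2 ∧ q.2 < p) (m : ℕ) :
    ∃ a < p, (Q.filter (fun q => (a * q.1 % p) % m = (a * q.2 % p) % m)).card * m ≤ 2 * Q.card := by
  classical
  by_contra! hcon
  have h1 : ∑ a ∈ Finset.Ico 1 p,
      (Q.filter (fun q => (a * q.1 % p) % m = (a * q.2 % p) % m)).card * m
      = ∑ q ∈ Q, ((Finset.Ico 1 p).filter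
          (fun a => (a * q.1 % p) % m = (a * q.2 % p) % m)).card * m := by
    simp only [Finset.card_filter, Finset.sum_mul]
    exact Finset.sum_comm
  have h2 : ∑ q ∈ Q, ((Finset.Ico 1 p).filter
          (fun a => (a * q.1 % p) % m = (a * q.2 % p) % m)).card * m ≤ Q.card * (2 * (p - 1)) := by
    rw [← smul_eq_mul]
    exact Finset.sum_le_card_nsmul _ _ _
      fun q hq => card_filter_mod_eq_mul_le hp (hQ q hq).1 (hQ q hq).2 m
  have h3 : (Finset.Ico 1 p).card • (2 * Q.card + 1) ≤ ∑ a ∈ Finset.Ico 1 p,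
      (Q.filter (fun q => (a * q.1 % p) % m = (a * q.2 % p) % m)).card * m :=
    Finset.card_nsmul_le_sum _ _ _ fun a ha => hcon a (Finset.mem_Ico.1 ha).2
  rw [Nat.card_Ico, smul_eq_mul] at h3
  have h4 : 0 < p - 1 := by have := hp.two_le; omega
  have : (p - 1) * (2 * Q.card + 1) ≤ Q.card * (2 * (p - 1)) := by omega
  nlinarith

/-- Two-level perfect hashing with linear space. -/
theorem exists_perfect_hash {p : ℕ} (hp : p.Prime) (U : Finset ℕ) (hU : ∀ u ∈ U, u < p)
    (hU0 : U.Nonempty) :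
    ∃ (A : ℕ) (a m off : ℕ → ℕ), A < p ∧ (∀ b, a b < p) ∧ (∀ b, 0 < m b) ∧
      (∀ b < U.card, off b + m b ≤ 5 * U.card) ∧
      Set.InjOn (fun u => off (A * u % p % U.card) +
        a (A * u % p % U.card) * u % p % m (A * u % p % U.card)) U := by
  classical
  set N := U.card with hN
  have hN0 : 0 < N := hU0.card_pos
  set Q := (U ×ˢ U).filter (fun q => q.1 < q.2) with hQdef
  have hQ : ∀ q ∈ Q, q.1 < q.2 ∧ q.2 < p := by
    intro q hq
    simp only [hQdef, Finset.mem_filter, Finset.mem_product] at hq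
    exact ⟨hq.2, hU _ hq.1.2⟩
  have hQc : Q.card ≤ N * N := (Finset.card_filter_le _ _).trans (by rw [Finset.card_product])
  obtain ⟨A, hA, hAc⟩ := exists_multiplier hp Q hQ N
  set h : ℕ → ℕ := fun u => A * u % p % N with hh
  set R := Q.filter (fun q => h q.1 = h q.2) with hR
  -- There are at most `N * N` pairs and `N` buckets on the first level.
  have hRc : R.card ≤ 2 * N := by
    have : R.card * N ≤ (2 * N) * N := hAc.trans (by nlinarith)
    exact Nat.le_of_mul_le_mul_right this hN0
  set Rb : ℕ → Finset (ℕ × ℕ) := fun b => R.filter (fun q => h q.1 = b) with hRb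
  -- One more than the bound `2 * (Rb b).card` of `exists_multiplier`, so that the number of
  -- collisions inside bucket `b` must be 0.
  set m : ℕ → ℕ := fun b => 2 * (Rb b).card + 1 with hm
  have hm0 : ∀ b, 0 < m b := fun b => by simp [hm]
  have hex : ∀ b, ∃ a < p, ((Rb b).filter
      (fun q => (a * q.1 % p) % m b = (a * q.2 % p) % m b)).card * m b ≤ 2 * (Rb b).card :=
    fun b => exists_multiplier hp (Rb b)
      (fun q hq => hQ q (Finset.mem_filter.1 (Finset.mem_filter.1 hq).1).1) (m b)
  choose a ha hac using hex
  have hempty : ∀ b, (Rb b).filter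
      (fun q => (a b * q.1 % p) % m b = (a b * q.2 % p) % m b) = ∅ := by
    intro b
    rw [← Finset.card_eq_zero]
    by_contra hne
    have := hac b
    have h1 : m b ≤ ((Rb b).filter
      (fun q => (a b * q.1 % p) % m b = (a b * q.2 % p) % m b)).card * m b :=
      Nat.le_mul_of_pos_left _ (Nat.pos_of_ne_zero hne)
    have h2 : m b = 2 * (Rb b).card + 1 := rfl
    omega
  -- Twice the at most `2 * N` colliding pairs, plus 1 for each of the `N` buckets.
  have hsum : ∑ b ∈ Finset.range N, m b ≤ 5 * N := by
    have h1 : ∑ b ∈ Finset.range N, (Rb b).card = R.card := by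
      rw [Finset.card_eq_sum_card_fiberwise (f := fun q => h q.1) (t := Finset.range N)]
      intro q _
      simpa using Nat.mod_lt _ hN0
    simp only [hm, Finset.sum_add_distrib, ← Finset.mul_sum, h1]
    simp
    omega
  refine ⟨A, a, m, fun b => ∑ b' ∈ Finset.range b, m b', hA, ha, hm0, ?_, ?_⟩
  · intro b hb
    rw [← Finset.sum_range_succ]
    exact (Finset.sum_le_sum_of_subset (Finset.range_subset_range.2 hb)).trans hsum
  · have hlt : ∀ u v, h u < h v →
        (∑ b' ∈ Finset.range (h u), m b') + a (h u) * u % p % m (h u) <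
        (∑ b' ∈ Finset.range (h v), m b') + a (h v) * v % p % m (h v) := by
      intro u v huv
      have h1 := Nat.mod_lt (a (h u) * u % p) (hm0 (h u))
      have h2 : (∑ b' ∈ Finset.range (h u + 1), m b') ≤ ∑ b' ∈ Finset.range (h v), m b' :=
        Finset.sum_le_sum_of_subset (Finset.range_subset_range.2 huv)
      rw [Finset.sum_range_succ] at h2
      omega
    have hsame : ∀ u ∈ U, ∀ v ∈ U, u < v → h u = h v →
        a (h u) * u % p % m (h u) ≠ a (h v) * v % p % m (h v) := by
      intro u hu v hv huv hb hc
      have : (u, v) ∈ (Rb (h u)).filter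
          (fun q => (a (h u) * q.1 % p) % m (h u) = (a (h u) * q.2 % p) % m (h u)) := by
        simp only [hRb, hR, hQdef, Finset.mem_filter, Finset.mem_product]
        exact ⟨⟨⟨⟨⟨hu, hv⟩, huv⟩, hb⟩, trivial⟩, by rw [hc, hb]⟩
      rw [hempty] at this
      simp at this
    intro u hu v hv huv
    change (∑ b' ∈ Finset.range (h u), m b') + a (h u) * u % p % m (h u) =
        (∑ b' ∈ Finset.range (h v), m b') + a (h v) * v % p % m (h v) at huv
    rcases lt_trichotomy (h u) (h v) with hb | hb | hb
    · exact absurd huv (hlt u v hb).ne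
    · have hc : a (h u) * u % p % m (h u) = a (h v) * v % p % m (h v) := by
        rw [hb] at huv ⊢
        omega
      rcases lt_trichotomy u v with h' | h' | h'
      · exact absurd hc (hsame u hu v hv h' hb)
      · exact h'
      · exact absurd hc.symm (hsame v hv u hu h' hb.symm)
    · exact absurd huv (hlt v u hb).ne'

/-! ### Predecessor search -/

/-- The number that encodes the node of depth `d` above the leaf `x` in the complete binary tree of
height `l`. -/
def node (l d x : ℕ) : ℕ := (x + 2 ^ l) >>> (l - d)

theorem node_eq (l d x : ℕ) : node l d x = (x + 2 ^ l) / 2 ^ (l - d) :=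
  Nat.shiftRight_eq_div_pow _ _

theorem node_mono (l d : ℕ) {x y : ℕ} (h : x ≤ y) : node l d x ≤ node l d y := by
  rw [node_eq, node_eq]
  exact Nat.div_le_div_right (by omega)

theorem node_half {l d : ℕ} (x : ℕ) (h : d < l) : node l d x = node l (d + 1) x / 2 := by
  rw [node_eq, node_eq, Nat.div_div_eq_div_mul, ← pow_succ, show l - (d + 1) + 1 = l - d by omega]

theorem node_lt {l d x : ℕ} (hx : x < 2 ^ l) (h : d ≤ l) : node l d x < 2 ^ (d + 1) := by
  rw [node_eq, Nat.div_lt_iff_lt_mul (by positivity), ← pow_add,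
    show d + 1 + (l - d) = l + 1 by omega, pow_succ]
  omega

theorem le_node {l d : ℕ} (x : ℕ) (h : d ≤ l) : 2 ^ d ≤ node l d x := by
  rw [node_eq, Nat.le_div_iff_mul_le (by positivity), ← pow_add,
    show d + (l - d) = l by omega]
  omega

theorem log_node {l d x : ℕ} (hx : x < 2 ^ l) (h : d ≤ l) : Nat.log 2 (node l d x) = d :=
  Nat.log_eq_of_pow_le_of_lt_pow (le_node x h) (node_lt hx h)

theorem node_zero {l x : ℕ} (hx : x < 2 ^ l) : node l 0 x = 1 := by
  have h1 := node_lt hx (Nat.zero_le l)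
  have h2 := le_node x (Nat.zero_le l)
  simp at h1 h2
  omega

theorem node_self (l x : ℕ) : node l l x = x + 2 ^ l := by simp [node]

/-! ### The increasing enumeration of a finite set -/

section keys
/-- The position of the predecessor of `x` in the increasing enumeration of `S`. -/
def keyIdx (S : Finset ℕ) (x : ℕ) : ℕ := Nat.count (· ∈ S) (x + 1) - 1

/-- The increasing enumeration of `S`. -/
noncomputable def key (S : Finset ℕ) (j : ℕ) : ℕ := Nat.nth (· ∈ S) j

variable {S : Finset ℕ}

theorem lt_card_toFinset {j : ℕ} (hj : j < S.card) (hf : (Set.ofPred (· ∈ S)).Finite) :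
    j < hf.toFinset.card := by
  have : hf.toFinset = S := by ext; simp
  rwa [this]

theorem key_mem {j : ℕ} (hj : j < S.card) : key S j ∈ S :=
  Nat.nth_mem j (lt_card_toFinset hj)

theorem count_pos (h0 : 0 ∈ S) (x : ℕ) : 0 < Nat.count (· ∈ S) (x + 1) := by
  have h1 : Nat.count (· ∈ S) 1 ≤ Nat.count (· ∈ S) (x + 1) := Nat.count_monotone _ (by omega)
  have h2 : Nat.count (· ∈ S) 1 = 1 := by simp [Nat.count_succ, h0]
  omega

/-- The Galois connection on which all comparisons with keys rest. As `0 ∈ S`, every `x` has a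
predecessor and the subtraction in `keyIdx` is not truncated. -/
theorem key_le_iff (h0 : 0 ∈ S) {j : ℕ} (hj : j < S.card) (x : ℕ) :
    key S j ≤ x ↔ j ≤ keyIdx S x := by
  have hp := count_pos h0 x
  unfold keyIdx key
  constructor
  · intro h
    have h1 : Nat.count (· ∈ S) (Nat.nth (· ∈ S) j + 1) ≤ Nat.count (· ∈ S) (x + 1) :=
      Nat.count_monotone _ (by omega)
    rw [Nat.count_nth_succ (lt_card_toFinset hj)] at h1
    omega
  · intro h
    have : j < Nat.count (· ∈ S) (x + 1) := by omega
    have := Nat.nth_lt_of_lt_count this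
    omega

theorem keyIdx_lt (h0 : 0 ∈ S) (x : ℕ) : keyIdx S x < S.card := by
  have h1 : Nat.count (· ∈ S) (x + 1) ≤ S.card := by
    rw [Nat.count_eq_card_filter_range]
    exact Finset.card_le_card fun y hy => (Finset.mem_filter.1 hy).2
  have hS : 0 < S.card := Finset.card_pos.2 ⟨0, h0⟩
  unfold keyIdx
  omega

theorem key_keyIdx_le (h0 : 0 ∈ S) (x : ℕ) : key S (keyIdx S x) ≤ x :=
  (key_le_iff h0 (keyIdx_lt h0 x) x).2 le_rfl

theorem exists_key_eq {s : ℕ} (hs : s ∈ S) : ∃ j < S.card, key S j = s := by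
  obtain ⟨j, hj, h⟩ := Nat.exists_lt_card_nth_eq (p := (· ∈ S)) hs
  refine ⟨j, ?_, h⟩
  have hf : (Set.ofPred (· ∈ S)).Finite := S.finite_toSet
  have := hj hf
  rwa [show hf.toFinset = S by ext; simp] at this

theorem le_key_keyIdx (h0 : 0 ∈ S) {s x : ℕ} (hs : s ∈ S) (hx : s ≤ x) :
    s ≤ key S (keyIdx S x) := by
  obtain ⟨j, hj, rfl⟩ := exists_key_eq hs
  rw [key_le_iff h0 hj] at hx ⊢
  refine hx.trans ((key_le_iff h0 (keyIdx_lt h0 x) _).1 le_rfl)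

theorem keyIdx_mono (h0 : 0 ∈ S) {x y : ℕ} (h : x ≤ y) : keyIdx S x ≤ keyIdx S y :=
  (key_le_iff h0 (keyIdx_lt h0 x) y).1 ((key_keyIdx_le h0 x).trans h)

end keys

/-- The tables for predecessor search in `S`: a perfect hash table for nodes above every `2 ^ T`-th
key. -/
structure SearchTables (S : Finset ℕ) (l T : ℕ) where
  (p A N : ℕ)
  (a m off cellCode cellAns : ℕ → ℕ)
  p_lt : p ≤ 2 ^ (l + 2)
  p_pos : 0 < p
  A_lt : A < p
  a_lt : ∀ b, a b < p
  N_pos : 0 < N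
  N_le : N ≤ S.card
  m_pos : ∀ b, 0 < m b
  off_le : ∀ b < N, off b + m b ≤ 5 * S.card
  cellCode_lt : ∀ c, cellCode c < 2 ^ (l + 1)
  cellAns_lt : ∀ c, cellAns c < S.card
  root : cellCode (off (A * 1 % p % N) + a (A * 1 % p % N) * 1 % p % m (A * 1 % p % N)) = 1
  -- It suffices that the node at depth `d` is found and the one at depth `d + 1` is not. Hence the
  -- binary search over depths never needs to know that the stored nodes are closed under ancestors.
  cellAns_eq : ∀ d x u c, d ≤ l → x < 2 ^ l → u = node l d x →
    c = off (A * u % p % N) + a (A * u % p % N) * u % p % m (A * u % p % N) →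
    cellCode c = u →
    (d < l → ∀ u' c', u' = node l (d + 1) x →
      c' = off (A * u' % p % N) + a (A * u' % p % N) * u' % p % m (A * u' % p % N) →
      cellCode c' ≠ u') →
    cellAns c = keyIdx S x / 2 ^ T * 2 ^ T

/-- An x-fast trie over every `2 ^ T`-th key. Sampling pays for the `l + 1 = 2 ^ T` ancestors of
each sample, so the space is linear in `S.card`. -/
theorem exists_searchTables (S : Finset ℕ) (l T : ℕ) (h0 : 0 ∈ S) (hS : ∀ s ∈ S, s < 2 ^ l)
    (hl : l + 1 = 2 ^ T) : Nonempty (SearchTables S l T) := by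
  classical
  have hT : 0 < 2 ^ T := by positivity
  have hc0 : 0 < S.card := Finset.card_pos.2 ⟨0, h0⟩
  set q := (S.card - 1) / 2 ^ T with hq
  have hjlt : ∀ j ∈ Finset.Icc 1 q, j * 2 ^ T < S.card := by
    intro j hj
    have : j * 2 ^ T ≤ S.card - 1 :=
      (Nat.mul_le_mul_right _ (Finset.mem_Icc.1 hj).2).trans (Nat.div_mul_le_self _ _)
    omega
  set U : Finset ℕ := insert 1 ((Finset.range (2 ^ T) ×ˢ Finset.Icc 1 q).image
    (fun z => node l z.1 (key S (z.2 * 2 ^ T)))) with hU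
  -- There are `q` samples with `2 ^ T` ancestors each, plus the root; and `2 ^ T * q ≤ S.card - 1`.
  have hUc : U.card ≤ S.card := by
    have h1 : U.card ≤ 2 ^ T * q + 1 := by
      refine (Finset.card_insert_le _ _).trans (Nat.add_le_add_right ?_ 1)
      refine Finset.card_image_le.trans ?_
      simp
    have h2 : 2 ^ T * q ≤ S.card - 1 := Nat.mul_div_le _ _
    omega
  have hUlt : ∀ u ∈ U, u < 2 ^ (l + 1) := by
    intro u hu
    rcases Finset.mem_insert.1 hu with rfl | hu
    · exact Nat.one_lt_two_pow (by omega)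
    · obtain ⟨⟨d, j⟩, hz, rfl⟩ := Finset.mem_image.1 hu
      simp only [Finset.mem_product, Finset.mem_range] at hz
      refine (node_lt (hS _ (key_mem (hjlt j hz.2))) (by omega)).trans_le ?_
      exact Nat.pow_le_pow_right (by omega) (by omega)
  have hUpos : ∀ u ∈ U, 0 < u := by
    intro u hu
    rcases Finset.mem_insert.1 hu with rfl | hu
    · exact one_pos
    · obtain ⟨⟨d, j⟩, hz, rfl⟩ := Finset.mem_image.1 hu
      simp only [Finset.mem_product, Finset.mem_range] at hz
      exact (Nat.two_pow_pos d).trans_le (le_node _ (by omega))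
  -- Bertrand's postulate keeps the modulus within a constant factor of the universe.
  obtain ⟨p, hp, hp1, hp2⟩ := Nat.exists_prime_lt_and_le_two_mul (2 ^ (l + 1)) (by positivity)
  obtain ⟨A, a, m, off, hA, ha, hm, hoff, hinj⟩ :=
    exists_perfect_hash hp U (fun u hu => (hUlt u hu).trans hp1) ⟨1, Finset.mem_insert_self _ _⟩
  set N := U.card with hN
  set cell : ℕ → ℕ := fun u => off (A * u % p % N) + a (A * u % p % N) * u % p % m (A * u % p % N)
    with hcell
  -- Empty cells hold 0, which is the number of no node.
  set code : ℕ → ℕ := fun c => if h : ∃ u ∈ U, cell u = c then h.choose else 0 with hcode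
  have hcode_eq : ∀ u, code (cell u) = u ↔ u ∈ U ∨ (u = 0 ∧ code (cell 0) = 0) := by
    intro u
    constructor
    · intro h
      by_cases hx : ∃ v ∈ U, cell v = cell u
      · left
        have h1 : code (cell u) = hx.choose := by simp only [hcode]; rw [dif_pos hx]
        rw [← h, h1]
        exact hx.choose_spec.1
      · right
        have h1 : code (cell u) = 0 := by simp only [hcode]; rw [dif_neg hx]
        have : u = 0 := by omega
        subst this
        exact ⟨rfl, h⟩
    · rintro (h | ⟨rfl, h⟩)
      · have hx : ∃ v ∈ U, cell v = cell u := ⟨u, h, rfl⟩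
        have h1 : code (cell u) = hx.choose := by simp only [hcode]; rw [dif_pos hx]
        rw [h1]
        exact hinj hx.choose_spec.1 h hx.choose_spec.2
      · exact h
  have hcode_node : ∀ d x, d ≤ l → (code (cell (node l d x)) = node l d x ↔ node l d x ∈ U) := by
    intro d x hd
    rw [hcode_eq]
    constructor
    · rintro (h | ⟨h, -⟩)
      · exact h
      · have := le_node x hd
        have := Nat.two_pow_pos d
        omega
    · exact Or.inl
  -- The block depends only on the node at which the search stops. If `x` and `y` lay in different
  -- blocks, a sample would lie in `(x, y]`, below the same node; its ancestor at depth `d + 1` is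
  -- then that of `x` or that of `y`, yet it is stored.
  have hwd : ∀ d x y, d ≤ l → x < y → node l d x = node l d y →
      (d < l → node l (d + 1) x ∉ U) → (d < l → node l (d + 1) y ∉ U) →
      keyIdx S x / 2 ^ T = keyIdx S y / 2 ^ T := by
    intro d x y hd hxy hn hx hy
    rcases hd.eq_or_lt with rfl | hd
    · rw [node_self, node_self] at hn
      omega
    · by_contra hne
      have hlt : keyIdx S x / 2 ^ T < keyIdx S y / 2 ^ T :=
        lt_of_le_of_ne (Nat.div_le_div_right (keyIdx_mono h0 hxy.le)) hne
      set j := keyIdx S y / 2 ^ T with hj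
      have hjy : j * 2 ^ T ≤ keyIdx S y := Nat.div_mul_le_self _ _
      have hjx : keyIdx S x < j * 2 ^ T := (Nat.div_lt_iff_lt_mul hT).1 hlt
      have hjm : j ∈ Finset.Icc 1 q := by
        rw [Finset.mem_Icc]
        refine ⟨(Nat.zero_le _).trans_lt hlt, Nat.div_le_div_right ?_⟩
        have := keyIdx_lt h0 y
        omega
      have hk1 : key S (j * 2 ^ T) ≤ y := (key_le_iff h0 (hjlt j hjm) y).2 hjy
      have hk2 : x < key S (j * 2 ^ T) := by
        by_contra hcon
        exact absurd ((key_le_iff h0 (hjlt j hjm) x).1 (by omega)) (by omega)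
      have hkU : node l (d + 1) (key S (j * 2 ^ T)) ∈ U := by
        refine Finset.mem_insert_of_mem (Finset.mem_image.2 ⟨(d + 1, j), ?_, rfl⟩)
        simp only [Finset.mem_product, Finset.mem_range]
        exact ⟨by omega, hjm⟩
      have h1 := node_mono l (d + 1) hk2.le
      have h2 := node_mono l (d + 1) hk1
      rw [node_half x hd, node_half y hd] at hn
      have : node l (d + 1) (key S (j * 2 ^ T)) = node l (d + 1) x ∨
        node l (d + 1) (key S (j * 2 ^ T)) = node l (d + 1) y := by omega
      rcases this with h | h
      · exact hx hd (h ▸ hkU)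
      · exact hy hd (h ▸ hkU)
  -- The leaves `x` below `u` whose next ancestor is not stored. By `hwd` any of them yields the
  -- answer for `u`; the depth of `u` is its binary logarithm.
  set final : ℕ → ℕ → Prop := fun u x => x < 2 ^ l ∧ node l (Nat.log 2 u) x = u ∧
    (Nat.log 2 u < l → node l (Nat.log 2 u + 1) x ∉ U) with hfinal
  set ans : ℕ → ℕ := fun u => if h : ∃ x, final u x then keyIdx S h.choose / 2 ^ T * 2 ^ T else 0
    with hans
  have hans_eq : ∀ d x, d ≤ l → x < 2 ^ l → (d < l → node l (d + 1) x ∉ U) →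
      ans (node l d x) = keyIdx S x / 2 ^ T * 2 ^ T := by
    intro d x hd hx hn
    have hlog := log_node hx hd
    have hex : ∃ y, final (node l d x) y := ⟨x, hx, by rw [hlog], by rwa [hlog]⟩
    have h1 : ans (node l d x) = keyIdx S hex.choose / 2 ^ T * 2 ^ T := by
      simp only [hans]; rw [dif_pos hex]
    rw [h1]
    obtain ⟨hy1, hy2, hy3⟩ := hex.choose_spec
    rw [hlog] at hy2 hy3
    congr 1
    rcases lt_trichotomy x hex.choose with h | h | h
    · exact (hwd d _ _ hd h hy2.symm hn hy3).symm
    · rw [← h]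
    · exact hwd d _ _ hd h hy2 hy3 hn
  refine ⟨⟨p, A, N, a, m, off, code, fun c => ans (code c), ?_, hp.pos, hA, ha, ?_, hUc, hm, ?_, ?_,
    ?_, ?_, ?_⟩⟩
  · rw [show l + 2 = l + 1 + 1 from rfl, pow_succ]
    omega
  · exact Finset.card_pos.2 ⟨1, Finset.mem_insert_self _ _⟩
  · intro b hb
    exact (hoff b hb).trans (Nat.mul_le_mul_left _ hUc)
  · intro c
    by_cases h : ∃ u ∈ U, cell u = c
    · have : code c = h.choose := by simp only [hcode]; rw [dif_pos h]
      rw [this]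
      exact hUlt _ h.choose_spec.1
    · have : code c = 0 := by simp only [hcode]; rw [dif_neg h]
      rw [this]
      positivity
  · intro c
    by_cases h : ∃ x, final (code c) x
    · have : ans (code c) = keyIdx S h.choose / 2 ^ T * 2 ^ T := by
        simp only [hans]; rw [dif_pos h]
      rw [this]
      exact (Nat.div_mul_le_self _ _).trans_lt (keyIdx_lt h0 _)
    · have : ans (code c) = 0 := by simp only [hans]; rw [dif_neg h]
      rw [this]
      exact hc0
  · exact (hcode_eq 1).2 (Or.inl (Finset.mem_insert_self _ _))
  · intro d x u c hd hx hu hc hcu hn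
    rw [hcu, hu]
    refine hans_eq d x hd hx fun hdl hmem => ?_
    exact hn hdl _ _ rfl rfl ((hcode_node _ _ (by omega)).2 hmem)

namespace LabelledDigraph

/-! ### Inner edges of a path decomposition -/

section inner
variable {V E A : Type} (G : LabelledDigraph V E A)

theorem eq_of_outDeg_eq_one {e e' : E} (h : G.outDeg (G.src e) = 1) (he : G.src e' = G.src e) :
    e' = e := by
  obtain ⟨x, hx⟩ := Set.ncard_eq_one.1 h
  have h1 : e ∈ ({x} : Set E) := hx ▸ (rfl : G.src e = G.src e)
  have h2 : e' ∈ ({x} : Set E) := hx ▸ he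
  rw [Set.mem_singleton_iff] at h1 h2
  rw [h1, h2]

theorem eq_of_inDeg_eq_one {e e' : E} (h : G.inDeg (G.tgt e) = 1) (he : G.tgt e' = G.tgt e) :
    e' = e := by
  obtain ⟨x, hx⟩ := Set.ncard_eq_one.1 h
  have h1 : e ∈ ({x} : Set E) := hx ▸ (rfl : G.tgt e = G.tgt e)
  have h2 : e' ∈ ({x} : Set E) := hx ▸ he
  rw [Set.mem_singleton_iff] at h1 h2
  rw [h1, h2]

theorem inDeg_pos_iff [Finite E] {v : V} : 0 < G.inDeg v ↔ ∃ e, G.tgt e = v :=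
  Set.ncard_pos (Set.toFinite _)

/-- The edges that are the first or the last edge of a path in `D`. -/
def boundary (D : List (List E)) : List E := D.filterMap List.head? ++ D.filterMap List.getLast?

theorem length_boundary_le (D : List (List E)) : (boundary D).length ≤ 2 * D.length := by
  have h1 := List.length_filterMap_le List.head? D
  have h2 := List.length_filterMap_le List.getLast? D
  rw [boundary, List.length_append]
  omega

theorem head_mem_boundary {D : List (List E)} {p : List E} (hp : p ∈ D) (h : p ≠ []) :
    p.head h ∈ boundary D :=
  List.mem_append_left _ (List.mem_filterMap.2 ⟨p, hp, List.head?_eq_some_head h⟩)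

theorem getLast_mem_boundary {D : List (List E)} {p : List E} (hp : p ∈ D) (h : p ≠ []) :
    p.getLast h ∈ boundary D :=
  List.mem_append_right _ (List.mem_filterMap.2 ⟨p, hp, List.getLast?_eq_some_getLast h⟩)

variable {G} {D : List (List E)}

/-- Such an `e` has a predecessor `f` and a successor `e'` on its path, so both of its ends are
internal and have degrees 1. If one of them were an endpoint of a path `q`, the degrees would make
the first or last edge of `q` one of `f`, `e`, `e'`. For `e` this contradicts `he`; for `f` and `e'`
disjointness forces `q` to be the path of `e`, on which `f` is not last and `e'` is not first. -/
theorem IsPathDecomposition.inner (hD : G.IsPathDecomposition D) {e : E} (he : e ∉ boundary D) :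
    G.inDeg (G.src e) = 1 ∧ G.outDeg (G.src e) = 1 ∧ G.inDeg (G.tgt e) = 1 ∧
      G.outDeg (G.tgt e) = 1 ∧ ¬ G.IsEndpoint D (G.src e) ∧ ¬ G.IsEndpoint D (G.tgt e) := by
  obtain ⟨p, hp, hep⟩ := List.mem_flatten.1 (hD.cover e)
  obtain ⟨l1, l2, rfl⟩ := List.append_of_mem hep
  have hne := hD.ne_nil _ hp
  obtain ⟨hnd, hdis⟩ := List.nodup_flatten.1 hD.nodup
  have hdisj : ∀ q ∈ D, ∀ f, f ∈ q → f ∈ l1 ++ e :: l2 → q = l1 ++ e :: l2 := by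
    intro q hq f hfq hfp
    by_contra hqp
    have : Std.Symm (List.Disjoint (α := E)) := ⟨fun _ _ h => h.symm⟩
    exact hdis.forall hq hp hqp hfq hfp
  rcases List.eq_nil_or_concat l1 with rfl | ⟨l1, f, rfl⟩
  · exact absurd (by simpa using head_mem_boundary hp hne) he
  rcases l2 with - | ⟨e', l2⟩
  · exact absurd (by simpa using getLast_mem_boundary hp hne) he
  have hnd' := hnd _ hp
  have hc := hD.consecutive _ hp
  have hi := hD.internal _ hp
  simp only [List.append_assoc, List.singleton_append, List.concat_eq_append] at hc hi hnd' hdisj hp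
  rw [List.isChain_append] at hc hi
  have hc' := hc.2.1
  have hi' := hi.2.1
  simp only [List.isChain_cons_cons] at hc' hi'
  obtain ⟨hfe, hee, -⟩ := hc'
  obtain ⟨hif, hie, -⟩ := hi'
  refine ⟨hfe ▸ hif.1, hfe ▸ hif.2, hie.1, hie.2, ?_, ?_⟩
  · rintro ⟨q, hq, hq0, h | h⟩
    · have := G.eq_of_outDeg_eq_one (hfe ▸ hif.2) h.symm
      exact he (this ▸ head_mem_boundary hq hq0)
    · have := G.eq_of_inDeg_eq_one hif.1 (h.symm.trans hfe.symm)
      have hqe := hdisj q hq f (this ▸ List.getLast_mem hq0) (by simp)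
      subst hqe
      have h3 : (l1 ++ f :: e :: e' :: l2).getLast hq0 = (e' :: l2).getLast (by simp) := by simp
      rw [h3] at this
      have h4 := List.getLast_mem (show e' :: l2 ≠ [] by simp)
      rw [this] at h4
      rw [List.nodup_append] at hnd'
      have h5 := hnd'.2.1
      rw [List.nodup_cons] at h5
      exact h5.1 (List.mem_cons_of_mem _ h4)
  · rintro ⟨q, hq, hq0, h | h⟩
    · rw [hee] at hie
      have := G.eq_of_outDeg_eq_one hie.2 (h.symm.trans hee)
      have hqe := hdisj q hq e' (this ▸ List.head_mem hq0) (by simp)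
      subst hqe
      have hsplit : l1 ++ f :: e :: e' :: l2 = (l1 ++ [f, e]) ++ (e' :: l2) := by simp
      have h3 : (l1 ++ f :: e :: e' :: l2).head hq0 = (l1 ++ [f, e]).head (by simp) := by
        cases l1 <;> simp
      rw [h3] at this
      have h4 := List.head_mem (show l1 ++ [f, e] ≠ [] by simp)
      rw [this] at h4
      rw [hsplit, List.nodup_append] at hnd'
      exact hnd'.2.2 _ h4 _ (by simp) rfl
    · have := G.eq_of_inDeg_eq_one hie.1 h.symm
      exact he (this ▸ getLast_mem_boundary hq hq0)

end inner

/-! ### Reachability by labelled paths -/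

section reached
variable {V E A : Type} (G : LabelledDigraph V E A)

theorem pathLabelled_cons {u v : V} {a : A} {P : List A} :
    G.PathLabelled u (a :: P) v ↔
      ∃ e, G.src e = u ∧ G.label e = a ∧ G.PathLabelled (G.tgt e) P v := by
  constructor
  · intro h
    cases h with
    | cons e h => exact ⟨e, rfl, rfl, h⟩
  · rintro ⟨e, rfl, rfl, h⟩
    exact .cons e h

theorem pathLabelled_nil {u v : V} : G.PathLabelled u [] v ↔ u = v := by
  constructor
  · intro h
    cases h
    rfl
  · rintro rfl
    exact .nil u

theorem pathLabelled_append_singleton {a : A} {P : List A} {u v : V} :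
    G.PathLabelled u (P ++ [a]) v ↔
      ∃ e, G.PathLabelled u P (G.src e) ∧ G.label e = a ∧ G.tgt e = v := by
  induction P generalizing u with
  | nil =>
    simp only [List.nil_append, pathLabelled_cons, pathLabelled_nil]
    exact exists_congr fun e => by rw [eq_comm]
  | cons b P ih =>
    simp only [List.cons_append, pathLabelled_cons, ih]
    constructor
    · rintro ⟨e, h1, h2, e', h3, h4⟩
      exact ⟨e', ⟨e, h1, h2, h3⟩, h4⟩
    · rintro ⟨e', ⟨e, h1, h2, h3⟩, h4⟩
      exact ⟨e, h1, h2, e', h3, h4⟩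

theorem mem_reached_append_singleton {a : A} {P : List A} {v : V} :
    v ∈ G.reached (P ++ [a]) ↔ ∃ e, G.src e ∈ G.reached P ∧ G.label e = a ∧ G.tgt e = v := by
  simp only [reached, Set.mem_ofPred_eq, pathLabelled_append_singleton]
  constructor
  · rintro ⟨u, e, h1, h2⟩
    exact ⟨e, ⟨u, h1⟩, h2⟩
  · rintro ⟨e, ⟨u, h1⟩, h2⟩
    exact ⟨u, e, h1, h2⟩

theorem mem_reached_nil (v : V) : v ∈ G.reached [] := ⟨v, .nil v⟩

end reached

/-! ### One step of the search in a Wheeler graph -/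

section step
variable {V E : Type} {σ n : ℕ} (G : LabelledDigraph V E (Fin σ)) (π : V ≃ Fin n)

/-- The least rank that is at least `i` and that of a vertex with an out-edge labelled `a`; it is `n`
if there is none. -/
noncomputable def nextSrc (a i : ℕ) : ℕ :=
  sInf {k | i ≤ k ∧ ((∃ e, (G.label e : ℕ) = a ∧ (π (G.src e) : ℕ) = k) ∨ k = n)}

/-- The least rank of a target of an edge labelled `a` whose source has rank at least `i`. -/
noncomputable def lowTgt (a i : ℕ) : ℕ :=
  sInf {k | ∃ e, (G.label e : ℕ) = a ∧ i ≤ (π (G.src e) : ℕ) ∧ (π (G.tgt e) : ℕ) = k}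

open scoped Classical in
/-- The successor of the greatest rank of a target of an edge labelled `a` whose source has rank
less than `j`. -/
noncomputable def highTgt (a j : ℕ) : ℕ :=
  if ∃ e, (G.label e : ℕ) = a ∧ (π (G.src e) : ℕ) < j then
    sSup {k | ∃ e, (G.label e : ℕ) = a ∧ (π (G.src e) : ℕ) < j ∧ (π (G.tgt e) : ℕ) + 1 = k}
  -- With this default the value at the source of the first edge labelled `a` fits the same formula
  -- as at later inner edges; see `highTgt_inner`.
  else G.lowTgt π a j

variable {G π} {a i j : ℕ}

theorem nextSrc_le {e : E} (ha : (G.label e : ℕ) = a) (hi : i ≤ π (G.src e)) :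
    G.nextSrc π a i ≤ π (G.src e) :=
  Nat.sInf_le ⟨hi, Or.inl ⟨e, ha, rfl⟩⟩

theorem nextSrc_le_card (hi : i ≤ n) : G.nextSrc π a i ≤ n := Nat.sInf_le ⟨hi, Or.inr rfl⟩

theorem nextSrc_spec (hi : i ≤ n) : i ≤ G.nextSrc π a i ∧
    ((∃ e, (G.label e : ℕ) = a ∧ (π (G.src e) : ℕ) = G.nextSrc π a i) ∨ G.nextSrc π a i = n) :=
  Nat.sInf_mem (s := {k | i ≤ k ∧ ((∃ e, (G.label e : ℕ) = a ∧ (π (G.src e) : ℕ) = k) ∨ k = n)})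
    ⟨n, hi, Or.inr rfl⟩

theorem lowTgt_le {e : E} (ha : (G.label e : ℕ) = a) (hi : i ≤ π (G.src e)) :
    G.lowTgt π a i ≤ π (G.tgt e) :=
  Nat.sInf_le ⟨e, ha, hi, rfl⟩

theorem exists_eq_lowTgt {e : E} (ha : (G.label e : ℕ) = a) (hi : i ≤ π (G.src e)) :
    ∃ e', (G.label e' : ℕ) = a ∧ i ≤ (π (G.src e') : ℕ) ∧ (π (G.tgt e') : ℕ) = G.lowTgt π a i :=
  Nat.sInf_mem
    (s := {k | ∃ e, (G.label e : ℕ) = a ∧ i ≤ (π (G.src e) : ℕ) ∧ (π (G.tgt e) : ℕ) = k})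
    ⟨_, e, ha, hi, rfl⟩

theorem lowTgt_eq_zero (h : ∀ e, (G.label e : ℕ) = a → (π (G.src e) : ℕ) < i) :
    G.lowTgt π a i = 0 := by
  unfold lowTgt
  convert Nat.sInf_empty
  ext k
  simp only [Set.mem_ofPred_eq, Set.mem_empty_iff_false, iff_false]
  rintro ⟨e, h1, h2, -⟩
  exact absurd (h e h1) (by omega)

theorem lowTgt_le_card : G.lowTgt π a i ≤ n := by
  by_cases h : ∃ e, (G.label e : ℕ) = a ∧ i ≤ (π (G.src e) : ℕ)
  · obtain ⟨e, h1, h2⟩ := h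
    exact (lowTgt_le h1 h2).trans (π (G.tgt e)).isLt.le
  · push Not at h
    rw [lowTgt_eq_zero h]
    exact Nat.zero_le n

theorem bddAbove_tgt : BddAbove {k | ∃ e, (G.label e : ℕ) = a ∧ (π (G.src e) : ℕ) < j ∧
    (π (G.tgt e) : ℕ) + 1 = k} := by
  refine ⟨n, ?_⟩
  rintro k ⟨e, -, -, rfl⟩
  exact (π (G.tgt e)).isLt

theorem lt_highTgt {e : E} (ha : (G.label e : ℕ) = a) (hj : π (G.src e) < j) :
    π (G.tgt e) < G.highTgt π a j := by
  rw [highTgt, if_pos ⟨e, ha, hj⟩]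
  exact le_csSup bddAbove_tgt ⟨e, ha, hj, rfl⟩

theorem exists_eq_highTgt {e : E} (ha : (G.label e : ℕ) = a) (hj : π (G.src e) < j) :
    ∃ e', (G.label e' : ℕ) = a ∧ (π (G.src e') : ℕ) < j ∧
      (π (G.tgt e') : ℕ) + 1 = G.highTgt π a j := by
  rw [highTgt, if_pos ⟨e, ha, hj⟩]
  exact Nat.sSup_mem (s := {k | ∃ e, (G.label e : ℕ) = a ∧ (π (G.src e) : ℕ) < j ∧
    (π (G.tgt e) : ℕ) + 1 = k}) ⟨_, e, ha, hj, rfl⟩ bddAbove_tgt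

theorem highTgt_eq_lowTgt (h : ∀ e, (G.label e : ℕ) = a → j ≤ (π (G.src e) : ℕ)) :
    G.highTgt π a j = G.lowTgt π a j := by
  rw [highTgt, if_neg]
  rintro ⟨e, h1, h2⟩
  exact absurd (h e h1) (by omega)

theorem highTgt_le_card : G.highTgt π a j ≤ n := by
  by_cases h : ∃ e, (G.label e : ℕ) = a ∧ (π (G.src e) : ℕ) < j
  · obtain ⟨e, h1, h2⟩ := h
    obtain ⟨e', -, -, h3⟩ := exists_eq_highTgt h1 h2
    rw [← h3]
    exact (π (G.tgt e')).isLt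
  · push Not at h
    rw [highTgt_eq_lowTgt h]
    exact lowTgt_le_card

theorem IsWheelerOrder.tgt_lt (W : G.IsWheelerOrder π) {e e' : E}
    (h : (G.label e : ℕ) < G.label e') : (π (G.tgt e) : ℕ) < π (G.tgt e') :=
  W.lt_of_label_lt e e' h

theorem IsWheelerOrder.tgt_le (W : G.IsWheelerOrder π) {e e' : E}
    (h : (G.label e : ℕ) = G.label e') (hs : (π (G.src e) : ℕ) < π (G.src e')) :
    (π (G.tgt e) : ℕ) ≤ π (G.tgt e') :=
  W.le_of_label_eq e e' (Fin.ext h) hs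

theorem IsWheelerOrder.inDeg_pos_of_le (W : G.IsWheelerOrder π) {u v : V}
    (h : (π u : ℕ) ≤ π v) (hu : 0 < G.inDeg u) : 0 < G.inDeg v := by
  by_contra hv
  have := W.sources_first v u (by omega) hu
  exact absurd (Fin.lt_def.1 this) (by omega)

/-- Sources come first, so `v` has an in-edge. A smaller or larger label on it would put `v`
strictly before or after both targets. -/
theorem IsWheelerOrder.exists_label_eq [Finite E] (W : G.IsWheelerOrder π) {e e' : E} {v : V}
    (h : (G.label e : ℕ) = G.label e') (h1 : (π (G.tgt e) : ℕ) ≤ π v)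
    (h2 : (π v : ℕ) ≤ π (G.tgt e')) : ∃ f, (G.label f : ℕ) = G.label e ∧ G.tgt f = v := by
  obtain ⟨f, rfl⟩ := G.inDeg_pos_iff.1 (W.inDeg_pos_of_le h1 (G.inDeg_pos_iff.2 ⟨e, rfl⟩))
  refine ⟨f, ?_, rfl⟩
  rcases lt_trichotomy (G.label f : ℕ) (G.label e) with hl | hl | hl
  · exact absurd (W.tgt_lt hl) (by omega)
  · exact hl
  · exact absurd (W.tgt_lt (h ▸ hl)) (by omega)

/-- A vertex in the range of targets has an in-edge `f` labelled `a`. If the source of `f` is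
outside `[i, j)`, monotonicity forces its target to be the extreme target on that side, which an
edge leaving `[i, j)` also enters: the extremal edge itself, or the edge `e0` that exists by `hne`.
-/
theorem IsWheelerOrder.image_interval [Finite E] (W : G.IsWheelerOrder π)
    (hne : G.nextSrc π a i < j) (hj : j ≤ n) (hi : i ≤ n) (v : V) :
    (∃ e, (i ≤ (π (G.src e) : ℕ) ∧ (π (G.src e) : ℕ) < j) ∧ (G.label e : ℕ) = a ∧ G.tgt e = v) ↔
      G.lowTgt π a i ≤ π v ∧ π v < G.highTgt π a j := by
  constructor
  · rintro ⟨e, ⟨h1, h2⟩, ha, rfl⟩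
    exact ⟨lowTgt_le ha h1, lt_highTgt ha h2⟩
  · rintro ⟨hlo, hhi⟩
    obtain ⟨hi1, ⟨e0, ha0, he0⟩ | hn⟩ := nextSrc_spec (G := G) (π := π) (a := a) hi
    swap
    · omega
    obtain ⟨e1, ha1, hs1, ht1⟩ := exists_eq_lowTgt (π := π) (i := i) ha0 (by omega)
    obtain ⟨e2, ha2, hs2, ht2⟩ := exists_eq_highTgt (π := π) (j := j) ha0 (by omega)
    obtain ⟨f, hfa, rfl⟩ := W.exists_label_eq (v := v) (ha1.trans ha2.symm) (by omega) (by omega)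
    have hπ : ∀ {u v : V}, (π u : ℕ) = π v → u = v := fun h => π.injective (Fin.ext h)
    by_cases hfi : (π (G.src f) : ℕ) < i
    · have hle := W.tgt_le (e := f) (e' := e1) hfa (by omega)
      have heq : G.tgt e1 = G.tgt f := hπ (by omega)
      by_cases h1j : (π (G.src e1) : ℕ) < j
      · exact ⟨e1, ⟨hs1, h1j⟩, ha1, heq⟩
      · have h01 := W.tgt_le (e := e0) (e' := e1) (ha0.trans ha1.symm) (by omega)
        have h10 := lowTgt_le (π := π) (i := i) ha0 (by omega)
        exact ⟨e0, ⟨by omega, by omega⟩, ha0, hπ (by omega)⟩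
    by_cases hfj : j ≤ (π (G.src f) : ℕ)
    · have hle := W.tgt_le (e := e2) (e' := f) ((ha2.trans ha1.symm).trans hfa.symm) (by omega)
      have heq : G.tgt e2 = G.tgt f := hπ (by omega)
      by_cases h2i : i ≤ (π (G.src e2) : ℕ)
      · exact ⟨e2, ⟨h2i, hs2⟩, ha2, heq⟩
      · have h01 := W.tgt_le (e := e2) (e' := e0) (ha2.trans ha0.symm) (by omega)
        have h10 := lt_highTgt (π := π) (j := j) ha0 (by omega)
        exact ⟨e0, ⟨by omega, by omega⟩, ha0, hπ (by omega)⟩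
    · exact ⟨f, ⟨by omega, by omega⟩, hfa.trans ha1, rfl⟩

/-- Consecutive targets. -/
theorem IsWheelerOrder.tgt_eq_succ [Finite E] (W : G.IsWheelerOrder π) {e e' : E}
    (hl : (G.label e' : ℕ) = G.label e) (hs : (π (G.src e') : ℕ) < π (G.src e))
    (hin : G.inDeg (G.tgt e) = 1) (hout : G.outDeg (G.src e) = 1)
    (hmax : ∀ f, (G.label f : ℕ) = G.label e → (π (G.src f) : ℕ) < π (G.src e) →
      (π (G.tgt f) : ℕ) ≤ π (G.tgt e')) :
    (π (G.tgt e) : ℕ) = π (G.tgt e') + 1 := by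
  have hπ : ∀ {u v : V}, (π u : ℕ) = π v → u = v := fun h => π.injective (Fin.ext h)
  have h1 := W.tgt_le hl hs
  have h2 : (π (G.tgt e') : ℕ) ≠ π (G.tgt e) := by
    intro h
    have := G.eq_of_inDeg_eq_one hin (hπ h)
    subst this
    omega
  -- A vertex strictly between the two targets would be entered by an edge `f` with the same label.
  -- Its source cannot precede that of `e` by `hmax`, cannot equal it by the out-degree, and cannot
  -- follow it by monotonicity.
  by_contra h3
  have hlt : (π (G.tgt e') : ℕ) + 1 < n := by have := (π (G.tgt e)).isLt; omega
  set v := π.symm ⟨(π (G.tgt e') : ℕ) + 1, hlt⟩ with hv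
  have hrv : (π v : ℕ) = (π (G.tgt e') : ℕ) + 1 := by rw [hv, Equiv.apply_symm_apply]
  obtain ⟨f, hfa, hfv⟩ := W.exists_label_eq (v := v) hl (by omega) (by omega)
  rw [← hfv] at hrv
  rcases lt_trichotomy (π (G.src f) : ℕ) (π (G.src e)) with h | h | h
  · have := hmax f (hfa.trans hl) h
    omega
  · have := G.eq_of_outDeg_eq_one hout (hπ h)
    subst this
    omega
  · have := W.tgt_le (hl.symm.trans hfa.symm) h
    omega

end step

end LabelledDigraph

/-! ### Runs -/

section runs
variable {A : Type} [DecidableEq A]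

/-- A group closes wherever a letter differs from the next one. The last position counts too, since
`some` differs from `none`. -/
theorem length_splitBy_loop (l : List A) : ∀ (a : A) (g : List A) (gs : List (List A)),
    (List.splitBy.loop (fun a b => decide (a = b)) l a g gs).length = gs.length +
      ∑ p ∈ Finset.range (l.length + 1), if (a :: l)[p]? ≠ (a :: l)[p + 1]? then 1 else 0 := by
  induction l with
  | nil => simp [List.splitBy.loop]
  | cons b l ih =>
    intro a g gs
    rw [List.length_cons, Finset.sum_range_succ']
    by_cases h : a = b
    · simp only [List.splitBy.loop, h, decide_true]
      rw [ih]
      simp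
    · simp only [List.splitBy.loop, h, decide_false]
      rw [ih]
      simp [h]
      omega

theorem runs_eq_card (B : List A) :
    runs B = ((Finset.range B.length).filter (fun p => B[p]? ≠ B[p + 1]?)).card := by
  cases B with
  | nil => simp [runs]
  | cons a l =>
    rw [Finset.card_filter, runs, List.splitBy, length_splitBy_loop]
    simp

/-- The last occurrence of each letter ends a run. -/
theorem card_toFinset_le_runs (B : List A) : B.toFinset.card ≤ runs B := by
  classical
  rw [runs_eq_card]
  refine (Finset.card_le_card_of_surjOn (fun p => B[p]?)
    (t := B.toFinset.image some) ?_).trans' ?_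
  · intro x hx
    simp only [Finset.coe_image, Set.mem_image, Finset.mem_coe, List.mem_toFinset] at hx
    obtain ⟨a, ha, rfl⟩ := hx
    have hne : ((Finset.range B.length).filter (fun p => B[p]? = some a)).Nonempty := by
      obtain ⟨p, hp, rfl⟩ := List.mem_iff_getElem.1 ha
      exact ⟨p, by simp [hp]⟩
    have hmem := Finset.max'_mem _ hne
    set p := Finset.max' _ hne
    rw [Finset.mem_filter, Finset.mem_range] at hmem
    refine ⟨p, ?_, hmem.2⟩
    simp only [Finset.coe_filter, Finset.mem_range, Set.mem_ofPred_eq]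
    refine ⟨hmem.1, ?_⟩
    intro heq
    rw [hmem.2] at heq
    have hlt : p + 1 < B.length := by
      by_contra hcon
      rw [List.getElem?_eq_none (by omega)] at heq
      simp at heq
    have := Finset.le_max' ((Finset.range B.length).filter (fun p => B[p]? = some a)) (p + 1)
      (Finset.mem_filter.2 ⟨Finset.mem_range.2 hlt, heq.symm⟩)
    change p + 1 ≤ p at this
    omega
  · rw [Finset.card_image_of_injective _ (Option.some_injective A)]

end runs

/-! ### The piecewise linear functions that the index stores -/

/-- The data that are stored for a key. The first three values grow by `slope` from each key to the
next. -/
structure Rec where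
  (src low high ident slope : ℕ)

/-- `r'` continues the linear piece on which `r` lies. -/
def Rec.Extends (r r' : Rec) : Prop :=
  r'.slope = r.slope ∧ r'.src = r.src + r.slope ∧ r'.low = r.low + r.slope ∧
    r'.high = r.high + r.slope ∧ r'.ident = r.ident

/-- The key for the letter `a` and the rank `i`. -/
def letterKey (n a i : ℕ) : ℕ := (a + 1) * (n + 1) + i

theorem letterKey_lt {n σ a i : ℕ} (ha : a < σ) (hi : i ≤ n) :
    letterKey n a i < (σ + 1) * (n + 1) := by
  have : (a + 1 + 1) * (n + 1) ≤ (σ + 1) * (n + 1) := Nat.mul_le_mul_right _ (by omega)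
  have h2 : (a + 1 + 1) * (n + 1) = (a + 1) * (n + 1) + (n + 1) := by ring
  unfold letterKey
  omega

theorem lt_letterKey (n a i : ℕ) : n < letterKey n a i := by
  have : 1 * (n + 1) ≤ (a + 1) * (n + 1) := Nat.mul_le_mul_right _ (by omega)
  unfold letterKey
  omega

namespace LabelledDigraph

/-! ### Records, relevant keys and breaks -/

section records
variable {V E : Type} {σ n : ℕ} (G : LabelledDigraph V E (Fin σ)) (π : V ≃ Fin n)
  (D : List (List E)) (ident : V ≃ Fin n)

/-- An inner edge labelled `a` leaves the vertex of rank `i`. -/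
def InnerAt (a i : ℕ) : Prop :=
  ∃ e ∉ boundary D, (G.label e : ℕ) = a ∧ (π (G.src e) : ℕ) = i

/-- The identifier of the vertex of rank `r`. -/
def identAt (r : ℕ) : ℕ := if h : r < n then ident (π.symm ⟨r, h⟩) else 0

/-- The rank of the vertex with identifier `x`. -/
def rankOf (x : ℕ) : ℕ := if h : x < n then π (ident.symm ⟨x, h⟩) else 0

open scoped Classical in
/-- The data for the letter `a` and the rank `i`. -/
noncomputable def letterRec (a i : ℕ) : Rec where
  src := G.nextSrc π a i
  low := G.lowTgt π a i
  high := G.highTgt π a i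
  -- From the current identifier `d`, the next one is `slope * (d + 1) + ident`: an inner edge adds
  -- 1 to `d`, and elsewhere the stored identifier replaces it.
  ident := if G.InnerAt π D a i then 0 else identAt π ident (G.lowTgt π a i)
  slope := if G.InnerAt π D a i then 1 else 0

/-- The data for the identifier `x`: the identifier of the next vertex in the Wheeler order. -/
def identRec (x : ℕ) : Rec where
  -- Reporting reads only `low`; the copies make `Rec.Extends` hold for all three fields alike.
  src := identAt π ident (rankOf π ident x + 1)
  low := identAt π ident (rankOf π ident x + 1)
  high := identAt π ident (rankOf π ident x + 1)
  ident := 0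
  slope := 1

/-- The data for the key `k`. -/
noncomputable def record (k : ℕ) : Rec :=
  if k ≤ n then identRec π ident k else G.letterRec π D ident (k / (n + 1) - 1) (k % (n + 1))

/-- The keys that are looked up by queries. -/
def Relevant (k : ℕ) : Prop :=
  -- Vertices of in-degree 0 are left out: isolated vertices lie on no path, so irregularities in
  -- their identifiers cannot be charged to `D`. Only the empty pattern reaches vertices of
  -- in-degree 0, and it is answered without the index.
  (∃ v, 0 < G.inDeg v ∧ (ident v : ℕ) = k) ∨ ∃ a < σ, ∃ i ≤ n, letterKey n a i = k

open scoped Classical in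
/-- The keys at which a linear piece begins. -/
noncomputable def breakKeys : Finset ℕ :=
  (Finset.range ((σ + 1) * (n + 1))).filter fun k => k = 0 ∨ (G.Relevant ident k ∧
    ¬ (0 < k ∧ G.Relevant ident (k - 1) ∧
      (G.record π D ident (k - 1)).Extends (G.record π D ident k)))

variable {G π D ident}

theorem identAt_rank (v : V) : identAt π ident (π v) = ident v := by
  simp [identAt]

theorem identAt_le (r : ℕ) : identAt π ident r ≤ n := by
  unfold identAt
  split_ifs
  · exact (ident _).isLt.le
  · exact Nat.zero_le n

theorem rankOf_ident (v : V) : rankOf π ident (ident v) = π v := by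
  simp [rankOf]

theorem record_ident (v : V) : G.record π D ident (ident v) = identRec π ident (ident v) := by
  rw [record, if_pos (ident v).isLt.le]

theorem record_letterKey {a i : ℕ} (hi : i ≤ n) :
    G.record π D ident (letterKey n a i) = G.letterRec π D ident a i := by
  rw [record, if_neg (by have := lt_letterKey n a i; omega)]
  have h1 : letterKey n a i / (n + 1) = a + 1 := by
    unfold letterKey
    rw [mul_comm, Nat.mul_add_div (by omega), Nat.div_eq_of_lt (by omega), add_zero]
  have h2 : letterKey n a i % (n + 1) = i := by
    unfold letterKey
    rw [mul_comm, Nat.mul_add_mod, Nat.mod_eq_of_lt (by omega)]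
  rw [h1, h2, Nat.add_sub_cancel]

theorem record_le (k : ℕ) : (G.record π D ident k).src ≤ n ∧ (G.record π D ident k).low ≤ n ∧
    (G.record π D ident k).high ≤ n ∧ (G.record π D ident k).ident ≤ n ∧
    (G.record π D ident k).slope ≤ 1 := by
  unfold record
  split_ifs with h
  · exact ⟨identAt_le _, identAt_le _, identAt_le _, Nat.zero_le _, le_rfl⟩
  · refine ⟨nextSrc_le_card (Nat.le_of_lt_succ (Nat.mod_lt _ (by omega))), lowTgt_le_card,
      highTgt_le_card, ?_, ?_⟩
    · simp only [letterRec]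
      split_ifs
      · exact Nat.zero_le _
      · exact identAt_le _
    · simp only [letterRec]
      split_ifs <;> omega

theorem Relevant.lt {k : ℕ} (h : G.Relevant ident k) : k < (σ + 1) * (n + 1) := by
  rcases h with ⟨v, -, rfl⟩ | ⟨a, ha, i, hi, rfl⟩
  · have := (ident v).isLt
    nlinarith
  · exact letterKey_lt ha hi

theorem zero_mem_breakKeys : 0 ∈ G.breakKeys π D ident := by
  simp only [breakKeys, Finset.mem_filter, Finset.mem_range]
  exact ⟨by positivity, Or.inl trivial⟩

theorem breakKeys_lt {k : ℕ} (h : k ∈ G.breakKeys π D ident) : k < (σ + 1) * (n + 1) := by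
  simp only [breakKeys, Finset.mem_filter, Finset.mem_range] at h
  exact h.1

/-- The data of a key follow from those of the preceding break. -/
theorem record_eq {k : ℕ} (hk : G.Relevant ident k) {k0 : ℕ} (h0 : k0 ≤ k)
    (hlast : ∀ s ∈ G.breakKeys π D ident, s ≤ k → s ≤ k0) :
    let r := G.record π D ident k
    let r0 := G.record π D ident k0
    r.slope = r0.slope ∧ r.src = r0.src + r0.slope * (k - k0) ∧
      r.low = r0.low + r0.slope * (k - k0) ∧ r.high = r0.high + r0.slope * (k - k0) ∧
      r.ident = r0.ident := by
  induction k with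
  | zero =>
    obtain rfl : k0 = 0 := by omega
    simp
  | succ k ih =>
    rcases h0.eq_or_lt with rfl | h0
    · simp
    · have hnot : k + 1 ∉ G.breakKeys π D ident := fun hmem => by
        have := hlast _ hmem le_rfl
        omega
      simp only [breakKeys, Finset.mem_filter, Finset.mem_range] at hnot
      obtain ⟨-, hrel, hext⟩ : 0 < k + 1 ∧ G.Relevant ident (k + 1 - 1) ∧
          (G.record π D ident (k + 1 - 1)).Extends (G.record π D ident (k + 1)) :=
        by_contra fun hcon => hnot ⟨hk.lt, Or.inr ⟨hk, hcon⟩⟩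
      rw [Nat.add_sub_cancel] at hrel hext
      obtain ⟨i1, i2, i3, i4, i5⟩ := ih hrel (by omega) fun s hs hsk => hlast s hs (by omega)
      obtain ⟨e1, e2, e3, e4, e5⟩ := hext
      have hmul : ∀ s, s * (k + 1 - k0) = s * (k - k0) + s := by
        intro s
        rw [show k + 1 - k0 = (k - k0) + 1 by omega]
        ring
      simp only [e1, e2, e3, e4, e5, i1, i2, i3, i4, i5, hmul]
      refine ⟨trivial, ?_, ?_, ?_, trivial⟩ <;> ring

end records

end LabelledDigraph
namespace LabelledDigraph

/-! ### The number of linear pieces -/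

section pieces
variable {V E : Type} {σ n : ℕ} {G : LabelledDigraph V E (Fin σ)} {π : V ≃ Fin n}
  {D : List (List E)} {ident : V ≃ Fin n}

theorem eq_of_rank_eq {u v : V} (h : (π u : ℕ) = π v) : u = v := π.injective (Fin.ext h)

theorem nextSrc_eq_self {e : E} : G.nextSrc π (G.label e) (π (G.src e)) = π (G.src e) :=
  le_antisymm (nextSrc_le rfl le_rfl) (nextSrc_spec (π (G.src e)).isLt.le).1

/-- Only `e` itself leaves its source, and later sources have no earlier targets. -/
theorem lowTgt_inner (W : G.IsWheelerOrder π) (hD : G.IsPathDecomposition D) {e : E}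
    (he : e ∉ boundary D) : G.lowTgt π (G.label e) (π (G.src e)) = π (G.tgt e) := by
  obtain ⟨-, hout, -⟩ := hD.inner he
  apply le_antisymm (lowTgt_le rfl le_rfl)
  obtain ⟨f, hf, hs, ht⟩ := exists_eq_lowTgt (π := π) (e := e) rfl le_rfl
  rw [← ht]
  rcases hs.eq_or_lt with h | h
  · rw [G.eq_of_outDeg_eq_one hout (eq_of_rank_eq h.symm)]
  · exact W.tgt_le hf.symm h

/-- By `tgt_eq_succ` the greatest earlier target immediately precedes the target of `e`; if there is
none, the default in `highTgt` gives the same value. -/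
theorem highTgt_inner [Finite E] (W : G.IsWheelerOrder π) (hD : G.IsPathDecomposition D) {e : E}
    (he : e ∉ boundary D) : G.highTgt π (G.label e) (π (G.src e)) = π (G.tgt e) := by
  obtain ⟨-, hout, hin, -⟩ := hD.inner he
  by_cases h : ∃ f, (G.label f : ℕ) = G.label e ∧ (π (G.src f) : ℕ) < π (G.src e)
  · obtain ⟨f0, h1, h2⟩ := h
    obtain ⟨f, hf, hs, ht⟩ := exists_eq_highTgt (π := π) h1 h2
    rw [← ht]
    refine (W.tgt_eq_succ hf hs hin hout fun g hg hgs => ?_).symm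
    have := lt_highTgt (π := π) hg hgs
    omega
  · push Not at h
    rw [highTgt_eq_lowTgt h, lowTgt_inner W hD he]

/-- The source of slope 1: no edge other than `e` leaves the rank just before that of `f`, so `e`
attains the greatest target before that of `f`. -/
theorem tgt_inner_succ [Finite E] (W : G.IsWheelerOrder π) (hD : G.IsPathDecomposition D) {e f : E}
    (he : e ∉ boundary D) (hf : f ∉ boundary D) (hl : (G.label e : ℕ) = G.label f)
    (hs : (π (G.src f) : ℕ) = π (G.src e) + 1) : (π (G.tgt f) : ℕ) = π (G.tgt e) + 1 := by
  obtain ⟨-, hout, hin, -⟩ := hD.inner hf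
  obtain ⟨-, houte, -⟩ := hD.inner he
  refine W.tgt_eq_succ hl (by omega) hin hout fun g hg hgs => ?_
  rcases lt_or_eq_of_le (show (π (G.src g) : ℕ) ≤ π (G.src e) by omega) with h | h
  · exact W.tgt_le (hg.trans hl.symm) h
  · rw [G.eq_of_outDeg_eq_one houte (eq_of_rank_eq h)]

/-- Pieces of slope 0. A boundary edge leaving rank `i + 1` does no harm: `nextSrc` and `lowTgt`
already anticipate it, and `highTgt` does not yet see it. An inner edge there would change the
slope. -/
theorem letterRec_extends_of_forall_ne {a i : ℕ} (hi : i < n)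
    (h : ∀ e, (G.label e : ℕ) = a → (π (G.src e) : ℕ) ≠ i) (h' : ¬ G.InnerAt π D a (i + 1)) :
    (G.letterRec π D ident a i).Extends (G.letterRec π D ident a (i + 1)) := by
  have h1 : ¬ G.InnerAt π D a i := fun ⟨e, _, h1, h2⟩ => h e h1 h2
  have hsrc : G.nextSrc π a (i + 1) = G.nextSrc π a i := by
    unfold nextSrc
    congr 1
    ext k
    simp only [Set.mem_ofPred_eq]
    constructor
    · rintro ⟨h2, h3⟩
      exact ⟨by omega, h3⟩
    · rintro ⟨h2, h3⟩
      refine ⟨?_, h3⟩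
      rcases h3 with ⟨e, he, hk⟩ | rfl
      · have := h e he
        omega
      · omega
  have hlow : G.lowTgt π a (i + 1) = G.lowTgt π a i := by
    unfold lowTgt
    congr 1
    ext k
    simp only [Set.mem_ofPred_eq]
    refine exists_congr fun e => and_congr_right fun he => and_congr_left fun _ => ?_
    have := h e he
    omega
  have hlt : ∀ e, (G.label e : ℕ) = a → ((π (G.src e) : ℕ) < i + 1 ↔ (π (G.src e) : ℕ) < i) := by
    intro e he
    have := h e he
    omega
  have hhigh : G.highTgt π a (i + 1) = G.highTgt π a i := by
    by_cases hex : ∃ e, (G.label e : ℕ) = a ∧ (π (G.src e) : ℕ) < i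
    · have hex' : ∃ e, (G.label e : ℕ) = a ∧ (π (G.src e) : ℕ) < i + 1 := by
        obtain ⟨e, he, hs⟩ := hex
        exact ⟨e, he, by omega⟩
      unfold highTgt
      rw [if_pos hex, if_pos hex']
      congr 1
      ext k
      simp only [Set.mem_ofPred_eq]
      exact exists_congr fun e => and_congr_right fun he => and_congr_left fun _ => hlt e he
    · push Not at hex
      rw [highTgt_eq_lowTgt hex, highTgt_eq_lowTgt, hlow]
      intro e he
      have := hex e he
      have := h e he
      omega
  simp only [Rec.Extends, letterRec, if_neg h1, if_neg h', hsrc, hlow, hhigh]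
  simp

theorem letterRec_extends_of_innerAt [Finite E] (W : G.IsWheelerOrder π)
    (hD : G.IsPathDecomposition D) {a i : ℕ} (h : G.InnerAt π D a i)
    (h' : G.InnerAt π D a (i + 1)) :
    (G.letterRec π D ident a i).Extends (G.letterRec π D ident a (i + 1)) := by
  have h1 := h
  have h2 := h'
  obtain ⟨e, he, rfl, rfl⟩ := h
  obtain ⟨f, hf, hl, hs⟩ := h'
  have ht := tgt_inner_succ W hD he hf hl.symm hs
  have hsrc := nextSrc_eq_self (G := G) (π := π) (e := f)
  have hlow := lowTgt_inner W hD hf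
  have hhigh := highTgt_inner W hD hf
  rw [hl, hs] at hsrc hlow hhigh
  simp only [Rec.Extends, letterRec, if_pos h1, if_pos h2, hsrc, hlow, hhigh, nextSrc_eq_self,
    lowTgt_inner W hD he, highTgt_inner W hD he, ht]
  simp

/-- The successors of the two ends of `e` are the two ends of `f`, and the identifiers grow by 1
along `f`. -/
theorem identRec_extends [Finite E] (W : G.IsWheelerOrder π) (hD : G.IsPathDecomposition D)
    (hI : G.IsIdentifierAssignment D ident) {e f : E} (he : e ∉ boundary D) (hf : f ∉ boundary D)
    (hl : (G.label e : ℕ) = G.label f) (hs : (π (G.src f) : ℕ) = π (G.src e) + 1) :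
    (identRec π ident (ident (G.src e))).Extends (identRec π ident (ident (G.tgt e))) := by
  obtain ⟨-, -, -, -, hf1, hf2⟩ := hD.inner hf
  have h1 : identAt π ident (rankOf π ident (ident (G.src e)) + 1) = ident (G.src f) := by
    rw [rankOf_ident, ← hs, identAt_rank]
  have h2 : identAt π ident (rankOf π ident (ident (G.tgt e)) + 1) = ident (G.tgt f) := by
    rw [rankOf_ident, ← tgt_inner_succ W hD he hf hl hs, identAt_rank]
  simp only [Rec.Extends, identRec, h1, h2, hI f hf1 hf2]
  simp

/-- Letters that do not occur all have the same constant record, so they cost no space however large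
the alphabet is. -/
theorem letterRec_extends_of_not_occurs {a b i j : ℕ} (hi : i ≤ n) (hj : j ≤ n)
    (ha : ∀ e, (G.label e : ℕ) ≠ a) (hb : ∀ e, (G.label e : ℕ) ≠ b) :
    (G.letterRec π D ident a i).Extends (G.letterRec π D ident b j) := by
  have hval : ∀ {c k : ℕ}, k ≤ n → (∀ e, (G.label e : ℕ) ≠ c) →
      G.letterRec π D ident c k = ⟨n, 0, 0, identAt π ident 0, 0⟩ := by
    intro c k hk hc
    have h1 : ¬ G.InnerAt π D c k := fun ⟨e, _, h1, h2⟩ => hc e h1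
    have h2 : G.nextSrc π c k = n := by
      rcases (nextSrc_spec (G := G) (π := π) (a := c) hk).2 with ⟨e, he, -⟩ | h
      · exact absurd he (hc e)
      · exact h
    have h3 : G.lowTgt π c k = 0 := lowTgt_eq_zero fun e he => absurd he (hc e)
    have h4 : G.highTgt π c k = 0 := by
      rw [highTgt_eq_lowTgt fun e he => absurd he (hc e), h3]
    simp only [letterRec, if_neg h1, h2, h3, h4]
  rw [hval hi ha, hval hj hb]
  simp [Rec.Extends]

/-! #### Exceptional ranks -/

variable (π D) in
open scoped Classical in
/-- The ranks at which a new linear piece may begin. -/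
noncomputable def exceptional (G : LabelledDigraph V E (Fin σ)) (es : List E) : Finset ℕ :=
  {n} ∪ (Finset.range n).filter (fun i => ∃ u v, (π u : ℕ) + 1 = i ∧ (π v : ℕ) = i ∧
      G.inDeg u = 0 ∧ 0 < G.inDeg v) ∪
    ((boundary D).toFinset.image (fun e => (π (G.src e) : ℕ)) ∪
      (boundary D).toFinset.image (fun e => (π (G.src e) : ℕ) + 1) ∪
      (boundary D).toFinset.image (fun e => (π (G.tgt e) : ℕ)) ∪
      (boundary D).toFinset.image (fun e => (π (G.tgt e) : ℕ) + 1)) ∪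
    ((Finset.range es.length).filter
      (fun p => (es.map G.label)[p]? ≠ (es.map G.label)[p + 1]?)).image
      -- The rank at which the next run begins; the last run has no successor, and 0 is a dummy.
      (fun p => if h : p + 1 < es.length then (π (G.src es[p + 1]) : ℕ) else 0)

theorem card_exceptional_le (W : G.IsWheelerOrder π) (es : List E) :
    (exceptional π D G es).card ≤ 2 + 8 * D.length + runs (es.map G.label) := by
  classical
  have hb : (boundary D).toFinset.card ≤ 2 * D.length :=
    (List.toFinset_card_le _).trans (length_boundary_le D)
  have h1 : ((Finset.range n).filter (fun i => ∃ u v, (π u : ℕ) + 1 = i ∧ (π v : ℕ) = i ∧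
      G.inDeg u = 0 ∧ 0 < G.inDeg v)).card ≤ 1 := by
    have hlt : ∀ u v u' v' : V, (π u : ℕ) + 1 = π v → (π u' : ℕ) + 1 = π v' →
        G.inDeg u' = 0 → 0 < G.inDeg v → ¬ (π v : ℕ) < π v' := by
      intro u v u' v' h1 h2 h3 h4 h5
      have := W.inDeg_pos_of_le (u := v) (v := u') (by omega) h4
      omega
    refine Finset.card_le_one.2 fun i hi j hj => ?_
    simp only [Finset.mem_filter] at hi hj
    obtain ⟨-, u, v, h1, h2, h3, h4⟩ := hi
    obtain ⟨-, u', v', h1', h2', h3', h4'⟩ := hj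
    have := hlt u v u' v' (by omega) (by omega) h3' h4
    have := hlt u' v' u v (by omega) (by omega) h3 h4'
    omega
  unfold exceptional
  refine (Finset.card_union_le _ _).trans ?_
  refine Nat.add_le_add ((Finset.card_union_le _ _).trans (Nat.add_le_add
    ((Finset.card_union_le _ _).trans (Nat.add_le_add (Finset.card_singleton _).le h1)) ?_)) ?_
  · refine (Finset.card_union_le _ _).trans ?_
    refine (Nat.add_le_add ((Finset.card_union_le _ _).trans (Nat.add_le_add
      ((Finset.card_union_le _ _).trans (Nat.add_le_add Finset.card_image_le
        Finset.card_image_le)) Finset.card_image_le)) Finset.card_image_le).trans ?_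
    omega
  · refine Finset.card_image_le.trans ?_
    rw [runs_eq_card, List.length_map]

theorem ne_of_notMem_exceptional {es : List E} {i : ℕ} (hi : i ∉ exceptional π D G es) :
    i ≠ n ∧ (∀ u v, (π u : ℕ) + 1 = i → (π v : ℕ) = i → G.inDeg u = 0 → ¬ 0 < G.inDeg v) ∧
    (∀ e ∈ boundary D, (π (G.src e) : ℕ) ≠ i ∧ (π (G.src e) : ℕ) + 1 ≠ i ∧
      (π (G.tgt e) : ℕ) ≠ i ∧ (π (G.tgt e) : ℕ) + 1 ≠ i) ∧
    (∀ p (h : p + 1 < es.length), (π (G.src es[p + 1]) : ℕ) = i →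
      G.label es[p] = G.label es[p + 1]) := by
  classical
  simp only [exceptional, Finset.mem_union, not_or, Finset.mem_singleton, Finset.mem_image,
    Finset.mem_filter, Finset.mem_range, List.mem_toFinset, not_exists, not_and] at hi
  obtain ⟨⟨⟨h1, h2⟩, ⟨⟨h3, h4⟩, h5⟩, h6⟩, h7⟩ := hi
  refine ⟨h1, fun u v hu hv hu0 hv0 => h2 (hv ▸ (π v).isLt) u v hu hv hu0 hv0,
    fun e he => ⟨h3 e he, h4 e he, h5 e he, h6 e he⟩, fun p hp hs => ?_⟩
  by_contra hne
  refine h7 p ⟨by omega, ?_⟩ ?_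
  · simpa [hp, show p < es.length by omega] using hne
  · rw [dif_pos hp, hs]

/-- The list `es` contains all edges, ordered by the ranks of their sources. -/
def IsSrcSorted (π : V ≃ Fin n) (G : LabelledDigraph V E (Fin σ)) (es : List E) : Prop :=
  es.Nodup ∧ (∀ e, e ∈ es) ∧
    es.Pairwise (fun e e' => (π (G.src e) : ℕ) ≤ π (G.src e'))

/-- Out-degrees 1 at consecutive ranks make the two edges neighbours in the transform, and no run
ends between them. -/
theorem label_eq_of_notMem_exceptional {es : List E} (hes : IsSrcSorted π G es) {e f : E}
    (hs : (π (G.src f) : ℕ) = π (G.src e) + 1) (he : G.outDeg (G.src e) = 1)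
    (hf : G.outDeg (G.src f) = 1) (hi : (π (G.src f) : ℕ) ∉ exceptional π D G es) :
    G.label e = G.label f := by
  obtain ⟨hnd, hall, hsort⟩ := hes
  obtain ⟨p, hp, rfl⟩ := List.mem_iff_getElem.1 (hall e)
  obtain ⟨q, hq, rfl⟩ := List.mem_iff_getElem.1 (hall f)
  have hmono : ∀ (x y : ℕ) (hx : x < es.length) (hy : y < es.length), x < y →
      (π (G.src es[x]) : ℕ) ≤ π (G.src es[y]) := fun x y hx hy hxy =>
    List.pairwise_iff_getElem.1 hsort x y hx hy hxy
  have hpq : p < q := by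
    rcases lt_trichotomy p q with h | h | h
    · exact h
    · subst h
      omega
    · have := hmono q p hq hp h
      omega
  have hq1 : q = p + 1 := by
    by_contra hne
    have h1 := hmono p (p + 1) hp (by omega) (by omega)
    have h2 := hmono (p + 1) q (by omega) hq (by omega)
    rcases (show (π (G.src es[p + 1]) : ℕ) = π (G.src es[p]) ∨
        (π (G.src es[p + 1]) : ℕ) = π (G.src es[q]) by omega) with h | h
    · have := G.eq_of_outDeg_eq_one he (eq_of_rank_eq h)
      rw [hnd.getElem_inj_iff] at this
      omega
    · have := G.eq_of_outDeg_eq_one hf (eq_of_rank_eq h)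
      rw [hnd.getElem_inj_iff] at this
      omega
  subst hq1
  exact (ne_of_notMem_exceptional hi).2.2.2 p hq rfl

theorem exists_src_eq_of_outDeg_eq_one {v : V} (h : G.outDeg v = 1) : ∃ e, G.src e = v := by
  obtain ⟨x, hx⟩ := Set.ncard_eq_one.1 h
  exact ⟨x, (hx ▸ Set.mem_singleton x : x ∈ {e | G.src e = v})⟩

/-- The next vertex has positive in-degree because the source of `e` has. As its rank is not
exceptional, its in-edge is inner; this gives it out-degree 1, and its out-edge is inner as well. -/
theorem innerAt_succ [Finite E] (W : G.IsWheelerOrder π) (hD : G.IsPathDecomposition D)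
    {es : List E} (hes : IsSrcSorted π G es) {e : E} (he : e ∉ boundary D)
    (hi : (π (G.src e) : ℕ) + 1 ∉ exceptional π D G es) :
    G.InnerAt π D (G.label e) (π (G.src e) + 1) := by
  obtain ⟨hin, hout, -⟩ := hD.inner he
  obtain ⟨h1, h2, h3, -⟩ := ne_of_notMem_exceptional hi
  have hlt : (π (G.src e) : ℕ) + 1 < n := by have := (π (G.src e)).isLt; omega
  obtain ⟨v, hv⟩ : ∃ v, (π v : ℕ) = π (G.src e) + 1 :=
    ⟨π.symm ⟨_, hlt⟩, by rw [Equiv.apply_symm_apply]⟩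
  have hex : ∃ f, G.src f = v := by
    obtain ⟨g, hg⟩ := G.inDeg_pos_iff.1
      (W.inDeg_pos_of_le (u := G.src e) (v := v) (by omega) (by omega))
    by_cases hgb : g ∈ boundary D
    · exact absurd (hg ▸ hv) (h3 g hgb).2.2.1
    · exact exists_src_eq_of_outDeg_eq_one (hg ▸ (hD.inner hgb).2.2.2.1)
  obtain ⟨f, rfl⟩ := hex
  by_cases hfb : f ∈ boundary D
  · exact absurd hv (h3 f hfb).1
  · refine ⟨f, hfb, ?_, hv⟩
    rw [label_eq_of_notMem_exceptional (D := D) hes hv hout (hD.inner hfb).2.1 (hv ▸ hi)]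

/-- The mirror image of `innerAt_succ`. Positive in-degree is not inherited downwards, so the rank
where it begins has to be exceptional. -/
theorem innerAt_pred [Finite E] (hD : G.IsPathDecomposition D)
    {es : List E} (hes : IsSrcSorted π G es) {f : E} (hf : f ∉ boundary D) {i : ℕ}
    (hs : (π (G.src f) : ℕ) = i + 1) (hi : i + 1 ∉ exceptional π D G es) :
    G.InnerAt π D (G.label f) i := by
  obtain ⟨hin, hout, -⟩ := hD.inner hf
  obtain ⟨h1, h2, h3, -⟩ := ne_of_notMem_exceptional hi
  have hlt : i < n := by have := (π (G.src f)).isLt; omega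
  obtain ⟨v, hv⟩ : ∃ v, (π v : ℕ) = i := ⟨π.symm ⟨_, hlt⟩, by rw [Equiv.apply_symm_apply]⟩
  have hex : ∃ e, G.src e = v := by
    have hv0 : 0 < G.inDeg v := by
      by_contra h0
      exact h2 v (G.src f) (by omega) hs (by omega) (by omega)
    obtain ⟨g, hg⟩ := G.inDeg_pos_iff.1 hv0
    by_cases hgb : g ∈ boundary D
    · exact absurd (by rw [hg, hv]) (h3 g hgb).2.2.2
    · exact exists_src_eq_of_outDeg_eq_one (hg ▸ (hD.inner hgb).2.2.2.1)
  obtain ⟨e, rfl⟩ := hex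
  by_cases heb : e ∈ boundary D
  · exact absurd (by rw [hv]) (h3 e heb).2.1
  · refine ⟨e, heb, ?_, hv⟩
    rw [label_eq_of_notMem_exceptional (D := D) hes (by omega) (hD.inner heb).2.1 hout (hs ▸ hi)]

-- Each break is charged to a boundary edge, an exceptional rank, an occurring letter or a fixed
-- key. For an exceptional rank the charged edge is picked by `choose`; the choice is harmless
-- because the edge in question is inner, so its source has no other out-edge.
open scoped Classical in
theorem breakKeys_subset [Finite E] (W : G.IsWheelerOrder π) (hD : G.IsPathDecomposition D)
    (hI : G.IsIdentifierAssignment D ident) {es : List E} (hes : IsSrcSorted π G es) :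
    G.breakKeys π D ident ⊆
      ({0} ∪ (boundary D).toFinset.image (fun e => (ident (G.tgt e) : ℕ)) ∪
      (exceptional π D G es).image (fun i =>
        if h : ∃ e, (π (G.src e) : ℕ) + 1 = i then (ident (G.tgt h.choose) : ℕ) else 0)) ∪
      (({0} ∪ (es.map G.label).toFinset.image Fin.val ∪
        (es.map G.label).toFinset.image (fun a => a.val + 1)).image (fun a => letterKey n a 0) ∪
      (boundary D).toFinset.image (fun e => letterKey n (G.label e) (π (G.src e) + 1)) ∪
      (exceptional π D G es).image (fun i =>
        if h : ∃ e, (π (G.src e) : ℕ) + 1 = i then letterKey n (G.label h.choose) i else 0) ∪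
      (exceptional π D G es).image (fun i =>
        if h : ∃ e, (π (G.src e) : ℕ) = i then letterKey n (G.label h.choose) i else 0)) := by
  intro k hk
  simp only [breakKeys, Finset.mem_filter] at hk
  obtain ⟨-, rfl | ⟨hrel, hext⟩⟩ := hk
  · simp
  rcases hrel with ⟨v, hv, rfl⟩ | ⟨a, ha, i, hi, rfl⟩
  · apply Finset.mem_union_left
    obtain ⟨e, rfl⟩ := G.inDeg_pos_iff.1 hv
    by_cases he : e ∈ boundary D
    · exact Finset.mem_union_left _ (Finset.mem_union_right _
        (Finset.mem_image.2 ⟨e, List.mem_toFinset.2 he, rfl⟩))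
    · obtain ⟨hin, hout, -, -, hne1, hne2⟩ := hD.inner he
      have hid := hI e hne1 hne2
      by_cases hX : (π (G.src e) : ℕ) + 1 ∈ exceptional π D G es
      · refine Finset.mem_union_right _ (Finset.mem_image.2 ⟨_, hX, ?_⟩)
        have hex : ∃ f, (π (G.src f) : ℕ) + 1 = π (G.src e) + 1 := ⟨e, rfl⟩
        rw [dif_pos hex]
        have h1 := hex.choose_spec
        rw [G.eq_of_outDeg_eq_one hout (eq_of_rank_eq (Nat.succ_injective h1))]
      · obtain ⟨f, hf, hl, hs⟩ := innerAt_succ W hD hes he hX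
        refine absurd ⟨by omega, Or.inl ⟨G.src e, by omega, by omega⟩, ?_⟩ hext
        rw [hid, Nat.add_sub_cancel, record_ident, ← hid, record_ident]
        exact identRec_extends W hD hI he hf hl.symm hs
  · apply Finset.mem_union_right
    rcases i with - | i
    · refine Finset.mem_union_left _ (Finset.mem_union_left _ (Finset.mem_union_left _
        (Finset.mem_image.2 ⟨a, ?_, rfl⟩)))
      rcases a with - | a
      · simp
      · by_contra hcon
        simp only [Finset.mem_union, not_or, Finset.mem_image, List.mem_toFinset, List.mem_map,
          not_exists, not_and] at hcon
        obtain ⟨⟨-, h1⟩, h2⟩ := hcon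
        -- The keys of consecutive letters are adjacent, so a piece may run across letters that do
        -- not occur.
        have hkey : letterKey n (a + 1) 0 - 1 = letterKey n a n := by
          unfold letterKey
          have : (a + 1 + 1) * (n + 1) = (a + 1) * (n + 1) + (n + 1) := by ring
          omega
        refine hext ⟨by have := lt_letterKey n (a + 1) 0; omega,
          Or.inr ⟨a, by omega, n, le_rfl, hkey.symm⟩, ?_⟩
        rw [hkey, record_letterKey le_rfl, record_letterKey (Nat.zero_le n)]
        refine letterRec_extends_of_not_occurs le_rfl (Nat.zero_le n) (fun e he => ?_)
          fun e he => h1 (G.label e) ⟨e, hes.2.1 e, rfl⟩ he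
        exact h2 (G.label e) ⟨e, hes.2.1 e, rfl⟩ (by rw [he])
    · have hnot : ¬ (G.letterRec π D ident a i).Extends (G.letterRec π D ident a (i + 1)) := by
        intro h
        have hkey : letterKey n a (i + 1) - 1 = letterKey n a i := rfl
        refine hext ⟨by have := lt_letterKey n a (i + 1); omega,
          Or.inr ⟨a, ha, i, by omega, hkey.symm⟩, ?_⟩
        rwa [hkey, record_letterKey (by omega), record_letterKey hi]
      by_cases h1 : G.InnerAt π D a i
      · have h1' := h1
        obtain ⟨e, he, rfl, rfl⟩ := h1
        by_cases hX : (π (G.src e) : ℕ) + 1 ∈ exceptional π D G es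
        · refine Finset.mem_union_left _ (Finset.mem_union_right _
            (Finset.mem_image.2 ⟨_, hX, ?_⟩))
          have hex : ∃ f, (π (G.src f) : ℕ) + 1 = π (G.src e) + 1 := ⟨e, rfl⟩
          rw [dif_pos hex]
          have h2 := hex.choose_spec
          rw [G.eq_of_outDeg_eq_one (hD.inner he).2.1 (eq_of_rank_eq (Nat.succ_injective h2))]
        · exact absurd (letterRec_extends_of_innerAt W hD h1' (innerAt_succ W hD hes he hX)) hnot
      · by_cases h2 : ∃ e, (G.label e : ℕ) = a ∧ (π (G.src e) : ℕ) = i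
        · obtain ⟨e, rfl, rfl⟩ := h2
          have he : e ∈ boundary D := by_contra fun he => h1 ⟨e, he, rfl, rfl⟩
          exact Finset.mem_union_left _ (Finset.mem_union_left _ (Finset.mem_union_right _
            (Finset.mem_image.2 ⟨e, List.mem_toFinset.2 he, rfl⟩)))
        · push Not at h2
          by_cases h3 : G.InnerAt π D a (i + 1)
          · obtain ⟨f, hf, rfl, hs⟩ := h3
            by_cases hX : i + 1 ∈ exceptional π D G es
            · refine Finset.mem_union_right _ (Finset.mem_image.2 ⟨_, hX, ?_⟩)
              have hex : ∃ g, (π (G.src g) : ℕ) = i + 1 := ⟨f, hs⟩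
              rw [dif_pos hex]
              have h4 := hex.choose_spec
              rw [G.eq_of_outDeg_eq_one (hD.inner hf).2.1 (eq_of_rank_eq (h4.trans hs.symm))]
            · exact absurd (innerAt_pred hD hes hf hs hX) h1
          · exact absurd (letterRec_extends_of_forall_ne hi h2 h3) hnot

/-- Three images of exceptional ranks, two of boundary edges and at most two keys per occurring
letter; the largest coefficient, that of `D.length`, is `3 * 8 + 2 * 2 = 28`. -/
theorem card_breakKeys_le [Finite E] (W : G.IsWheelerOrder π) (hD : G.IsPathDecomposition D)
    (hI : G.IsIdentifierAssignment D ident) {B : List (Fin σ)} (hB : G.IsBWT π B) :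
    (G.breakKeys π D ident).card ≤ 28 * (runs B + D.length + 1) := by
  classical
  obtain ⟨es, hnd, hall, hsort, rfl⟩ := hB
  have hes : IsSrcSorted π G es := by
    refine ⟨hnd, hall, hsort.imp fun h => ?_⟩
    rcases h with h | ⟨h, -⟩
    · exact (Fin.lt_def.1 h).le
    · rw [h]
  have hX := card_exceptional_le (D := D) W es
  have hb : (boundary D).toFinset.card ≤ 2 * D.length :=
    (List.toFinset_card_le _).trans (length_boundary_le D)
  have hl := card_toFinset_le_runs (es.map G.label)
  refine (Finset.card_le_card (breakKeys_subset W hD hI hes)).trans ?_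
  refine (Finset.card_union_le _ _).trans ((Nat.add_le_add
    ((Finset.card_union_le _ _).trans (Nat.add_le_add ((Finset.card_union_le _ _).trans
      (Nat.add_le_add (Finset.card_singleton _).le Finset.card_image_le)) Finset.card_image_le))
    ((Finset.card_union_le _ _).trans (Nat.add_le_add ((Finset.card_union_le _ _).trans
      (Nat.add_le_add ((Finset.card_union_le _ _).trans
        (Nat.add_le_add (Finset.card_image_le.trans ((Finset.card_union_le _ _).trans
          (Nat.add_le_add ((Finset.card_union_le _ _).trans (Nat.add_le_add
            (Finset.card_singleton _).le Finset.card_image_le)) Finset.card_image_le)))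
          Finset.card_image_le)) Finset.card_image_le)) Finset.card_image_le))).trans ?_)
  omega

end pieces

end LabelledDigraph

/-! ### Evaluation of expressions without overflow -/

namespace Expr

/-- Entry `e` of table number `t`; the tables are interleaved in memory. -/
def table (t : ℕ) (e : Expr) : Expr := ld (bin .add (bin .mul (lit 32) e) (lit t))

/-- The first entry of table number `t`. -/
def header (t : ℕ) : Expr := ld (lit t)

section eval
variable {w : ℕ} {mem : List ℕ} {f : Fin 20 → ℕ} {a b : Expr} {x y : ℕ}

theorem eval_var (r : Fin 20) (h : f r = x) : (var r).eval w mem f = x := h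

theorem eval_lit (h : x < 2 ^ w) : (lit x).eval w mem f = x := Nat.mod_eq_of_lt h

theorem eval_add (ha : a.eval w mem f = x) (hb : b.eval w mem f = y) (h : x + y < 2 ^ w) :
    (bin .add a b).eval w mem f = x + y := by
  rw [eval, ha, hb]
  exact Nat.mod_eq_of_lt h

theorem eval_mul (ha : a.eval w mem f = x) (hb : b.eval w mem f = y) (h : x * y < 2 ^ w) :
    (bin .mul a b).eval w mem f = x * y := by
  rw [eval, ha, hb]
  exact Nat.mod_eq_of_lt h

theorem eval_sub (ha : a.eval w mem f = x) (hb : b.eval w mem f = y) (h : y ≤ x) (hx : x < 2 ^ w) :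
    (bin .sub a b).eval w mem f = x - y := by
  rw [eval, ha, hb]
  change (x + (2 ^ w - y)) % 2 ^ w = x - y
  rw [show x + (2 ^ w - y) = (x - y) + 2 ^ w by omega, Nat.add_mod_right]
  exact Nat.mod_eq_of_lt (by omega)

theorem eval_sub_of_lt (ha : a.eval w mem f = x) (hb : b.eval w mem f = y) (h : x < y)
    (hy : y < 2 ^ w) : (bin .sub a b).eval w mem f = 2 ^ w - (y - x) := by
  rw [eval, ha, hb]
  change (x + (2 ^ w - y)) % 2 ^ w = _
  rw [Nat.mod_eq_of_lt (by omega)]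
  omega

theorem eval_mod (ha : a.eval w mem f = x) (hb : b.eval w mem f = y) (h : x < 2 ^ w) :
    (bin .mod a b).eval w mem f = x % y := by
  rw [eval, ha, hb]
  exact Nat.mod_eq_of_lt ((Nat.mod_le _ _).trans_lt h)

theorem eval_shr (ha : a.eval w mem f = x) (hb : b.eval w mem f = y) (h : x < 2 ^ w) :
    (bin .shr a b).eval w mem f = x >>> y := by
  rw [eval, ha, hb]
  exact Nat.mod_eq_of_lt ((Nat.shiftRight_le _ _).trans_lt h)

theorem eval_lt_op (ha : a.eval w mem f = x) (hb : b.eval w mem f = y) (h : 1 < 2 ^ w) :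
    (bin .lt a b).eval w mem f = if x < y then 1 else 0 := by
  rw [eval, ha, hb]
  exact Nat.mod_eq_of_lt (by simp only [BinOp.eval]; split_ifs <;> omega)

theorem eval_eq_op (ha : a.eval w mem f = x) (hb : b.eval w mem f = y) (h : 1 < 2 ^ w) :
    (bin .eq a b).eval w mem f = if x = y then 1 else 0 := by
  rw [eval, ha, hb]
  exact Nat.mod_eq_of_lt (by simp only [BinOp.eval]; split_ifs <;> omega)

end eval
end Expr

/-- The memory consists of 32 interleaved tables. -/
structure Stores (w : ℕ) (mem : List ℕ) (tab : ℕ → ℕ → ℕ) : Prop where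
  getD_eq : ∀ t < 32, ∀ i, mem.getD (32 * i + t) 0 = tab t i
  tab_lt : ∀ t i, tab t i < 2 ^ w

namespace Stores
variable {w : ℕ} {mem : List ℕ} {tab : ℕ → ℕ → ℕ} {f : Fin 20 → ℕ}

theorem eval_table (h : Stores w mem tab) {t i : ℕ} {e : Expr}
    (he : e.eval w mem f = i) (ht : t < 32)
    (hi : 32 * i + 64 ≤ 2 ^ w) : (Expr.table t e).eval w mem f = tab t i := by
  have h1 : (Expr.bin .add (.bin .mul (.lit 32) e) (.lit t)).eval w mem f = 32 * i + t :=
    Expr.eval_add (Expr.eval_mul (Expr.eval_lit (by omega)) he (by omega))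
      (Expr.eval_lit (by omega)) (by omega)
  rw [Expr.table, Expr.eval, h1, h.getD_eq t ht]
  exact Nat.mod_eq_of_lt (h.tab_lt t i)

theorem eval_header (h : Stores w mem tab) {t : ℕ} (ht : t < 32) (hw : 32 ≤ 2 ^ w) :
    (Expr.header t).eval w mem f = tab t 0 := by
  rw [Expr.header, Expr.eval, Expr.eval_lit (by omega)]
  have := h.getD_eq t ht 0
  rw [mul_zero, zero_add] at this
  rw [this]
  exact Nat.mod_eq_of_lt (h.tab_lt t 0)

end Stores

/-! ### The program for predecessor search -/

namespace Expr

/-- The address of the node `u` in the perfect hash table. -/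
def cell (u : Expr) : Expr :=
  bin .add (table 10 (bin .mod (bin .mod (bin .mul (header 1) u) (header 0)) (header 2)))
    (bin .mod (bin .mod
      (bin .mul (table 8 (bin .mod (bin .mod (bin .mul (header 1) u) (header 0)) (header 2))) u)
      (header 0)) (table 9 (bin .mod (bin .mod (bin .mul (header 1) u) (header 0)) (header 2))))

end Expr

open WheelerIndex.Expr in
/-- One step of the search for the depth of the deepest stored node above the query. -/
def depthStep : List (Fin 20 × Expr) :=
  [(6, bin .shr (var 2) (bin .sub (header 3) (bin .add (var 3) (var 4)))),
    (7, bin .eq (table 11 (cell (var 6))) (var 6)),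
    (3, bin .add (var 3) (bin .mul (var 4) (var 7))),
    (4, bin .shr (var 4) (lit 1))]

open WheelerIndex.Expr in
/-- One step of the search in a block of keys. -/
def keyStep : List (Fin 20 × Expr) :=
  [(7, bin .eq (bin .lt (var 1) (bin .sub (table 13 (bin .add (var 5) (var 4))) (lit 1))) (lit 0)),
    (5, bin .add (var 5) (bin .mul (var 4) (var 7))),
    (4, bin .shr (var 4) (lit 1))]

open WheelerIndex.Expr in
/-- Initialization of the search for the depth. -/
def depthInit : List (Fin 20 × Expr) :=
  [(2, bin .add (var 1) (header 4)), (3, lit 0), (4, header 5)]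

open WheelerIndex.Expr in
/-- Initialization of the search in a block of keys. -/
def keyInit : List (Fin 20 × Expr) :=
  [(6, bin .shr (var 2) (bin .sub (header 3) (var 3))), (5, table 12 (cell (var 6))), (4, header 5)]

/-- Put the position of the predecessor of register 1 into register 5. -/
def lookup : Prog :=
  .seq (block depthInit) (.seq (.loop 4 (block depthStep))
    (.seq (block keyInit) (.loop 4 (block keyStep))))

/-- The running time of `lookup`. -/
def lookupCost (T : ℕ) : ℕ :=
  blockCost depthInit + ((T * (blockCost depthStep + 1) + 1) +
    (blockCost keyInit + (T * (blockCost keyStep + 1) + 1)))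

/-- The tables contain what `lookup` needs. -/
structure HasSearch {S : Finset ℕ} {l T : ℕ} (X : SearchTables S l T) (tab : ℕ → ℕ → ℕ) : Prop where
  p : tab 0 0 = X.p
  A : tab 1 0 = X.A
  N : tab 2 0 = X.N
  height : tab 3 0 = l
  top : tab 4 0 = 2 ^ l
  half : tab 5 0 = 2 ^ T / 2
  a : ∀ b < X.N, tab 8 b = X.a b
  m : ∀ b < X.N, tab 9 b = X.m b
  off : ∀ b < X.N, tab 10 b = X.off b
  code : ∀ c < 5 * S.card, tab 11 c = X.cellCode c
  ans : ∀ c < 5 * S.card, tab 12 c = X.cellAns c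
  -- The shift by 1 frees 0 as a mark for positions past the end; subtracting 1 there wraps around
  -- to the largest word.
  key : ∀ j < S.card, tab 13 j = key S j + 1
  key_of_le : ∀ j, S.card ≤ j → tab 13 j = 0

/-- The variables other than those that `lookup` changes have the same values. -/
def Frame (f f' : Fin 20 → ℕ) : Prop := ∀ r : Fin 20, (r : ℕ) < 2 ∨ 7 < (r : ℕ) → f' r = f r

theorem Frame.refl (f : Fin 20 → ℕ) : Frame f f := fun _ _ => rfl

theorem Frame.update {f f' : Fin 20 → ℕ} (h : Frame f f') {d : Fin 20}
    (hd : 2 ≤ (d : ℕ) ∧ (d : ℕ) ≤ 7)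
    (v : ℕ) : Frame f (Function.update f' d v) := by
  intro r hr
  rw [Function.update_of_ne (by rintro rfl; omega)]
  exact h r hr

/-! ### Correctness of predecessor search -/

section lookup
variable {w : ℕ} {mem : List ℕ} {tab : ℕ → ℕ → ℕ} {S : Finset ℕ} {l T : ℕ}
  {X : SearchTables S l T} {f : Fin 20 → ℕ} {inp : List ℕ}

/-- The address of the node `u` in the perfect hash table. -/
def SearchTables.cell (X : SearchTables S l T) (u : ℕ) : ℕ :=
  X.off (X.A * u % X.p % X.N) +
    X.a (X.A * u % X.p % X.N) * u % X.p % X.m (X.A * u % X.p % X.N)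

theorem SearchTables.cell_lt (X : SearchTables S l T) (u : ℕ) : X.cell u < 5 * S.card := by
  have h1 := X.off_le _ (Nat.mod_lt (X.A * u % X.p) X.N_pos)
  have h2 := Nat.mod_lt (X.a (X.A * u % X.p % X.N) * u % X.p) (X.m_pos (X.A * u % X.p % X.N))
  unfold SearchTables.cell
  omega

/-- The largest intermediate values are products of a multiplier below `4 * 2 ^ l` and a node below
`2 * 2 ^ l`; `hw` leaves room for them. -/
theorem eval_cell (hmem : Stores w mem tab) (hX : HasSearch X tab) (hc : S.card ≤ 2 ^ l)
    (hw : 4096 * 2 ^ l * 2 ^ l ≤ 2 ^ w) {u : Expr} {x : ℕ} (hu : u.eval w mem f = x)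
    (hx : x < 2 ^ (l + 1)) : (Expr.cell u).eval w mem f = X.cell x := by
  have hpos := Nat.two_pow_pos l
  have hw1 : 4096 * 2 ^ l ≤ 2 ^ w := (Nat.le_mul_of_pos_right _ hpos).trans hw
  have hp := X.p_lt
  rw [pow_succ] at hx
  rw [show l + 2 = l + 1 + 1 from rfl, pow_succ, pow_succ] at hp
  have hmul : ∀ a, a < X.p → a * x < 2 ^ w := by
    intro a ha
    have h1 : a * x ≤ (4 * 2 ^ l) * (2 * 2 ^ l) := Nat.mul_le_mul (by omega) (by omega)
    have h2 : (4 * 2 ^ l) * (2 * 2 ^ l) < 4096 * 2 ^ l * 2 ^ l := by nlinarith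
    omega
  have hN := X.N_le
  have hh : ∀ t < 32, (Expr.header t).eval w mem f = tab t 0 := fun t ht =>
    hmem.eval_header ht (by omega)
  have hb : (Expr.bin .mod (.bin .mod (.bin .mul (.header 1) u) (.header 0)) (.header 2)).eval w mem f
      = X.A * x % X.p % X.N := by
    have h1 := hmul _ X.A_lt
    refine Expr.eval_mod (Expr.eval_mod (Expr.eval_mul ?_ hu h1) ?_ h1) ?_
      ((Nat.mod_le _ _).trans_lt h1)
    · rw [hh 1 (by omega), hX.A]
    · rw [hh 0 (by omega), hX.p]
    · rw [hh 2 (by omega), hX.N]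
  have hbN : X.A * x % X.p % X.N < X.N := Nat.mod_lt _ X.N_pos
  have ht : ∀ t < 32, (Expr.table t (.bin .mod (.bin .mod (.bin .mul (.header 1) u) (.header 0))
      (.header 2))).eval w mem f = tab t (X.A * x % X.p % X.N) := fun t ht =>
    hmem.eval_table hb ht (by omega)
  have ha := hmul _ (X.a_lt (X.A * x % X.p % X.N))
  have hcell := X.cell_lt x
  refine Expr.eval_add ?_ (Expr.eval_mod (Expr.eval_mod (Expr.eval_mul ?_ hu ha) ?_ ha) ?_
    ((Nat.mod_le _ _).trans_lt ha)) ?_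
  · rw [ht 10 (by omega), hX.off _ hbN]
  · rw [ht 8 (by omega), hX.a _ hbN]
  · rw [hh 0 (by omega), hX.p]
  · rw [ht 9 (by omega), hX.m _ hbN]
  · change X.cell x < 2 ^ w
    omega

theorem SearchTables.cellAns_node (X : SearchTables S l T) {d x : ℕ} (hd : d ≤ l) (hx : x < 2 ^ l)
    (h : X.cellCode (X.cell (node l d x)) = node l d x)
    (h' : d < l → X.cellCode (X.cell (node l (d + 1) x)) ≠ node l (d + 1) x) :
    X.cellAns (X.cell (node l d x)) = keyIdx S x / 2 ^ T * 2 ^ T :=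
  X.cellAns_eq d x _ _ hd hx rfl rfl h fun hdl _ _ hu hc => by
    subst hu
    subst hc
    exact h' hdl

theorem runs_lookup (hmem : Stores w mem tab) (hX : HasSearch X tab) (hc : S.card ≤ 2 ^ l)
    (h0 : 0 ∈ S) (hS : ∀ s ∈ S, s < 2 ^ l) (hl : l + 1 = 2 ^ T)
    (hw : 4096 * 2 ^ l * 2 ^ l ≤ 2 ^ w) (hx : f 1 < 2 ^ l) :
    Runs w mem lookup (lookupCost T) f inp
      (fun f' i' => i' = inp ∧ f' 5 = keyIdx S (f 1) ∧ Frame f f') := by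
  have hpos := Nat.two_pow_pos l
  have hw1 : 4096 * 2 ^ l ≤ 2 ^ w := (Nat.le_mul_of_pos_right _ hpos).trans hw
  have hll : l < 2 ^ l := Nat.lt_two_pow_self
  have hh : ∀ {f : Fin 20 → ℕ} {t : ℕ}, t < 32 → (Expr.header t).eval w mem f = tab t 0 := fun ht =>
    hmem.eval_header ht (by omega)
  obtain ⟨x, hfx⟩ : ∃ x, f 1 = x := ⟨_, rfl⟩
  rw [hfx] at hx ⊢
  have hshr : ∀ k, 2 ^ k >>> 1 = 2 ^ k / 2 := fun k => Nat.shiftRight_eq_div_pow _ 1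
  have hhalf : ∀ k, 2 ^ (k + 1) / 2 = 2 ^ k := fun k => by rw [pow_succ]; omega
  refine Runs.seq (Q := fun f' i' => i' = inp ∧ f' 1 = x ∧ f' 2 = x + 2 ^ l ∧ f' 3 = 0 ∧
    f' 4 = 2 ^ T / 2 ∧ Frame f f') ?_ ?_
  · refine runs_block_cons (Expr.eval_add (Expr.eval_var 1 hfx) (hh (by omega)) ?_) fun _ => ?_
    · rw [hX.top]; omega
    refine runs_block_cons (Expr.eval_lit (by omega)) fun _ => ?_
    refine runs_block_cons (hh (by omega)) fun _ => ?_
    refine runs_block_nil ?_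
    refine ⟨rfl, by simpa [Function.update] using hfx, by simp [Function.update, hX.top],
      by simp [Function.update], by simp [Function.update, hX.half], ?_⟩
    exact (((Frame.refl f).update (by decide) _).update (by decide) _).update (by decide) _
  rintro f1 i1 - ⟨rfl, h11, h12, h13, h14, hF1⟩
  refine Runs.seq (Q := fun f' i' => i' = i1 ∧ f' 1 = x ∧ f' 2 = x + 2 ^ l ∧ f' 3 ≤ l ∧
    X.cellCode (X.cell (node l (f' 3) x)) = node l (f' 3) x ∧
    (f' 3 < l → X.cellCode (X.cell (node l (f' 3 + 1) x)) ≠ node l (f' 3 + 1) x) ∧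
    Frame f f') ?_ ?_
  -- Binary search with `k` rounds to go: the node at depth `f' 3` is stored, the one `2 ^ k` deeper
  -- is not or lies below the leaves. The step width `2 ^ k / 2` becomes 0 exactly when `k = 0`.
  · refine (runs_loop (a := 4) (fun k f' i' => i' = i1 ∧ f' 1 = x ∧ f' 2 = x + 2 ^ l ∧
      f' 4 = 2 ^ k / 2 ∧ f' 3 + 2 ^ k ≤ 2 ^ T ∧
      X.cellCode (X.cell (node l (f' 3) x)) = node l (f' 3) x ∧
      (f' 3 + 2 ^ k ≤ l →
        X.cellCode (X.cell (node l (f' 3 + 2 ^ k) x)) ≠ node l (f' 3 + 2 ^ k) x) ∧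
      Frame f f') ?_ ?_ ?_ T f1 i1 ?_).mono le_rfl ?_
    · rintro f' i' ⟨-, -, -, h, -⟩
      simpa using h
    · rintro k f' i' ⟨-, -, -, h, -⟩
      rw [hhalf] at h
      have := Nat.two_pow_pos k
      change f' 4 ≠ 0
      omega
    · rintro k f' i' - ⟨rfl, g1, g2, g4, g3, gcode, gnot, gF⟩
      rw [hhalf] at g4
      have hk := Nat.two_pow_pos k
      rw [pow_succ] at g3 gnot
      obtain ⟨lo, hlo⟩ : ∃ lo, f' 3 = lo := ⟨_, rfl⟩
      rw [hlo] at g3 gcode gnot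
      set u := node l (lo + 2 ^ k) x with hu
      have hult : u < 2 ^ (l + 1) :=
        (node_lt hx (by omega)).trans_le (Nat.pow_le_pow_right (by omega) (by omega))
      have hult' : u < 2 * 2 ^ l := by rw [pow_succ] at hult; omega
      have hcell := X.cell_lt u
      refine runs_block_cons (v := u) ?_ fun _ => ?_
      · refine Expr.eval_shr (Expr.eval_var 2 g2) (Expr.eval_sub (hh (by omega))
          (Expr.eval_add (Expr.eval_var 3 hlo) (Expr.eval_var 4 g4) (by omega)) ?_ ?_)
          (by omega) |>.trans ?_
        · rw [hX.height]; omega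
        · rw [hX.height]; omega
        · rw [hX.height, hu, node]
      refine runs_block_cons (Expr.eval_eq_op (hmem.eval_table (eval_cell hmem hX hc hw
        (Expr.eval_var (x := u) 6 (by simp)) hult) (by omega) (by omega))
        (Expr.eval_var (x := u) 6 (by simp))
        (by omega)) fun _ => ?_
      rw [hX.code _ hcell]
      set flag := if X.cellCode (X.cell u) = u then 1 else 0 with hflag
      have hflag1 : flag ≤ 1 := by rw [hflag]; split_ifs <;> omega
      have hmf : 2 ^ k * flag ≤ 2 ^ k := (Nat.mul_le_mul_left _ hflag1).trans (by omega)
      refine runs_block_cons (Expr.eval_add (x := lo) (Expr.eval_var 3 ?_)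
        (Expr.eval_mul (x := 2 ^ k) (y := flag) (Expr.eval_var 4 ?_) (Expr.eval_var 7 ?_) (by omega))
        (by omega)) fun _ => ?_
      · simpa [Function.update] using hlo
      · simpa [Function.update] using g4
      · simp [Function.update]
      refine runs_block_cons (Expr.eval_shr (x := 2 ^ k) (y := 1) (Expr.eval_var 4 ?_)
        (Expr.eval_lit (by omega)) (by omega)) fun _ => ?_
      · simpa [Function.update] using g4
      refine runs_block_nil ⟨rfl, by simpa [Function.update] using g1,
        by simpa [Function.update] using g2, by simpa [Function.update] using hshr k, ?_⟩
      have h3 : ∀ v v' v'', Function.update (Function.update (Function.update (Function.update f' 6 v)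
          7 v') 3 (lo + 2 ^ k * flag)) 4 v'' 3 = lo + 2 ^ k * flag := by
        intro v v' v''
        simp [Function.update]
      rw [h3]
      refine ⟨by omega, ?_, ?_, ((((gF.update (by decide) _).update (by decide) _).update
        (by decide) _).update (by decide) _)⟩
      · by_cases hg : X.cellCode (X.cell u) = u
        · rw [hflag, if_pos hg, mul_one]
          exact hg
        · rw [hflag, if_neg hg, mul_zero, add_zero]
          exact gcode
      · by_cases hg : X.cellCode (X.cell u) = u
        · rw [hflag, if_pos hg, mul_one]
          intro h
          rw [show lo + 2 ^ k + 2 ^ k = lo + 2 ^ k * 2 by ring] at h ⊢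
          exact gnot h
        · rw [hflag, if_neg hg, mul_zero, add_zero]
          exact fun _ => hg
    · refine ⟨rfl, h11, h12, h14, by omega, ?_, ?_, hF1⟩
      · rw [h13, node_zero hx]
        exact X.root
      · intro h
        omega
    · rintro f' i' - ⟨g0, g1, g2, g4, g3, gcode, gnot, gF⟩
      rw [pow_zero] at g3 gnot
      exact ⟨g0, g1, g2, by omega, gcode, gnot, gF⟩
  rintro f2 i2 - ⟨rfl, h21, h22, h23, hcode, hnot, hF2⟩
  refine Runs.seq (Q := fun f' i' => i' = i2 ∧ f' 1 = x ∧ f' 5 = keyIdx S x / 2 ^ T * 2 ^ T ∧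
    f' 4 = 2 ^ T / 2 ∧ Frame f f') ?_ ?_
  · obtain ⟨d, hd⟩ : ∃ d, f2 3 = d := ⟨_, rfl⟩
    rw [hd] at h23 hcode hnot
    set u := node l d x with hu
    have hult : u < 2 ^ (l + 1) :=
        (node_lt hx (by omega)).trans_le (Nat.pow_le_pow_right (by omega) (by omega))
    have hcell := X.cell_lt u
    refine runs_block_cons (v := u) ?_ fun _ => ?_
    · refine Expr.eval_shr (Expr.eval_var 2 h22) (Expr.eval_sub (hh (by omega))
          (Expr.eval_var 3 hd) ?_ ?_) (by omega) |>.trans ?_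
      · rw [hX.height]; omega
      · rw [hX.height]; omega
      · rw [hX.height, hu, node]
    refine runs_block_cons (hmem.eval_table (eval_cell hmem hX hc hw
        (Expr.eval_var (x := u) 6 (by simp)) hult) (by omega) (by omega)) fun _ => ?_
    refine runs_block_cons (hh (by omega)) fun _ => ?_
    rw [hX.ans _ hcell, hX.half, X.cellAns_node h23 hx hcode hnot]
    refine runs_block_nil ⟨rfl, by simpa [Function.update] using h21,
      by simp [Function.update], by simp [Function.update], ?_⟩
    exact ((hF2.update (by decide) _).update (by decide) _).update (by decide) _
  rintro f3 i3 - ⟨rfl, h31, h35, h34, hF3⟩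
  have hK := keyIdx_lt h0 x
  refine (runs_loop (a := 4) (fun k f' i' => i' = i3 ∧ f' 1 = x ∧ f' 4 = 2 ^ k / 2 ∧
      2 ^ k ≤ 2 ^ T ∧ f' 5 ≤ keyIdx S x ∧ keyIdx S x < f' 5 + 2 ^ k ∧ Frame f f') ?_ ?_ ?_ T f3 i3 ?_).mono
      le_rfl ?_
  · rintro f' i' ⟨-, -, h, -⟩
    simpa using h
  · rintro k f' i' ⟨-, -, h, -⟩
    rw [hhalf] at h
    have := Nat.two_pow_pos k
    change f' 4 ≠ 0
    omega
  · rintro k f' i' - ⟨rfl, g1, g4, gT, g5, g5', gF⟩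
    rw [hhalf] at g4
    rw [pow_succ] at gT g5'
    have hk := Nat.two_pow_pos k
    obtain ⟨j, hj⟩ : ∃ j, f' 5 = j := ⟨_, rfl⟩
    rw [hj] at g5 g5'
    have htab := hmem.eval_table (Expr.eval_add (Expr.eval_var 5 hj) (Expr.eval_var 4 g4)
        (by omega)) (t := 13) (by omega) (by omega)
    refine runs_block_cons (v := if j + 2 ^ k ≤ keyIdx S x then 1 else 0) ?_ fun _ => ?_
    · by_cases hjc : j + 2 ^ k < S.card
      · rw [hX.key _ hjc] at htab
        have hkey := hS _ (key_mem hjc)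
        refine (Expr.eval_eq_op (Expr.eval_lt_op (Expr.eval_var 1 g1)
          (Expr.eval_sub htab (Expr.eval_lit (by omega)) (by omega) (by omega)) (by omega))
          (Expr.eval_lit (by omega)) (by omega)).trans ?_
        have := key_le_iff h0 hjc x
        rw [Nat.add_sub_cancel]
        by_cases hle : key S (j + 2 ^ k) ≤ x
        · rw [if_neg (show ¬ x < key S (j + 2 ^ k) by omega), if_pos rfl, if_pos (this.1 hle)]
        · rw [if_pos (show x < key S (j + 2 ^ k) by omega), if_neg one_ne_zero,
            if_neg (fun h => hle (this.2 h))]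
      -- Past the end the comparison is with the word `2 ^ w - 1`, which exceeds every query.
      · rw [hX.key_of_le _ (by omega)] at htab
        refine (Expr.eval_eq_op (Expr.eval_lt_op (Expr.eval_var 1 g1)
          (Expr.eval_sub_of_lt htab (Expr.eval_lit (by omega)) (by omega) (by omega)) (by omega))
          (Expr.eval_lit (by omega)) (by omega)).trans ?_
        rw [if_pos (show x < 2 ^ w - (1 - 0) by omega), if_neg one_ne_zero, if_neg (by omega)]
    set flag := if j + 2 ^ k ≤ keyIdx S x then 1 else 0 with hflag
    have hflag1 : flag ≤ 1 := by rw [hflag]; split_ifs <;> omega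
    have hmf : 2 ^ k * flag ≤ 2 ^ k := (Nat.mul_le_mul_left _ hflag1).trans (by omega)
    refine runs_block_cons (Expr.eval_add (x := j) (Expr.eval_var 5 ?_)
      (Expr.eval_mul (x := 2 ^ k) (y := flag) (Expr.eval_var 4 ?_) (Expr.eval_var 7 ?_) (by omega))
      (by omega)) fun _ => ?_
    · simpa [Function.update] using hj
    · simpa [Function.update] using g4
    · simp [Function.update]
    refine runs_block_cons (Expr.eval_shr (x := 2 ^ k) (y := 1) (Expr.eval_var 4 ?_)
      (Expr.eval_lit (by omega)) (by omega)) fun _ => ?_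
    · simpa [Function.update] using g4
    refine runs_block_nil ⟨rfl, by simpa [Function.update] using g1,
        by simpa [Function.update] using hshr k, by omega, ?_⟩
    have h5 : ∀ v v', Function.update (Function.update (Function.update f' 7 v)
          5 (j + 2 ^ k * flag)) 4 v' 5 = j + 2 ^ k * flag := by
      intro v v'
      simp [Function.update]
    rw [h5]
    refine ⟨?_, ?_, (((gF.update (by decide) _).update (by decide) _).update (by decide) _)⟩
    · by_cases hle : j + 2 ^ k ≤ keyIdx S x
      · rw [hflag, if_pos hle, mul_one]
        exact hle
      · rw [hflag, if_neg hle]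
        omega
    · by_cases hle : j + 2 ^ k ≤ keyIdx S x
      · rw [hflag, if_pos hle]
        omega
      · rw [hflag, if_neg hle]
        omega
  · have hdm := Nat.div_add_mod (keyIdx S x) (2 ^ T)
    have hml := Nat.mod_lt (keyIdx S x) (Nat.two_pow_pos T)
    rw [mul_comm] at hdm
    exact ⟨rfl, h31, h34, le_rfl, by omega, by omega, hF3⟩
  · rintro f' i' - ⟨g0, g1, g4, -, g5, g5', gF⟩
    rw [pow_zero] at g5'
    exact ⟨g0, by omega, gF⟩

end lookup

/-! ### The query programs -/

namespace Expr

/-- The product of the slope of the piece number `i` and the distance of `k` from its first key. -/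
def offset (i k : Expr) : Expr :=
  bin .mul (table 18 i) (bin .sub k (bin .sub (table 13 i) (lit 1)))

/-- The key for the letter in register 12 and the rank in register `r`. -/
def keyOf (r : Fin 20) : Expr :=
  bin .add (bin .mul (bin .add (var 12) (lit 1)) (bin .add (header 6) (lit 1))) (var r)

end Expr

open WheelerIndex.Expr in
/-- Keep the result of the first lookup, and compute the key for the second. -/
def stepMiddle : List (Fin 20 × Expr) :=
  [(14, var 5), (16, offset (var 14) (var 1)), (1, keyOf 9)]

open WheelerIndex.Expr in
/-- Combine the results of the two lookups. -/
def stepEnd : List (Fin 20 × Expr) :=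
  [(17, offset (var 5) (var 1)),
    (15, bin .lt (bin .add (table 14 (var 14)) (var 16)) (var 9)),
    -- Register 15 tells whether an edge with this letter leaves the interval; multiplying by it
    -- resets the results to 0 otherwise, without a branch.
    (10, bin .mul (var 15) (bin .add
      (bin .mul (table 18 (var 14)) (bin .add (var 10) (lit 1))) (table 17 (var 14)))),
    (8, bin .mul (var 15) (bin .add (table 15 (var 14)) (var 16))),
    (9, bin .mul (var 15) (bin .add (table 16 (var 5)) (var 17))),
    (11, lit 1)]

/-- Update the interval of ranks (registers 8 and 9) and the identifier of its first vertex
(register 10) for the letter in register 12. -/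
def step : Prog :=
  .seq (block [(1, Expr.keyOf 8)]) (.seq lookup (.seq (block stepMiddle)
    (.seq lookup (block stepEnd))))

/-- The running time of `step`. -/
def stepCost (T : ℕ) : ℕ :=
  blockCost [(1, Expr.keyOf 8)] + (lookupCost T + (blockCost stepMiddle +
    (lookupCost T + blockCost stepEnd)))

open WheelerIndex.Expr in
/-- The initial interval. -/
def countInit : List (Fin 20 × Expr) := [(9, header 6), (10, header 7)]

open WheelerIndex.Expr in
/-- The length of the interval, and the first identifier that is to be reported. -/
def countEnd : List (Fin 20 × Expr) :=
  -- Register 11 is 0 only for the empty pattern, for which the identifiers are enumerated from 0.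
  [(0, bin .sub (var 9) (var 8)), (10, bin .mul (var 10) (var 11))]

/-- The program that counts the vertices that are reached. -/
def count : Prog :=
  .seq (block countInit) (.seq (.read 12 13)
    (.seq (.loop 13 (.seq step (.read 12 13))) (block countEnd)))

/-- The running time of `count` for a pattern of length `m`. -/
def countCost (T m : ℕ) : ℕ :=
  blockCost countInit + (1 + ((m * (stepCost T + 1 + 1) + 1) + blockCost countEnd))

open WheelerIndex.Expr in
/-- Report the current identifier. -/
def nextInit : List (Fin 20 × Expr) := [(0, var 10), (1, var 10)]

open WheelerIndex.Expr in
/-- The next identifier by the index. -/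
def nextIdent : List (Fin 20 × Expr) :=
  [(10, bin .add (table 15 (var 5)) (offset (var 5) (var 1)))]

open WheelerIndex.Expr in
/-- The next identifier when all vertices are reported. -/
def nextNumber : List (Fin 20 × Expr) := [(10, bin .add (var 10) (lit 1))]

/-- The program that reports the next vertex. -/
def next : Prog :=
  .seq (block nextInit) (.cond 11 (.seq lookup (block nextIdent)) (block nextNumber))

/-- The running time of `next`. -/
def nextCost (T : ℕ) : ℕ :=
  blockCost nextInit + (lookupCost T + blockCost nextIdent + blockCost nextNumber + 1)

namespace LabelledDigraph

/-! ### Correctness of counting and reporting -/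

section queries
variable {V E : Type} {σ n : ℕ} {G : LabelledDigraph V E (Fin σ)} {π : V ≃ Fin n}
  {D : List (List E)} {ident : V ≃ Fin n} {w : ℕ} {mem : List ℕ} {l T : ℕ}

/-- The memory `mem` is an index for `G`. -/
structure Index (G : LabelledDigraph V E (Fin σ)) (π : V ≃ Fin n) (D : List (List E))
    (ident : V ≃ Fin n) (w : ℕ) (mem : List ℕ) (l T : ℕ) where
  tab : ℕ → ℕ → ℕ
  tables : SearchTables (G.breakKeys π D ident) l T
  stores : Stores w mem tab
  search : HasSearch tables tab
  card_eq : tab 6 0 = n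
  first_eq : tab 7 0 = identAt π ident 0
  rec_eq : ∀ j < (G.breakKeys π D ident).card,
    G.record π D ident (key (G.breakKeys π D ident) j) =
      ⟨tab 14 j, tab 15 j, tab 16 j, tab 17 j, tab 18 j⟩
  height_eq : l + 1 = 2 ^ T
  word : 4096 * 2 ^ l * 2 ^ l ≤ 2 ^ w
  universe_le : (σ + 1) * (n + 1) ≤ 2 ^ l

namespace Index

theorem breakKeys_lt (I : Index G π D ident w mem l T) : ∀ s ∈ G.breakKeys π D ident, s < 2 ^ l :=
  fun _ hs => (LabelledDigraph.breakKeys_lt hs).trans_le I.universe_le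

theorem card_le (I : Index G π D ident w mem l T) : (G.breakKeys π D ident).card ≤ 2 ^ l := by
  have h : G.breakKeys π D ident ⊆ Finset.range (2 ^ l) := fun s hs =>
    Finset.mem_range.2 (I.breakKeys_lt s hs)
  simpa using Finset.card_le_card h

theorem n_lt (I : Index G π D ident w mem l T) : n + 1 ≤ 2 ^ l :=
  (Nat.le_mul_of_pos_left _ (Nat.succ_pos σ)).trans I.universe_le

theorem word' (I : Index G π D ident w mem l T) : 4096 * 2 ^ l ≤ 2 ^ w :=
  (Nat.le_mul_of_pos_right _ (Nat.two_pow_pos l)).trans I.word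

/-- The difference between the data for the key `k` and those for the beginning of its piece, which
has the number `j`. -/
def diff (I : Index G π D ident w mem l T) (j k : ℕ) : ℕ := I.tab 18 j * (k - (I.tab 13 j - 1))

/-- The key `k` lies on the piece number `j`. -/
structure At (I : Index G π D ident w mem l T) (j k : ℕ) : Prop where
  lt_card : j < (G.breakKeys π D ident).card
  key_pos : 1 ≤ I.tab 13 j
  key_le : I.tab 13 j - 1 ≤ k
  src_eq : (G.record π D ident k).src = I.tab 14 j + I.diff j k
  low_eq : (G.record π D ident k).low = I.tab 15 j + I.diff j k
  high_eq : (G.record π D ident k).high = I.tab 16 j + I.diff j k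
  ident_eq : (G.record π D ident k).ident = I.tab 17 j
  slope_eq : (G.record π D ident k).slope = I.tab 18 j

theorem at_keyIdx (I : Index G π D ident w mem l T) {k : ℕ} (hk : G.Relevant ident k) :
    I.At (keyIdx (G.breakKeys π D ident) k) k := by
  have h0 := zero_mem_breakKeys (G := G) (π := π) (D := D) (ident := ident)
  have hj := keyIdx_lt h0 k
  have hkey := I.search.key _ hj
  have hle := key_keyIdx_le h0 k
  obtain ⟨h1, h2, h3, h4, h5⟩ := record_eq (π := π) (D := D) hk hle
    (fun s hs hsk => le_key_keyIdx h0 hs hsk)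
  rw [I.rec_eq _ hj] at h1 h2 h3 h4 h5
  constructor
  · exact hj
  · omega
  · omega
  · simpa only [diff, hkey, Nat.add_sub_cancel] using h2
  · simpa only [diff, hkey, Nat.add_sub_cancel] using h3
  · simpa only [diff, hkey, Nat.add_sub_cancel] using h4
  · exact h5
  · exact h1

variable {f : Fin 20 → ℕ} {inp : List ℕ}

theorem runs_lookup (I : Index G π D ident w mem l T) {k : ℕ} (hk : G.Relevant ident k)
    (hf : f 1 = k) :
    Runs w mem lookup (lookupCost T) f inp
      (fun f' i' => i' = inp ∧ I.At (f' 5) k ∧ Frame f f') := by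
  subst hf
  refine (WheelerIndex.runs_lookup I.stores I.search I.card_le zero_mem_breakKeys I.breakKeys_lt
    I.height_eq I.word (hk.lt.trans_le I.universe_le)).mono le_rfl ?_
  rintro f' i' - ⟨h1, h2, h3⟩
  exact ⟨h1, h2 ▸ I.at_keyIdx hk, h3⟩

theorem eval_table (I : Index G π D ident w mem l T) {j t : ℕ} (ht : t < 32) {e : Expr}
    (he : e.eval w mem f = j) (hj : j < (G.breakKeys π D ident).card) :
    (Expr.table t e).eval w mem f = I.tab t j := by
  have h1 := I.card_le
  have h2 := I.word'
  exact I.stores.eval_table he ht (by omega)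

theorem At.diff_le {I : Index G π D ident w mem l T} {j k : ℕ} (h : I.At j k) : I.diff j k ≤ n := by
  have h1 := (record_le (G := G) (π := π) (D := D) (ident := ident) k).1
  rw [h.src_eq] at h1
  omega

theorem eval_offset (I : Index G π D ident w mem l T) {j k : ℕ} {e e' : Expr} (h : I.At j k)
    (hk : k < 2 ^ l) (he : e.eval w mem f = j) (he' : e'.eval w mem f = k) :
    (Expr.offset e e').eval w mem f = I.diff j k := by
  have h2 := I.word'
  have h3 := I.n_lt
  have h4 := h.diff_le
  have h5 := h.key_le
  exact Expr.eval_mul (I.eval_table (by omega) he h.lt_card)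
    (Expr.eval_sub he' (Expr.eval_sub (I.eval_table (by omega) he h.lt_card)
      (Expr.eval_lit (by omega)) h.key_pos (I.stores.tab_lt _ _)) h5 (by omega))
    (show I.diff j k < 2 ^ w by omega)

theorem eval_keyOf (I : Index G π D ident w mem l T) {a i : ℕ} {r : Fin 20} (ha : a < σ)
    (hi : i ≤ n) (h12 : f 12 = a) (hr : f r = i) :
    (Expr.keyOf r).eval w mem f = letterKey n a i := by
  have h1 := letterKey_lt ha hi
  have h2 := I.universe_le
  have h3 := I.word'
  have h4 : (a + 1) * (n + 1) ≤ letterKey n a i := Nat.le_add_right _ _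
  have h5 : a + 1 ≤ (a + 1) * (n + 1) := Nat.le_mul_of_pos_right _ (by omega)
  have h6 := I.n_lt
  have h7 : (Expr.header 6).eval w mem f = n :=
    (I.stores.eval_header (by omega) (by omega)).trans I.card_eq
  exact Expr.eval_add (Expr.eval_mul (Expr.eval_add (Expr.eval_var 12 h12)
    (Expr.eval_lit (by omega)) (by omega)) (Expr.eval_add h7 (Expr.eval_lit (by omega)) (by omega))
    (by omega)) (Expr.eval_var r hr) (show letterKey n a i < 2 ^ w by omega)

theorem runs_step (I : Index G π D ident w mem l T) {a i j d : ℕ} (ha : a < σ)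
    (hi : i ≤ n) (hj : j ≤ n) (hd : d ≤ n) (h8 : f 8 = i) (h9 : f 9 = j) (h10 : f 10 = d)
    (h12 : f 12 = a) :
    Runs w mem step (stepCost T) f inp (fun f' i' => i' = inp ∧ f' 11 = 1 ∧
      (if G.nextSrc π a i < j then
        f' 8 = G.lowTgt π a i ∧ f' 9 = G.highTgt π a j ∧
        f' 10 = (G.letterRec π D ident a i).slope * (d + 1) + (G.letterRec π D ident a i).ident
      else f' 8 = 0 ∧ f' 9 = 0 ∧ f' 10 = 0)) := by
  have hw := I.word'
  have hn := I.n_lt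
  have hr1 : G.Relevant ident (letterKey n a i) := Or.inr ⟨a, ha, i, hi, rfl⟩
  have hr2 : G.Relevant ident (letterKey n a j) := Or.inr ⟨a, ha, j, hj, rfl⟩
  refine Runs.seq (Q := fun f' i' => i' = inp ∧ f' = Function.update f 1 (letterKey n a i)) ?_ ?_
  · exact runs_block_cons (I.eval_keyOf ha hi h12 h8) fun _ => runs_block_nil ⟨rfl, rfl⟩
  rintro f1 i1 - ⟨rfl, hf1⟩
  refine Runs.seq (I.runs_lookup hr1 (by simp [hf1])) ?_
  rintro f2 i2 - ⟨rfl, hA, hF⟩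
  obtain ⟨x, hx⟩ : ∃ x, f2 5 = x := ⟨_, rfl⟩
  rw [hx] at hA
  have h2 : ∀ r : Fin 20, r ≠ 1 → ((r : ℕ) < 2 ∨ 7 < (r : ℕ)) → f2 r = f r := by
    intro r hr1 hr2
    rw [hF r hr2, hf1, Function.update_of_ne hr1]
  have h21 : f2 1 = letterKey n a i := by rw [hF 1 (by decide), hf1, Function.update_self]
  refine Runs.seq (Q := fun f' i' => i' = i2 ∧ f' 14 = x ∧
    f' 16 = I.diff x (letterKey n a i) ∧ f' 1 = letterKey n a j ∧ f' 9 = j ∧ f' 10 = d) ?_ ?_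
  · refine runs_block_cons (Expr.eval_var 5 hx) fun _ => ?_
    refine runs_block_cons (I.eval_offset hA (hr1.lt.trans_le I.universe_le)
      (Expr.eval_var 14 (by simp)) (Expr.eval_var 1 (by simpa [Function.update] using h21)))
      fun _ => ?_
    refine runs_block_cons (I.eval_keyOf ha hj ?_ ?_) fun _ => runs_block_nil ?_
    · simpa [Function.update] using (h2 12 (by decide) (by decide)).trans h12
    · simpa [Function.update] using (h2 9 (by decide) (by decide)).trans h9
    · refine ⟨rfl, by simp [Function.update], by simp [Function.update], by simp [Function.update],
        ?_, ?_⟩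
      · simpa [Function.update] using (h2 9 (by decide) (by decide)).trans h9
      · simpa [Function.update] using (h2 10 (by decide) (by decide)).trans h10
  rintro f3 i3 - ⟨rfl, h314, h316, h31, h39, h310⟩
  refine Runs.seq (I.runs_lookup hr2 h31) ?_
  rintro f4 i4 - ⟨rfl, hB, hF'⟩
  obtain ⟨y, hy⟩ : ∃ y, f4 5 = y := ⟨_, rfl⟩
  rw [hy] at hB
  have h414 := (hF' 14 (by decide)).trans h314
  have h416 := (hF' 16 (by decide)).trans h316
  have h41 := (hF' 1 (by decide)).trans h31
  have h49 := (hF' 9 (by decide)).trans h39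
  have h410 := (hF' 10 (by decide)).trans h310
  have hle := record_le (G := G) (π := π) (D := D) (ident := ident) (letterKey n a i)
  have hle' := record_le (G := G) (π := π) (D := D) (ident := ident) (letterKey n a j)
  have e1 := hA.src_eq
  have e2 := hA.low_eq
  have e3 := hA.ident_eq
  have e4 := hA.slope_eq
  have e5 := hB.high_eq
  rw [record_letterKey hi] at e1 e2 e3 e4 hle
  rw [record_letterKey hj] at e5 hle'
  change G.nextSrc π a i = _ at e1
  change G.lowTgt π a i = _ at e2
  change G.highTgt π a j = _ at e5
  change G.nextSrc π a i ≤ _ ∧ G.lowTgt π a i ≤ _ ∧ _ at hle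
  change _ ∧ _ ∧ G.highTgt π a j ≤ _ ∧ _ at hle'
  obtain ⟨l1, l2, -, l3, l4⟩ := hle
  obtain ⟨-, -, l5, -⟩ := hle'
  have hslope : (G.letterRec π D ident a i).slope * (d + 1) ≤ n + 1 :=
    (Nat.mul_le_mul_right _ l4).trans (by omega)
  set flag := if G.nextSrc π a i < j then 1 else 0 with hflag
  refine runs_block_cons (I.eval_offset hB (hr2.lt.trans_le I.universe_le)
    (Expr.eval_var 5 hy) (Expr.eval_var 1 h41)) fun _ => ?_
  refine runs_block_cons (v := flag) ?_ fun _ => ?_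
  · rw [hflag, e1]
    refine Expr.eval_lt_op (Expr.eval_add (I.eval_table (by omega) (Expr.eval_var 14 ?_) hA.lt_card)
      (Expr.eval_var 16 ?_) (by omega)) (Expr.eval_var 9 ?_) (by omega)
    · simpa [Function.update] using h414
    · simpa [Function.update] using h416
    · simpa [Function.update] using h49
  have hfl : ∀ z, flag * z ≤ z := fun z => by
    have : flag ≤ 1 := by rw [hflag]; split_ifs <;> omega
    exact (Nat.mul_le_mul_right _ this).trans (by omega)
  refine runs_block_cons (v := flag * ((G.letterRec π D ident a i).slope * (d + 1) +
    (G.letterRec π D ident a i).ident)) ?_ fun _ => ?_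
  · have := hfl ((G.letterRec π D ident a i).slope * (d + 1) +
      (G.letterRec π D ident a i).ident)
    rw [e3, e4] at *
    refine Expr.eval_mul (Expr.eval_var 15 ?_) (Expr.eval_add (Expr.eval_mul (I.eval_table (by omega)
      (Expr.eval_var 14 ?_) hA.lt_card) (Expr.eval_add (Expr.eval_var 10 ?_) (Expr.eval_lit
      (by omega)) (by omega)) (by omega)) (I.eval_table (by omega) (Expr.eval_var 14 ?_) hA.lt_card)
      (by omega)) (by omega)
    · simp [Function.update]
    · simpa [Function.update] using h414
    · simpa [Function.update] using h410
    · simpa [Function.update] using h414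
  refine runs_block_cons (v := flag * G.lowTgt π a i) ?_ fun _ => ?_
  · have := hfl (G.lowTgt π a i)
    rw [e2] at *
    refine Expr.eval_mul (Expr.eval_var 15 ?_) (Expr.eval_add (I.eval_table (by omega)
      (Expr.eval_var 14 ?_) hA.lt_card) (Expr.eval_var 16 ?_) (by omega)) (by omega)
    · simp [Function.update]
    · simpa [Function.update] using h414
    · simpa [Function.update] using h416
  refine runs_block_cons (v := flag * G.highTgt π a j) ?_ fun _ => ?_
  · have := hfl (G.highTgt π a j)
    rw [e5] at *
    refine Expr.eval_mul (Expr.eval_var 15 ?_) (Expr.eval_add (I.eval_table (by omega)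
      (Expr.eval_var 5 ?_) hB.lt_card) (Expr.eval_var 17 ?_) (by omega)) (by omega)
    · simp [Function.update]
    · simpa [Function.update] using hy
    · simp [Function.update]
  refine runs_block_cons (Expr.eval_lit (by omega)) fun _ => runs_block_nil ⟨rfl, by simp, ?_⟩
  by_cases hlt : G.nextSrc π a i < j
  · rw [if_pos hlt]
    rw [if_pos hlt] at hflag
    simp [Function.update, hflag]
  · rw [if_neg hlt]
    rw [if_neg hlt] at hflag
    simp [Function.update, hflag]

end Index

/-- The registers after the pattern `P` has been read. -/
structure Interval (G : LabelledDigraph V E (Fin σ)) (π ident : V ≃ Fin n) (P : List (Fin σ))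
    (f : Fin 20 → ℕ) : Prop where
  le : f 8 ≤ f 9
  le_card : f 9 ≤ n
  mem_iff : ∀ v, v ∈ G.reached P ↔ f 8 ≤ π v ∧ π v < f 9
  ident_eq : f 8 < f 9 → f 10 = identAt π ident (f 8)
  ident_le : f 10 ≤ n
  mode : f 11 = if P = [] then 0 else 1

theorem Interval.congr {P : List (Fin σ)} {f f' : Fin 20 → ℕ} (h : Interval G π ident P f)
    (h8 : f' 8 = f 8) (h9 : f' 9 = f 9) (h10 : f' 10 = f 10) (h11 : f' 11 = f 11) :
    Interval G π ident P f' := by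
  obtain ⟨a1, a2, a3, a4, a5, a6⟩ := h
  constructor <;> simp only [h8, h9, h10, h11] <;> assumption

/-- The interval is handled by `image_interval`. For the identifier: if an inner edge leaves the
first vertex, then its target is the new first vertex and has the next identifier; otherwise the
record holds the new one outright. -/
theorem Interval.append [Finite E] (W : G.IsWheelerOrder π) (hD : G.IsPathDecomposition D)
    (hI : G.IsIdentifierAssignment D ident) {P : List (Fin σ)} {f f' : Fin 20 → ℕ} {a : Fin σ}
    (h : Interval G π ident P f) (h11 : f' 11 = 1)
    (hf' : if G.nextSrc π a (f 8) < f 9 then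
        f' 8 = G.lowTgt π a (f 8) ∧ f' 9 = G.highTgt π a (f 9) ∧
        f' 10 = (G.letterRec π D ident a (f 8)).slope * (f 10 + 1) +
          (G.letterRec π D ident a (f 8)).ident
      else f' 8 = 0 ∧ f' 9 = 0 ∧ f' 10 = 0) :
    Interval G π ident (P ++ [a]) f' := by
  have hle := h.le
  have hlec := h.le_card
  have hmem : ∀ v, v ∈ G.reached (P ++ [a]) ↔ ∃ e, (f 8 ≤ (π (G.src e) : ℕ) ∧
      (π (G.src e) : ℕ) < f 9) ∧ (G.label e : ℕ) = a ∧ G.tgt e = v := by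
    intro v
    rw [mem_reached_append_singleton]
    refine exists_congr fun e => ?_
    rw [h.mem_iff, Fin.ext_iff]
  have hspec := nextSrc_spec (G := G) (π := π) (a := a) (i := f 8) (by omega)
  split_ifs at hf' with hlt
  · obtain ⟨g8, g9, g10⟩ := hf'
    obtain ⟨e0, ha0, hs0⟩ : ∃ e, (G.label e : ℕ) = a ∧ (π (G.src e) : ℕ) = G.nextSrc π a (f 8) := by
      rcases hspec.2 with h | h
      · exact h
      · omega
    have hlow := lowTgt_le (π := π) (i := f 8) ha0 (by omega)
    have hhigh := lt_highTgt (π := π) (j := f 9) ha0 (by omega)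
    have hid : f' 10 = identAt π ident (f' 8) := by
      rw [g10, g8]
      by_cases hin : G.InnerAt π D a (f 8)
      · have hin' := hin
        obtain ⟨e, he, hl, hs⟩ := hin
        obtain ⟨-, -, -, -, hn1, hn2⟩ := hD.inner he
        have h1 := lowTgt_inner W hD he
        have h2 := h.ident_eq (by omega)
        rw [← hs, identAt_rank] at h2
        rw [hl, hs] at h1
        simp only [letterRec, if_pos hin', h1, identAt_rank, hI e hn1 hn2, h2]
        omega
      · simp only [letterRec, if_neg hin]
        omega
    constructor
    · omega
    · rw [g9]
      exact highTgt_le_card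
    · intro v
      rw [hmem, g8, g9]
      exact W.image_interval hlt hlec (by omega) v
    · exact fun _ => hid
    · rw [hid]
      exact identAt_le _
    · simpa using h11
  · obtain ⟨g8, g9, g10⟩ := hf'
    constructor
    · omega
    · omega
    · intro v
      rw [hmem, g8, g9]
      refine iff_of_false ?_ (by omega)
      rintro ⟨e, ⟨h1, h2⟩, ha, -⟩
      have := nextSrc_le ha h1
      omega
    · omega
    · omega
    · simpa using h11

theorem Interval.ncard_reached {P : List (Fin σ)} {f : Fin 20 → ℕ} (h : Interval G π ident P f) :
    (G.reached P).ncard = f 9 - f 8 := by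
  have h1 : (fun v => (π v : ℕ)) '' G.reached P = (Finset.Ico (f 8) (f 9) : Set ℕ) := by
    ext k
    simp only [Set.mem_image, h.mem_iff, Finset.coe_Ico, Set.mem_Ico]
    constructor
    · rintro ⟨v, hv, rfl⟩
      exact hv
    · intro hk
      have := h.le_card
      exact ⟨π.symm ⟨k, by omega⟩, by simpa using hk, by simp⟩
  rw [← Set.ncard_image_of_injective _ (show Function.Injective (fun v => (π v : ℕ)) from
    fun u v huv => π.injective (Fin.ext huv)), h1, Set.ncard_coe_finset, Nat.card_Ico]

namespace Index
variable {f : Fin 20 → ℕ} {inp : List ℕ}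

/-- The invariant of the loop of `count`. -/
def LoopInv (G : LabelledDigraph V E (Fin σ)) (π ident : V ≃ Fin n) (P : List (Fin σ)) (k : ℕ)
    (f : Fin 20 → ℕ) (inp : List ℕ) : Prop :=
  ∃ P₁ P₂, P = P₁ ++ P₂ ∧ k = P₂.length ∧ Interval G π ident P₁ f ∧
    ((P₂ = [] ∧ f 13 = 0) ∨
      ∃ a P₃, P₂ = a :: P₃ ∧ f 12 = (a : ℕ) ∧ f 13 = 1 ∧ inp = P₃.map Fin.val)

theorem runs_read (I : Index G π D ident w mem l T) {P P₁ P₂ : List (Fin σ)} (hP : P = P₁ ++ P₂)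
    (h : Interval G π ident P₁ f) :
    Runs w mem (.read 12 13) 1 f (P₂.map Fin.val) (LoopInv G π ident P P₂.length) := by
  have hw := I.word'
  have hpos := Nat.two_pow_pos l
  cases P₂ with
  | nil =>
    refine (runs_read_nil (d := 12) (g := 13)).mono le_rfl ?_
    rintro f' i' - ⟨rfl, rfl⟩
    exact ⟨P₁, [], hP, rfl, h.congr rfl rfl rfl rfl, Or.inl ⟨rfl, rfl⟩⟩
  | cons a P₃ =>
    have ha : (a : ℕ) < 2 ^ w := by
      have h1 := letterKey_lt (n := n) a.isLt (Nat.zero_le n)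
      have h2 := I.universe_le
      have h3 : (a : ℕ) + 1 ≤ (a + 1) * (n + 1) := Nat.le_mul_of_pos_right _ (by omega)
      unfold letterKey at h1
      omega
    refine (runs_read_cons (d := 12) (g := 13) (a : ℕ) ha (by omega)).mono le_rfl ?_
    rintro f' i' - ⟨rfl, rfl⟩
    exact ⟨P₁, a :: P₃, hP, rfl, h.congr rfl rfl rfl rfl, Or.inr ⟨a, P₃, rfl, rfl, rfl, rfl⟩⟩

theorem runs_count [Finite E] (I : Index G π D ident w mem l T) (W : G.IsWheelerOrder π)
    (hD : G.IsPathDecomposition D) (hI : G.IsIdentifierAssignment D ident) (P : List (Fin σ)) :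
    Runs w mem count (countCost T P.length) (fun _ => 0) (P.map Fin.val)
      (fun f' _ => f' 0 = (G.reached P).ncard ∧ ∃ i j, i ≤ j ∧ j ≤ n ∧
        (∀ v, v ∈ G.reached P ↔ i ≤ π v ∧ π v < j) ∧ f' 11 = (if P = [] then 0 else 1) ∧
        (P = [] → f' 10 = 0) ∧ (P ≠ [] → i < j → f' 10 = identAt π ident i)) := by
  have hw := I.word'
  have hn := I.n_lt
  have hh : ∀ {f : Fin 20 → ℕ} {t : ℕ}, t < 32 → (Expr.header t).eval w mem f = I.tab t 0 :=
    fun ht => I.stores.eval_header ht (by omega)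
  refine Runs.seq (Q := fun f' i' => i' = P.map Fin.val ∧ Interval G π ident [] f') ?_ ?_
  · refine runs_block_cons (hh (by omega)) fun _ => runs_block_cons (hh (by omega)) fun _ =>
      runs_block_nil ⟨rfl, ?_⟩
    rw [I.card_eq, I.first_eq]
    constructor
    · simp [Function.update]
    · simp [Function.update]
    · intro v
      simp [Function.update, mem_reached_nil]
    · simp [Function.update]
    · simpa [Function.update] using identAt_le (π := π) (ident := ident) 0
    · simp [Function.update]
  rintro f1 i1 - ⟨rfl, h1⟩
  refine Runs.seq (I.runs_read (P := P) (P₁ := []) (P₂ := P) rfl h1) ?_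
  intro f2 i2 _ h2
  refine Runs.seq (runs_loop (a := 13) (LoopInv G π ident P) ?_ ?_ ?_ P.length f2 i2 h2) ?_
  · rintro f i ⟨P₁, P₂, -, hk, -, h⟩
    rcases h with ⟨-, h⟩ | ⟨a, P₃, rfl, -⟩
    · exact h
    · simp at hk
  · rintro k f i ⟨P₁, P₂, -, hk, -, h⟩
    rcases h with ⟨rfl, -⟩ | ⟨a, P₃, -, -, h, -⟩
    · simp at hk
    · omega
  · rintro k f i - ⟨P₁, P₂, hP, hk, hint, h⟩
    rcases h with ⟨rfl, -⟩ | ⟨a, P₃, rfl, h12, h13, rfl⟩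
    · simp at hk
    have hk' : k = P₃.length := by simpa using hk
    subst hk'
    have hle := hint.le
    have hlec := hint.le_card
    refine Runs.seq (I.runs_step a.isLt (by omega) hlec hint.ident_le rfl rfl rfl h12) ?_
    rintro f' i' - ⟨rfl, g11, gf⟩
    exact I.runs_read (P₁ := P₁ ++ [a]) (by simpa using hP) (hint.append W hD hI g11 gf)
  · rintro f3 i3 - ⟨P₁, P₂, hP, hk, hint, -⟩
    obtain rfl : P₂ = [] := List.length_eq_zero_iff.1 hk.symm
    obtain rfl : P = P₁ := by simpa using hP
    have hle := hint.le
    have hlec := hint.le_card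
    have hid := hint.ident_le
    have hmode := hint.mode
    have hm1 : f3 11 ≤ 1 := by rw [hmode]; split_ifs <;> omega
    have hmul : f3 10 * f3 11 ≤ f3 10 := (Nat.mul_le_mul_left _ hm1).trans (by omega)
    refine runs_block_cons (Expr.eval_sub (Expr.eval_var 9 rfl) (Expr.eval_var 8 rfl) hle (by omega))
      fun _ => ?_
    refine runs_block_cons (v := f3 10 * f3 11) (Expr.eval_mul (Expr.eval_var 10 rfl)
      (Expr.eval_var 11 rfl) ?_) fun _ => runs_block_nil ?_
    · omega
    refine ⟨hint.ncard_reached.symm, f3 8, f3 9, hle, hlec, hint.mem_iff, hmode, ?_, ?_⟩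
    · intro h
      rw [if_pos h] at hmode
      change f3 10 * f3 11 = 0
      rw [hmode, mul_zero]
    · intro h hlt
      rw [if_neg h] at hmode
      change f3 10 * f3 11 = _
      rw [hmode, mul_one, hint.ident_eq hlt]

theorem runs_next_ident [Finite E] (I : Index G π D ident w mem l T) {v : V}
    (hv : 0 < G.inDeg v) (h10 : f 10 = ident v) (h11 : f 11 = 1) :
    Runs w mem next (nextCost T) f inp (fun f' _ => f' 0 = ident v ∧ f' 11 = 1 ∧
      f' 10 = identAt π ident (π v + 1)) := by
  have hw := I.word'
  have hn := I.n_lt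
  have hr : G.Relevant ident (ident v : ℕ) := Or.inl ⟨v, hv, rfl⟩
  suffices h : Runs w mem next (blockCost nextInit + (lookupCost T + blockCost nextIdent + 1)) f inp
      (fun f' _ => f' 0 = ident v ∧ f' 11 = 1 ∧ f' 10 = identAt π ident (π v + 1)) from
    h.mono (by simp only [nextCost]; omega) (fun _ _ _ h => h)
  refine Runs.seq (Q := fun f' i' => i' = inp ∧ f' 0 = ident v ∧ f' 1 = ident v ∧ f' 11 = 1) ?_ ?_
  · refine runs_block_cons (Expr.eval_var 10 h10) fun _ => runs_block_cons
      (Expr.eval_var (x := (ident v : ℕ)) 10 (by simpa [Function.update] using h10)) fun _ =>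
      runs_block_nil ?_
    exact ⟨rfl, by simp [Function.update], by simp [Function.update],
      by simpa [Function.update] using h11⟩
  rintro f1 i1 - ⟨rfl, g0, g1, g11⟩
  refine Runs.cond_pos (a := 11) (by rw [g11]; exact one_ne_zero) ?_
  refine Runs.seq (I.runs_lookup hr g1) ?_
  rintro f2 i2 - ⟨rfl, hA, hF⟩
  have hle := record_le (G := G) (π := π) (D := D) (ident := ident) (ident v)
  have hlow := hA.low_eq
  have hval : (G.record π D ident (ident v)).low = identAt π ident (π v + 1) := by
    rw [record_ident]
    simp only [identRec, rankOf_ident]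
  refine runs_block_cons (v := identAt π ident (π v + 1)) ?_ fun _ => runs_block_nil ?_
  · rw [← hval, hlow]
    refine Expr.eval_add (I.eval_table (by omega) (Expr.eval_var 5 rfl) hA.lt_card)
      (I.eval_offset hA (hr.lt.trans_le I.universe_le) (Expr.eval_var 5 rfl)
        (Expr.eval_var 1 ((hF 1 (by decide)).trans g1))) (by omega)
  · refine ⟨?_, ?_, by simp⟩
    · simpa [Function.update] using (hF 0 (by decide)).trans g0
    · simpa [Function.update] using (hF 11 (by decide)).trans g11

theorem runs_next_number (I : Index G π D ident w mem l T) {k : ℕ}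
    (hk : k < n) (h10 : f 10 = k) (h11 : f 11 = 0) :
    Runs w mem next (nextCost T) f inp (fun f' _ => f' 0 = k ∧ f' 11 = 0 ∧ f' 10 = k + 1) := by
  have hw := I.word'
  have hn := I.n_lt
  suffices h : Runs w mem next (blockCost nextInit + (blockCost nextNumber + 1)) f inp
      (fun f' _ => f' 0 = k ∧ f' 11 = 0 ∧ f' 10 = k + 1) from
    h.mono (by simp only [nextCost]; omega) (fun _ _ _ h => h)
  refine Runs.seq (Q := fun f' i' => i' = inp ∧ f' 0 = k ∧ f' 10 = k ∧ f' 11 = 0) ?_ ?_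
  · refine runs_block_cons (Expr.eval_var 10 h10) fun _ => runs_block_cons
      (Expr.eval_var (x := k) 10 (by simpa [Function.update] using h10)) fun _ => runs_block_nil ?_
    exact ⟨rfl, by simp [Function.update], by simpa [Function.update] using h10,
      by simpa [Function.update] using h11⟩
  rintro f1 i1 - ⟨rfl, g0, g10, g11⟩
  refine Runs.cond_zero (a := 11) g11 ?_
  refine runs_block_cons (Expr.eval_add (Expr.eval_var 10 g10) (Expr.eval_lit (by omega))
    (by omega)) fun _ => runs_block_nil ?_
  exact ⟨by simpa [Function.update] using g0, by simpa [Function.update] using g11, by simp⟩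

/-- Positive in-degrees make every lookup relevant. Register 10 matters only while something is left
to report, so its value after the last vertex of the interval is immaterial. -/
theorem reports_ident [Finite E] (I : Index G π D ident w mem l T) (m : ℕ) :
    ∀ (i : ℕ) (s : State) (f : Fin 20 → ℕ), Agree w s f → i + m ≤ n →
    (∀ v, i ≤ (π v : ℕ) → (π v : ℕ) < i + m → 0 < G.inDeg v) → f 11 = 1 →
    (0 < m → f 10 = identAt π ident i) →
    Reports w mem next (nextCost T) s ((List.range' i m).map (identAt π ident)) := by
  induction m with
  | zero =>
    intros
    exact trivial
  | succ m ih =>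
    intro i s f hs hi hpos h11 h10
    obtain ⟨v, hv⟩ : ∃ v, (π v : ℕ) = i := ⟨π.symm ⟨i, by omega⟩, by simp⟩
    have h10' := h10 (by omega)
    rw [← hv, identAt_rank] at h10'
    obtain ⟨t, s', f', he, ht, ha, g0, g11, g10⟩ :=
      I.runs_next_ident (hpos v hv.ge (by omega)) h10' h11 s hs rfl
    rw [List.range'_succ, List.map_cons]
    refine ⟨t, s', he, ht, ?_, ?_⟩
    · rw [← hv, identAt_rank, ← g0]
      exact (ha 0).1
    · exact ih (i + 1) s' f' ha (by omega) (fun u h1 h2 => hpos u (by omega) (by omega)) g11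
        (fun _ => by rw [g10, hv])

theorem reports_number (I : Index G π D ident w mem l T) (m : ℕ) :
    ∀ (k : ℕ) (s : State) (f : Fin 20 → ℕ), Agree w s f → k + m ≤ n → f 11 = 0 → f 10 = k →
    Reports w mem next (nextCost T) s (List.range' k m) := by
  induction m with
  | zero =>
    intros
    exact trivial
  | succ m ih =>
    intro k s f hs hk h11 h10
    obtain ⟨t, s', f', he, ht, ha, g0, g11, g10⟩ := I.runs_next_number (by omega) h10 h11 s hs rfl
    rw [List.range'_succ]
    exact ⟨t, s', he, ht, (ha 0).1.trans g0, ih (k + 1) s' f' ha (by omega) g11 g10⟩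

theorem inDeg_pos_of_mem_reached [Finite E] {P : List (Fin σ)} (hP : P ≠ []) {v : V}
    (hv : v ∈ G.reached P) : 0 < G.inDeg v := by
  rw [← List.dropLast_append_getLast hP, mem_reached_append_singleton] at hv
  obtain ⟨e, -, -, he⟩ := hv
  exact G.inDeg_pos_iff.2 ⟨e, he⟩

theorem exec_queries [Finite E] (I : Index G π D ident w mem l T) (W : G.IsWheelerOrder π)
    (hD : G.IsPathDecomposition D) (hI : G.IsIdentifierAssignment D ident) (P : List (Fin σ)) :
    ∃ t s, Exec w mem count (State.init (P.map Fin.val)) t s ∧ t ≤ countCost T P.length ∧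
      s.reg 0 = (G.reached P).ncard ∧ ∃ ids : List ℕ, ids.Nodup ∧
        (∀ i, i ∈ ids ↔ ∃ v ∈ G.reached P, (ident v : ℕ) = i) ∧
        Reports w mem next (nextCost T) s ids := by
  obtain ⟨t, s, f, he, ht, ha, h0, i, j, hij, hj, hmem, h11, h10, h10'⟩ :=
    I.runs_count W hD hI P (State.init (P.map Fin.val)) (fun r => ⟨rfl, by positivity⟩) rfl
  refine ⟨t, s, he, ht, (ha 0).1.trans h0, ?_⟩
  by_cases hP : P = []
  · subst hP
    rw [if_pos rfl] at h11
    refine ⟨List.range' 0 n, List.nodup_range', ?_, I.reports_number n 0 s f ha (by omega) h11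
      (h10 rfl)⟩
    intro k
    rw [List.mem_range'_1]
    constructor
    · intro hk
      exact ⟨ident.symm ⟨k, by omega⟩, G.mem_reached_nil _, by simp⟩
    · rintro ⟨v, -, rfl⟩
      have := (ident v).isLt
      omega
  · rw [if_neg hP] at h11
    refine ⟨(List.range' i (j - i)).map (identAt π ident), ?_, ?_,
      I.reports_ident (j - i) i s f ha (by omega) ?_ h11 fun h => h10' hP (by omega)⟩
    · refine List.Nodup.map_on ?_ List.nodup_range'
      intro x hx y hy hxy
      rw [List.mem_range'_1] at hx hy
      rw [identAt, identAt, dif_pos (by omega), dif_pos (by omega)] at hxy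
      simpa using π.symm.injective (ident.injective (Fin.ext hxy))
    · intro k
      simp only [List.mem_map, List.mem_range'_1]
      constructor
      · rintro ⟨x, hx, rfl⟩
        refine ⟨π.symm ⟨x, by omega⟩, (hmem _).2 ?_, ?_⟩
        · simp
          omega
        · rw [identAt, dif_pos (by omega)]
      · rintro ⟨v, hv, rfl⟩
        have := (hmem v).1 hv
        exact ⟨π v, by omega, identAt_rank v⟩
    · intro v h1 h2
      exact inDeg_pos_of_mem_reached hP ((hmem v).2 ⟨h1, by omega⟩)

end Index

end queries

end LabelledDigraph

/-! ### Construction of the index -/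

namespace LabelledDigraph

section construction
variable {V E : Type} {σ n : ℕ} {G : LabelledDigraph V E (Fin σ)} {π : V ≃ Fin n}
  {D : List (List E)} {ident : V ≃ Fin n} {l T : ℕ}

/-- The entries of the tables of the index. -/
noncomputable def indexEntry (X : SearchTables (G.breakKeys π D ident) l T) (i : ℕ) : ℕ → ℕ
  | 0 => X.p
  | 1 => X.A
  | 2 => X.N
  | 3 => l
  | 4 => 2 ^ l
  | 5 => 2 ^ T / 2
  | 6 => n
  | 7 => identAt π ident 0
  | 8 => X.a i
  | 9 => if i < X.N then X.m i else 0
  | 10 => if i < X.N then X.off i else 0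
  | 11 => X.cellCode i
  | 12 => X.cellAns i
  | 13 => if i < (G.breakKeys π D ident).card then key (G.breakKeys π D ident) i + 1 else 0
  | 14 => (G.record π D ident (key (G.breakKeys π D ident) i)).src
  | 15 => (G.record π D ident (key (G.breakKeys π D ident) i)).low
  | 16 => (G.record π D ident (key (G.breakKeys π D ident) i)).high
  | 17 => (G.record π D ident (key (G.breakKeys π D ident) i)).ident
  | 18 => (G.record π D ident (key (G.breakKeys π D ident) i)).slope
  | _ => 0

/-- The tables of the index. -/
noncomputable def indexTables (X : SearchTables (G.breakKeys π D ident) l T) (t i : ℕ) : ℕ :=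
  -- The hash table is the longest table. Zeros beyond it agree with the default value of a load
  -- outside the memory.
  if 5 * (G.breakKeys π D ident).card ≤ i then 0 else indexEntry X i t

theorem card_breakKeys_pos : 0 < (G.breakKeys π D ident).card :=
  Finset.card_pos.2 ⟨0, zero_mem_breakKeys⟩

theorem indexTables_lt (X : SearchTables (G.breakKeys π D ident) l T) (hl : l + 1 = 2 ^ T)
    (hU : (σ + 1) * (n + 1) ≤ 2 ^ l) (t i : ℕ) : indexTables X t i < 8 * 2 ^ l := by
  have hpos := Nat.two_pow_pos l
  have hll : l < 2 ^ l := Nat.lt_two_pow_self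
  have hn : n + 1 ≤ 2 ^ l := (Nat.le_mul_of_pos_left _ (Nat.succ_pos σ)).trans hU
  have hS : ∀ s ∈ G.breakKeys π D ident, s < 2 ^ l := fun s hs => (breakKeys_lt hs).trans_le hU
  have hc : (G.breakKeys π D ident).card ≤ 2 ^ l := by
    have h : G.breakKeys π D ident ⊆ Finset.range (2 ^ l) := fun s hs => Finset.mem_range.2 (hS s hs)
    simpa using Finset.card_le_card h
  have hp := X.p_lt
  rw [show l + 2 = l + 1 + 1 from rfl, pow_succ, pow_succ] at hp
  have hA := X.A_lt
  have hN := X.N_le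
  have hid := identAt_le (π := π) (ident := ident) 0
  have ha := X.a_lt i
  have hcode := X.cellCode_lt i
  rw [pow_succ] at hcode
  have hans := X.cellAns_lt i
  have hoff := X.off_le i
  have hrec := record_le (G := G) (π := π) (D := D) (ident := ident)
    (key (G.breakKeys π D ident) i)
  obtain ⟨r1, r2, r3, r4, r5⟩ := hrec
  unfold indexTables
  split_ifs with hi
  · omega
  have hkey : i < (G.breakKeys π D ident).card → key (G.breakKeys π D ident) i < 2 ^ l :=
    fun h => hS _ (key_mem h)
  unfold indexEntry
  split
  case h_10 => split_ifs <;> omega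
  case h_11 => split_ifs <;> omega
  case h_14 => split_ifs <;> omega
  all_goals omega

/-- The memory of the index. -/
noncomputable def indexMemory (X : SearchTables (G.breakKeys π D ident) l T) : List ℕ :=
  (List.range (32 * (5 * (G.breakKeys π D ident).card))).map
    fun k => indexTables X (k % 32) (k / 32)

theorem length_indexMemory (X : SearchTables (G.breakKeys π D ident) l T) :
    (indexMemory X).length = 160 * (G.breakKeys π D ident).card := by
  rw [indexMemory, List.length_map, List.length_range]
  ring

theorem indexMemory_lt (X : SearchTables (G.breakKeys π D ident) l T) (hl : l + 1 = 2 ^ T)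
    (hU : (σ + 1) * (n + 1) ≤ 2 ^ l) : ∀ x ∈ indexMemory X, x < 8 * 2 ^ l := by
  intro x hx
  obtain ⟨k, -, rfl⟩ := List.mem_map.1 hx
  exact indexTables_lt X hl hU _ _

theorem getD_indexMemory (X : SearchTables (G.breakKeys π D ident) l T) {t : ℕ} (ht : t < 32)
    (i : ℕ) : (indexMemory X).getD (32 * i + t) 0 = indexTables X t i := by
  by_cases hi : 5 * (G.breakKeys π D ident).card ≤ i
  · rw [indexTables, if_pos hi]
    apply List.getD_eq_default
    rw [length_indexMemory]
    omega
  · rw [List.getD_eq_getElem _ _ (by rw [length_indexMemory]; omega)]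
    simp only [indexMemory, List.getElem_map, List.getElem_range]
    congr 1 <;> omega

/-- The index. -/
noncomputable def index (X : SearchTables (G.breakKeys π D ident) l T) {w : ℕ} (hl : l + 1 = 2 ^ T)
    (hU : (σ + 1) * (n + 1) ≤ 2 ^ l) (hw : 4096 * 2 ^ l * 2 ^ l ≤ 2 ^ w) :
    Index G π D ident w (indexMemory X) l T :=
  have h0 : ¬ 5 * (G.breakKeys π D ident).card ≤ 0 := by
    have := card_breakKeys_pos (G := G) (π := π) (D := D) (ident := ident)
    omega
  have hN : ∀ b < X.N, ¬ 5 * (G.breakKeys π D ident).card ≤ b := fun b hb => by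
    have := X.N_le
    omega
  { tab := indexTables X
    tables := X
    stores := by
      refine ⟨fun t ht i => getD_indexMemory X ht i,
        fun t i => (indexTables_lt X hl hU t i).trans_le ?_⟩
      have h1 : 4096 * 2 ^ l ≤ 2 ^ w := (Nat.le_mul_of_pos_right _ (Nat.two_pow_pos l)).trans hw
      omega
    search := by
      constructor
      case a => exact fun b hb => by rw [indexTables, if_neg (hN b hb), indexEntry]
      case m => exact fun b hb => by rw [indexTables, if_neg (hN b hb)]; exact if_pos hb
      case off => exact fun b hb => by rw [indexTables, if_neg (hN b hb)]; exact if_pos hb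
      case code => exact fun c hc => by rw [indexTables, if_neg (by omega), indexEntry]
      case ans => exact fun c hc => by rw [indexTables, if_neg (by omega), indexEntry]
      case key => exact fun j hj => by rw [indexTables, if_neg (by omega)]; exact if_pos hj
      case key_of_le =>
        intro j hj
        rw [indexTables]
        split_ifs
        · rfl
        · exact if_neg (by omega)
      all_goals rw [indexTables, if_neg h0, indexEntry]
    card_eq := by rw [indexTables, if_neg h0, indexEntry]
    first_eq := by rw [indexTables, if_neg h0, indexEntry]
    rec_eq := fun j hj => by
      simp only [indexTables, indexEntry,
        if_neg (show ¬ 5 * (G.breakKeys π D ident).card ≤ j by omega)]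
    height_eq := hl
    word := hw
    universe_le := hU }

end construction

end LabelledDigraph

/-! ### The choice of the parameters -/

/-- The cost is affine in `T` with nonnegative coefficients, so the factor `q` can be pulled out. -/
theorem lookupCost_le {T a q : ℕ} (hT : T ≤ a * q) (hq : 0 < q) :
    lookupCost T ≤ lookupCost a * q := by
  have h1 : ∀ x, T * (x + 1) ≤ a * (x + 1) * q := fun x =>
    (Nat.mul_le_mul_right _ hT).trans (by rw [mul_right_comm])
  have h2 : ∀ x, x ≤ x * q := fun x => Nat.le_mul_of_pos_right _ hq
  have e : lookupCost a * q = blockCost depthInit * q + ((a * (blockCost depthStep + 1) * q + q) +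
    (blockCost keyInit * q + (a * (blockCost keyStep + 1) * q + q))) := by
    unfold lookupCost
    ring
  rw [e]
  have := h1 (blockCost depthStep)
  have := h1 (blockCost keyStep)
  have := h2 (blockCost depthInit)
  have := h2 (blockCost keyInit)
  unfold lookupCost
  omega

theorem nextCost_le {T a q : ℕ} (hT : T ≤ a * q) (hq : 0 < q) : nextCost T ≤ nextCost a * q := by
  have h := lookupCost_le hT hq
  have h2 : ∀ x, x ≤ x * q := fun x => Nat.le_mul_of_pos_right _ hq
  have h3 := h2 (blockCost nextInit)
  have h4 := h2 (blockCost nextIdent)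
  have h5 := h2 (blockCost nextNumber)
  unfold nextCost
  rw [add_mul, add_mul, add_mul, add_mul]
  omega

theorem countCost_le {T a q : ℕ} (hT : T ≤ a * q) (hq : 0 < q) (m : ℕ) :
    countCost T m ≤ countCost a 1 * ((m + 1) * q) := by
  have h := lookupCost_le hT hq
  have h2 : ∀ x, x ≤ x * q := fun x => Nat.le_mul_of_pos_right _ hq
  have hs : stepCost T + 1 + 1 ≤ (stepCost a + 1 + 1) * q := by
    have h3 := h2 (blockCost [(1, Expr.keyOf 8)])
    have h4 := h2 (blockCost stepMiddle)
    have h5 := h2 (blockCost stepEnd)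
    unfold stepCost
    simp only [add_mul]
    omega
  have hm : m * (stepCost T + 1 + 1) ≤ m * ((stepCost a + 1 + 1) * q) := Nat.mul_le_mul_left _ hs
  have h3 : ∀ x, x ≤ x * ((m + 1) * q) := fun x => Nat.le_mul_of_pos_right _ (by positivity)
  have e : countCost a 1 * ((m + 1) * q) = blockCost countInit * ((m + 1) * q) +
      (1 * ((m + 1) * q) + ((m * ((stepCost a + 1 + 1) * q) + (stepCost a + 1 + 1) * q +
        1 * ((m + 1) * q)) + blockCost countEnd * ((m + 1) * q))) := by
    unfold countCost
    ring
  rw [e]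
  have h4 := h3 (blockCost countInit)
  have h5 := h3 1
  have h6 := h3 (blockCost countEnd)
  unfold countCost
  omega

theorem Reports.mono {w : ℕ} {mem : List ℕ} {p : Prog} {T T' : ℕ} (hT : T ≤ T') {xs : List ℕ} :
    ∀ {s : State}, Reports w mem p T s xs → Reports w mem p T' s xs := by
  induction xs with
  | nil => exact fun _ => trivial
  | cons x xs ih =>
    rintro s ⟨t, s', he, ht, h0, h⟩
    exact ⟨t, s', he, ht.trans hT, h0, ih h⟩

/-- The height of the search tree is logarithmic in `n`, and the logarithm of the height is at most
proportional to `loglog n`. -/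
theorem exists_height (c n σ : ℕ) (hσ : σ ≤ c * n ^ c) :
    ∃ l T, l + 1 = 2 ^ T ∧ (σ + 1) * (n + 1) ≤ 2 ^ l ∧
      4096 * 2 ^ l * 2 ^ l ≤ 2 ^ wordSize (8 * c + 16) n ∧ T ≤ (2 * c + 3) * loglog n := by
  set q := Nat.log 2 n + 1 with hq
  have hn : n < 2 ^ q := Nat.lt_pow_succ_log_self (by omega) n
  -- The universe has at most `2 ^ (c + c * q + q)` keys, and `c + c * q + q ≤ (2 * c + 1) * q`.
  -- Rounding up to `2 ^ T` makes the number of depths a power of two and costs at most a factor 2.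
  set T := Nat.log 2 ((2 * c + 1) * q) + 1 with hT
  have hT1 : (2 * c + 1) * q < 2 ^ T := Nat.lt_pow_succ_log_self (by omega) _
  have hT2 : 2 ^ (T - 1) ≤ (2 * c + 1) * q := by
    rw [hT, Nat.add_sub_cancel]
    exact Nat.pow_log_le_self 2 (by positivity)
  have hT3 : 2 ^ T = 2 * 2 ^ (T - 1) := by rw [hT, Nat.add_sub_cancel, pow_succ]; ring
  have e1 : (2 * c + 1) * q = 2 * (c * q) + q := by ring
  refine ⟨2 ^ T - 1, T, Nat.sub_add_cancel (Nat.two_pow_pos T), ?_, ?_, ?_⟩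
  · have h1 : n ^ c ≤ 2 ^ (q * c) := by
      rw [pow_mul]
      exact Nat.pow_le_pow_left hn.le c
    have h2 : c + 1 ≤ 2 ^ c := Nat.lt_two_pow_self
    have h3 : σ + 1 ≤ 2 ^ c * 2 ^ (q * c) := by
      have h4 : σ ≤ c * 2 ^ (q * c) := hσ.trans (Nat.mul_le_mul_left _ h1)
      have h5 : (c + 1) * 2 ^ (q * c) ≤ 2 ^ c * 2 ^ (q * c) := Nat.mul_le_mul_right _ h2
      have h6 := Nat.two_pow_pos (q * c)
      rw [add_mul] at h5
      omega
    refine (Nat.mul_le_mul h3 hn).trans ?_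
    rw [← pow_add, ← pow_add]
    apply Nat.pow_le_pow_right (by omega)
    have h7 : c ≤ c * q := Nat.le_mul_of_pos_right _ (by omega)
    rw [mul_comm q c]
    omega
  · rw [show (4096 : ℕ) = 2 ^ 12 by norm_num, ← pow_add, ← pow_add]
    apply Nat.pow_le_pow_right (by omega)
    have e2 : wordSize (8 * c + 16) n = 8 * (c * q) + 16 * q := by
      unfold wordSize
      ring
    omega
  · have h1 : q ≤ 2 ^ loglog n := by
      have h : Nat.log 2 n < 2 ^ loglog n := Nat.lt_pow_succ_log_self (by omega) _
      omega
    have h2 : 2 * c + 1 ≤ 2 ^ (2 * c + 1) := Nat.lt_two_pow_self.le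
    have h3 : 2 ^ (T - 1) ≤ 2 ^ (2 * c + 1 + loglog n) := by
      rw [pow_add]
      exact hT2.trans (Nat.mul_le_mul h2 h1)
    have h4 := (Nat.pow_le_pow_iff_right (by omega : 1 < 2)).1 h3
    have h5 : 1 ≤ loglog n := Nat.succ_pos _
    have h6 : 2 * c + 2 ≤ (2 * c + 2) * loglog n := Nat.le_mul_of_pos_right _ h5
    have e3 : (2 * c + 3) * loglog n = (2 * c + 2) * loglog n + loglog n := by ring
    omega

end WheelerIndex

theorem theorem1 (c : ℕ) :
    ∃ (K C : ℕ) (count next : WheelerIndex.Prog),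
      ∀ (V E : Type) [Fintype V] [Fintype E] (σ : ℕ)
        (G : WheelerIndex.LabelledDigraph V E (Fin σ))
        (π : V ≃ Fin (Fintype.card V)) (B : List (Fin σ)) (D : List (List E))
        (ident : V ≃ Fin (Fintype.card V)),
        G.IsWheelerOrder π → G.IsBWT π B → G.IsPathDecomposition D →
        G.IsIdentifierAssignment D ident →
        Fintype.card E ≤ c * Fintype.card V ^ c → σ ≤ c * Fintype.card V ^ c →
        ∃ mem : List ℕ,
          (∀ x ∈ mem, x < 2 ^ WheelerIndex.wordSize K (Fintype.card V)) ∧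
          mem.length ≤ C * (WheelerIndex.runs B + D.length + 1) ∧
          ∀ P : List (Fin σ), ∃ (t : ℕ) (s : WheelerIndex.State),
            WheelerIndex.Exec (WheelerIndex.wordSize K (Fintype.card V)) mem count
              (WheelerIndex.State.init (P.map Fin.val)) t s ∧
            t ≤ C * ((P.length + 1) * WheelerIndex.loglog (Fintype.card V)) ∧
            s.reg 0 = (G.reached P).ncard ∧
            ∃ ids : List ℕ, ids.Nodup ∧
              (∀ i, i ∈ ids ↔ ∃ v ∈ G.reached P, (ident v : ℕ) = i) ∧
              WheelerIndex.Reports (WheelerIndex.wordSize K (Fintype.card V)) mem next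
                (C * WheelerIndex.loglog (Fintype.card V)) s ids := by
  -- Here `4480 = 160 * 28`: 32 tables of 5 entries for each break, and at most 28 breaks per unit
  -- of `runs B + D.length + 1`.
  refine ⟨8 * c + 16, 4480 + WheelerIndex.countCost (2 * c + 3) 1 +
    WheelerIndex.nextCost (2 * c + 3), WheelerIndex.count, WheelerIndex.next, ?_⟩
  intro V E _ _ σ G π B D ident W hB hD hI _ hσ
  obtain ⟨l, T, hl, hU, hw, hT⟩ := WheelerIndex.exists_height c (Fintype.card V) σ hσ
  obtain ⟨X⟩ := WheelerIndex.exists_searchTables (G.breakKeys π D ident) l T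
    WheelerIndex.LabelledDigraph.zero_mem_breakKeys
    (fun s hs => (WheelerIndex.LabelledDigraph.breakKeys_lt hs).trans_le hU) hl
  have I := WheelerIndex.LabelledDigraph.index X hl hU hw
  have hcard := WheelerIndex.LabelledDigraph.card_breakKeys_le (ident := ident) W hD hI hB
  have hq : 0 < WheelerIndex.loglog (Fintype.card V) := Nat.succ_pos _
  refine ⟨WheelerIndex.LabelledDigraph.indexMemory X, ?_, ?_, fun P => ?_⟩
  · intro x hx
    have h1 := WheelerIndex.LabelledDigraph.indexMemory_lt X hl hU x hx
    have h2 := I.word'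
    omega
  · rw [WheelerIndex.LabelledDigraph.length_indexMemory]
    refine (Nat.mul_le_mul_left 160 hcard).trans ?_
    rw [← mul_assoc]
    exact Nat.mul_le_mul_right _ (by omega)
  · obtain ⟨t, s, he, ht, h0, ids, hnd, hmem, hrep⟩ := I.exec_queries W hD hI P
    refine ⟨t, s, he, ?_, h0, ids, hnd, hmem, ?_⟩
    · exact (ht.trans (WheelerIndex.countCost_le hT hq _)).trans (Nat.mul_le_mul_right _ (by omega))
    · exact WheelerIndex.Reports.mono ((WheelerIndex.nextCost_le hT hq).trans
        (Nat.mul_le_mul_right _ (by omega))) hrep
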